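/- A backhaul network consists of a gateway (eNB) with $R\ge 1$ RF chains, $W\ge 1$ base stations with one RF chain each, and directed downlink links $e$ of capacity $c_e>0$, each from the gateway or a base station to another base station. The expanded network replaces the gateway by $R$ nodes with the same links. A unit length schedule consists of slots of positive lengths with sum $1$ and, for each slot, a matching of the expanded network that is active during the slot. The throughput of a base station under link times $(t_e)$ is $\sum_{e\text{ entering}}c_et_e-\sum_{e\text{ leaving}}c_et_e$, and the max-min throughput $\theta^*$ is the maximum over all unit length schedules of the minimum throughput of a base station. Step (i) yields link times $t_e\ge0$ such that $\sum_{e\in\delta(v)}t_e\le 1$ for every base station $v$ and, for some $t'_k\ge 0$ ($1\le k\le\lfloor W/2\rfloor$) with $\sum_k t'_k\le 1$, the sum of $t_e$ over links between base stations is $\sum_k k\,t'_k$, and the sum of $t_e$ over links at the gateway is at most $R-\sum_k\max(0,R-W+2k)\,t'_k$. The links with $t_e>0$ are taken to contain no directed cycle. Step (ii), with granularity $t^g\in(0,1]$: split the link time of each gateway link evenly among its $R$ copies; replace each link $e$ of the expanded network by $\lceil t_e/t^g\rceil$ parallel edges, all but one with time $t^g$ and the last one with the remainder, giving a multigraph $G_m$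 of maximum degree $\Delta$; colour the edges of $G_m$ properly with $\kappa\le 3\lceil\Delta/2\rceil$ colours by Karloff's method (orient the edges, properly colour the resulting bipartite multigraph with $\lceil\Delta/2\rceil$ colours, and colour each of its classes with at most three colours of its own); schedule the edges of each colour in one slot of length $t^g$; and, if $\kappa t^g>1$, scale the schedule by $1/(\kappa t^g)$. Theorem. (a) If $R\le W$, step (ii) runs in time $O\bigl((W^2+W/t^g)\log(W+1/t^g)\bigr)$: there are one program for a real random access machine with unit cost operations and one absolute constant that achieve this for all inputs. (b) For every proper edge colouring of $G_m$ with at most $3\lceil\Delta/2\rceil$ colours, the resulting link times are those of a unit length schedule. If $\mu$ is a performance metric on link times that is multiplied by $\rho$ whenever the link times are multiplied by $\rho>0$, and its value $\mu$ after step (i) is nonnegative, then its value $\mu'$ after step (ii) satisfies $$\mu'\ \ge\ \frac{2}{3[(W+R+1)t^g+1]}\,\mu ,$$ with strict inequality if $\mu>0$. (c) Suppose that step (i) maximizes the minimum throughput $\theta$ under its constraints and, subject to this, the total traffic $\sum c_et_e$ leaving the gateway. Then $\theta^*$ exists, and the minimum throughput $\theta'$ after step (ii) satisfies $\theta'\ge\frac{2}{3[(W+R+1)t^g+1]}\theta^*$,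 with strict inequality if $\theta^*>0$; moreover $\theta^*>0$ whenever every base station can be reached from the gateway along links. For such optimal link times the absence of directed cycles is no restriction: every optimal solution can be shortened, link by link, to an optimal solution without directed cycles. -/

import Mathlib

open scoped BigOperators

namespace MmWave

/-! ## A real random access machine with a step count

A structured program over finitely many named integer and real registers and arrays.  Integers
support only addition, truncated subtraction and comparison; reals support the four field
operations and comparison, and there is no rounding from reals to integers.  Every elementary
command and every evaluation of a guard costs one step; since the expressions of a program are
fixed by the program, this is the uniform cost of the machine up to a constant factor depending on
the program only. -/

/-- The memory: integer registers and arrays, real registers and arrays. -/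
structure Mem where
  nat : ℕ → ℕ
  natArr : ℕ → ℕ → ℕ
  real : ℕ → ℝ
  realArr : ℕ → ℕ → ℝ

/-- Integer expressions; `get a i` reads entry `i` of the integer array `a`. -/
inductive NExp where
  | const (n : ℕ)
  | reg (x : ℕ)
  | get (a : ℕ) (i : NExp)
  | add (e f : NExp)
  | sub (e f : NExp)

/-- Real expressions; `cast` converts an integer to a real. -/
inductive RExp where
  | cast (e : NExp)
  | reg (x : ℕ)
  | get (a : ℕ) (i : NExp)
  | add (e f : RExp)
  | sub (e f : RExp)
  | mul (e f : RExp)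
  | div (e f : RExp)

/-- Guards. -/
inductive BExp where
  | leN (e f : NExp)
  | leR (e f : RExp)
  | not (b : BExp)
  | and (b b' : BExp)

/-- Programs. -/
inductive Prog where
  | skip
  | setN (x : ℕ) (e : NExp)
  | putN (a : ℕ) (i e : NExp)
  | setR (x : ℕ) (e : RExp)
  | putR (a : ℕ) (i : NExp) (e : RExp)
  | seq (p q : Prog)
  | ite (b : BExp) (p q : Prog)
  | loop (b : BExp) (p : Prog)

def NExp.eval (m : Mem) : NExp → ℕ
  | .const n => n
  | .reg x => m.nat x
  | .get a i => m.natArr a (i.eval m)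
  | .add e f => e.eval m + f.eval m
  | .sub e f => e.eval m - f.eval m

noncomputable def RExp.eval (m : Mem) : RExp → ℝ
  | .cast e => (e.eval m : ℝ)
  | .reg x => m.real x
  | .get a i => m.realArr a (i.eval m)
  | .add e f => e.eval m + f.eval m
  | .sub e f => e.eval m - f.eval m
  | .mul e f => e.eval m * f.eval m
  | .div e f => e.eval m / f.eval m

def BExp.holds (m : Mem) : BExp → Prop
  | .leN e f => e.eval m ≤ f.eval m
  | .leR e f => e.eval m ≤ f.eval m
  | .not b => ¬ b.holds m
  | .and b b' => b.holds m ∧ b'.holds m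

/-- `Runs p m n m'`: started in memory `m`, the program `p` halts after exactly `n` steps in
memory `m'`. -/
inductive Runs : Prog → Mem → ℕ → Mem → Prop
  | skip (m : Mem) : Runs .skip m 1 m
  | setN (m : Mem) (x : ℕ) (e : NExp) :
      Runs (.setN x e) m 1 { m with nat := Function.update m.nat x (e.eval m) }
  | putN (m : Mem) (a : ℕ) (i e : NExp) :
      Runs (.putN a i e) m 1
        { m with natArr :=
            Function.update m.natArr a (Function.update (m.natArr a) (i.eval m) (e.eval m)) }
  | setR (m : Mem) (x : ℕ) (e : RExp) :
      Runs (.setR x e) m 1 { m with real := Function.update m.real x (e.eval m) }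
  | putR (m : Mem) (a : ℕ) (i : NExp) (e : RExp) :
      Runs (.putR a i e) m 1
        { m with realArr :=
            Function.update m.realArr a (Function.update (m.realArr a) (i.eval m) (e.eval m)) }
  | seq {p q : Prog} {m m₁ m₂ : Mem} {j k : ℕ} :
      Runs p m j m₁ → Runs q m₁ k m₂ → Runs (.seq p q) m (j + k) m₂
  | iteTrue {b : BExp} {p q : Prog} {m m₁ : Mem} {j : ℕ} :
      b.holds m → Runs p m j m₁ → Runs (.ite b p q) m (j + 1) m₁
  | iteFalse {b : BExp} {p q : Prog} {m m₁ : Mem} {j : ℕ} :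
      ¬ b.holds m → Runs q m j m₁ → Runs (.ite b p q) m (j + 1) m₁
  | loopStop {b : BExp} {p : Prog} {m : Mem} :
      ¬ b.holds m → Runs (.loop b p) m 1 m
  | loopStep {b : BExp} {p : Prog} {m m₁ m₂ : Mem} {j k : ℕ} :
      b.holds m → Runs p m j m₁ → Runs (.loop b p) m₁ k m₂ →
        Runs (.loop b p) m (j + k + 1) m₂

/-! ## Multigraphs and edge colourings -/

/-- A multigraph with vertices `V` and edges `E`; each edge has two endpoints. -/
structure Multigraph (V E : Type) where
  fst : E → V
  snd : E → V

namespace Multigraph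

variable {V E : Type}

/-- Two edges have a common endpoint. -/
def Touch (G : Multigraph V E) (d d' : E) : Prop :=
  G.fst d = G.fst d' ∨ G.fst d = G.snd d' ∨ G.snd d = G.fst d' ∨ G.snd d = G.snd d'

/-- The number of edges at a vertex, loops counted twice. -/
noncomputable def degree (G : Multigraph V E) (x : V) : ℕ :=
  Nat.card {d : E // G.fst d = x} + Nat.card {d : E // G.snd d = x}

noncomputable def maxDegree [Fintype V] (G : Multigraph V E) : ℕ :=
  Finset.univ.sup G.degree

/-- `⌈Δ / 2⌉` for the maximum degree `Δ`. -/
noncomputable def halfDegree [Fintype V] (G : Multigraph V E) : ℕ :=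
  (G.maxDegree + 1) / 2

/-- Different edges with a common endpoint have different colours. -/
def IsProper (G : Multigraph V E) {κ : ℕ} (col : E → Fin κ) : Prop :=
  ∀ d d', d ≠ d' → G.Touch d d' → col d ≠ col d'

/-- The first endpoint of an edge after reversing the edges `d` with `flip d = true`. -/
def src (G : Multigraph V E) (flip : E → Bool) (d : E) : V :=
  if flip d then G.snd d else G.fst d

/-- The second endpoint of an edge after reversing the edges `d` with `flip d = true`. -/
def dst (G : Multigraph V E) (flip : E → Bool) (d : E) : V :=
  if flip d then G.fst d else G.snd d

/-- A colouring produced by the method of Karloff and Shmoys: the edges are oriented, the bipartite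
multigraph joining the out-copy of the source to the in-copy of the target of every edge is properly
edge coloured with `⌈Δ / 2⌉` colours, and the edges of each class of this colouring (paths and
cycles of the multigraph) receive at most three colours of their own, so that the resulting
colouring of the multigraph is proper and uses at most `3 ⌈Δ / 2⌉` colours. -/
def IsKarloffColouring [Fintype V] (G : Multigraph V E) {κ : ℕ} (col : E → Fin κ) : Prop :=
  G.IsProper col ∧ κ ≤ 3 * G.halfDegree ∧
    ∃ (flip : E → Bool) (cls : E → Fin G.halfDegree),
      (∀ d d', d ≠ d' → cls d = cls d' →
        G.src flip d ≠ G.src flip d' ∧ G.dst flip d ≠ G.dst flip d') ∧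
      (∀ d d', col d = col d' → cls d = cls d') ∧
      ∀ i, (col '' {d | cls d = i}).ncard ≤ 3

end Multigraph

/-! ## Backhaul networks and unit length schedules -/

/-- A downlink backhaul network with `W` base stations, before the expansion of the gateway.  The
tail of a link is the gateway (`none`) or a base station (`some u`); its head is a base station. -/
structure Network (W : ℕ) where
  link : Option (Fin W) → Fin W → Prop
  loopless : ∀ v, ¬ link (some v) v
  cap : Option (Fin W) → Fin W → ℝ
  cap_pos : ∀ u v, link u v → 0 < cap u v

/-- Link times of the links of the network (zero on pairs that are not links). -/
abbrev LinkTime (W : ℕ) := Option (Fin W) → Fin W → ℝ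

/-- The nodes after the expansion of the gateway into `R` nodes with one RF chain each. -/
abbrev Node (W R : ℕ) := Fin R ⊕ Fin W

/-- Links of the expanded network, as pairs of a tail and a head. -/
abbrev XLink (W R : ℕ) := Node W R × Fin W

/-- The node that an expanded node stems from. -/
def Node.base {W R : ℕ} : Node W R → Option (Fin W)
  | .inl _ => none
  | .inr u => some u

/-- Two links of the expanded network share a node. -/
def XLink.Touch {W R : ℕ} (e f : XLink W R) : Prop :=
  e.1 = f.1 ∨ e.1 = .inr f.2 ∨ .inr e.2 = f.1 ∨ e.2 = f.2

/-- Total link times on the network before the expansion. -/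
noncomputable def collapse {W R : ℕ} (x : XLink W R → ℝ) : LinkTime W
  | none, v => ∑ r : Fin R, x (.inl r, v)
  | some u, v => x (.inr u, v)

/-- A unit length schedule: slots of positive lengths with sum one, and in each slot a matching of
the expanded network that is active during the whole slot. -/
structure UnitSchedule {W : ℕ} (N : Network W) (R : ℕ) where
  slots : ℕ
  len : Fin slots → ℝ
  len_pos : ∀ i, 0 < len i
  len_sum : ∑ i, len i = 1
  active : Fin slots → Finset (XLink W R)
  active_link : ∀ i, ∀ e ∈ active i, N.link e.1.base e.2
  active_matching : ∀ i, ∀ e ∈ active i, ∀ f ∈ active i, e ≠ f → ¬ e.Touch f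

/-- The total active time of a link of the expanded network. -/
def UnitSchedule.time {W R : ℕ} {N : Network W} (S : UnitSchedule N R) (e : XLink W R) : ℝ :=
  ∑ i, if e ∈ S.active i then S.len i else 0

/-- The throughput of a base station: inflow minus outflow. -/
noncomputable def Network.throughput {W : ℕ} (N : Network W) (t : LinkTime W) (v : Fin W) : ℝ :=
  ∑ u, N.cap u v * t u v - ∑ w, N.cap (some v) w * t (some v) w

/-- The minimum throughput among the base stations. -/
noncomputable def Network.minThroughput {W : ℕ} (N : Network W) (t : LinkTime W) : ℝ :=
  ⨅ v, N.throughput t v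

/-- `θ` is the max-min throughput, the greatest minimum throughput of a unit length schedule. -/
def Network.IsMaxMinThroughput {W : ℕ} (N : Network W) (R : ℕ) (θ : ℝ) : Prop :=
  IsGreatest (Set.range fun S : UnitSchedule N R => N.minThroughput (collapse S.time)) θ

/-- Every base station can be reached from the gateway along links. -/
def Network.Reachable {W : ℕ} (N : Network W) : Prop :=
  ∀ v, Relation.ReflTransGen (fun a b => ∃ w, b = some w ∧ N.link a w) none (some v)

/-! ## Step (i): link times -/

/-- The constraints of the relaxation: `τ k` is the time in which exactly `k` links between base
stations are active, for `1 ≤ k ≤ ⌊W / 2⌋`. -/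
structure StepOneFeasible {W : ℕ} (N : Network W) (R : ℕ) (t : LinkTime W) : Prop where
  nonneg : ∀ u v, 0 ≤ t u v
  support : ∀ u v, ¬ N.link u v → t u v = 0
  station : ∀ v, ∑ u, t u v + ∑ w, t (some v) w ≤ 1
  idle : ∃ τ : ℕ → ℝ, (∀ k ∈ Finset.Icc 1 (W / 2), 0 ≤ τ k) ∧
    ∑ k ∈ Finset.Icc 1 (W / 2), τ k ≤ 1 ∧
    ∑ k ∈ Finset.Icc 1 (W / 2), (k : ℝ) * τ k = ∑ u, ∑ v, t (some u) v ∧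
    ∑ v, t none v ≤
      R - ∑ k ∈ Finset.Icc 1 (W / 2), max 0 ((R : ℝ) - W + 2 * k) * τ k

/-- The links with positive link time form no directed cycle. -/
def NoDirectedCycle {W : ℕ} (t : LinkTime W) : Prop :=
  ∀ v, ¬ Relation.TransGen (fun u w => 0 < t (some u) w) v v

/-- Link times computed in step (i) for maximum throughput fair scheduling: the minimum throughput
is maximal under the constraints of the relaxation, and the traffic leaving the gateway is maximal
among the feasible link times with at least this minimum throughput. -/
structure IsFairLinkTime {W : ℕ} (N : Network W) (R : ℕ) (t : LinkTime W) : Prop where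
  feasible : StepOneFeasible N R t
  fair : ∀ s, StepOneFeasible N R s → N.minThroughput s ≤ N.minThroughput t
  total : ∀ s, StepOneFeasible N R s → N.minThroughput t ≤ N.minThroughput s →
    ∑ v, N.cap none v * s none v ≤ ∑ v, N.cap none v * t none v

/-! ## Step (ii): scheduling by edge colouring with granularity `g` -/

section StepTwo

variable {W : ℕ} (R : ℕ) (g : ℝ) (t : LinkTime W)

/-- Link times on the expanded network: a link of the gateway is split evenly. -/
noncomputable def expand : XLink W R → ℝ
  | (.inl _, v) => t none v / R
  | (.inr u, v) => t (some u) v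

/-- The edges of the colouring graph: `⌈t_e / g⌉` parallel edges for every link `e`. -/
abbrev Piece := Σ e : XLink W R, Fin ⌈expand R t e / g⌉₊

/-- The colouring graph. -/
def colouringGraph : Multigraph (Node W R) (Piece R g t) where
  fst d := d.1.1
  snd d := .inr d.1.2

/-- The link time of an edge of the colouring graph: `g` for all but one of the parallel edges of a
link, and the remainder, which lies in `(0, g]`, for the last one. -/
noncomputable def pieceTime (d : Piece R g t) : ℝ :=
  if d.2.val + 1 < ⌈expand R t d.1 / g⌉₊ then g
  else expand R t d.1 - (⌈expand R t d.1 / g⌉₊ - 1) * g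

/-- The factor by which a schedule of `κ` slots of length `g` is scaled to fit in unit time. -/
noncomputable def scaleFactor (κ : ℕ) : ℝ :=
  if 1 < κ * g then 1 / (κ * g) else 1

/-- The active time of link `e` in slot `i` of the scaled schedule. -/
noncomputable def slotTime {κ : ℕ} (col : Piece R g t → Fin κ) (i : Fin κ) (e : XLink W R) : ℝ :=
  ∑ j : Fin ⌈expand R t e / g⌉₊,
    if col ⟨e, j⟩ = i then scaleFactor g κ * pieceTime R g t ⟨e, j⟩ else 0

/-- The link times achieved by step (ii) on the expanded network. -/
noncomputable def finalTime {κ : ℕ} (col : Piece R g t → Fin κ) (e : XLink W R) : ℝ :=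
  ∑ i, slotTime R g t col i e

/-- The input of step (ii): `W`, `R`, `g` and the matrix of link times stored row by row, row `0`
for the gateway and row `u + 1` for the base station `u`.  Everything else is zero. -/
noncomputable def inputMem : Mem where
  nat x := if x = 0 then W else if x = 1 then R else 0
  natArr _ _ := 0
  real x := if x = 0 then g else 0
  realArr a k :=
    if h : a = 0 ∧ k < (W + 1) * W then
      have hW : 0 < W := Nat.pos_of_ne_zero fun h0 => by simp [h0] at h
      t (if h0 : k / W = 0 then none
         else some ⟨k / W - 1, by
          have := Nat.div_lt_of_lt_mul (n := W) (k := W + 1) (m := k) (by linarith [h.2, mul_comm W (W + 1)])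
          omega⟩)
        ⟨k % W, Nat.mod_lt k hW⟩
    else 0

/-- The number of an expanded node in the output. -/
def Node.code {W R : ℕ} : Node W R → ℕ
  | .inl r => r
  | .inr u => R + u

/-- The memory holds the scaled schedule of the colouring `col`: the number of slots, their common
length, and a table with one row (tail, head, slot, active time) per edge of the colouring graph. -/
def HoldsSchedule {κ : ℕ} (col : Piece R g t → Fin κ) (m : Mem) : Prop :=
  m.nat 0 = κ ∧ m.real 0 = scaleFactor g κ * g ∧
    ∃ φ : Fin (m.nat 1) ≃ Piece R g t, ∀ k : Fin (m.nat 1),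
      m.natArr 0 k = (φ k).1.1.code ∧
      m.natArr 1 k = Node.code (.inr (φ k).1.2 : Node W R) ∧
      m.natArr 2 k = col (φ k) ∧
      m.realArr 1 k = scaleFactor g κ * pieceTime R g t (φ k)

end StepTwo

end MmWave

open MmWave

/-! Why the theorem is true.

**Quality.** The links with positive time contain no directed cycle, in particular no antiparallel
pair, so a base station meets at most `W + R - 1` of them in the expanded network. Rounding `t_e /
g` up to an integer adds at most one edge per link, whence `Δ ≤ 1 / g + W + R - 1` (`maxDegree_le`).
With `κ ≤ 3 ⌈Δ / 2⌉` slots the schedule before scaling has length `κ g ≤ 3 ((W + R) g + 1) / 2`, so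
the scale factor exceeds the claimed ratio (`lt_scaleFactor`), and the link times achieved are
exactly the scale factor times those of step (i) (`collapse_finalTime`). They are link times of a
schedule because unit length schedules are the same as points of the matching polytope
(`exists_schedule_iff`): the slots are matchings whose links need not be active all the time, but
vectors below the incidence vector of a matching lie in the polytope too
(`mem_of_support_matching`). Compactness of the polytope gives the max-min throughput, and every
point of the polytope satisfies the constraints of step (i) (`stepOneFeasible_of_mem`), which bounds
it by the throughput after step (i). A circulation along a directed cycle can be subtracted from
optimal link times, so a shortest one among their optimal shortenings has no cycle
(`exists_noDirectedCycle`).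

**Running time.** With `n = W + R` nodes and `h = ⌈Δ / 2⌉`, the program needs `O(h n log (h n))`
steps after an enumeration of the `n W` links, and `h n = O(W² + W / g)` if `R ≤ W`. All steps are
reductions to one linear time primitive, `split`: given items with two keys such that every class of
either key has even size, it halves all the classes of both keys at once, by pairing the items of
each class and two-colouring the union of the two pairings (`ev_split`).

* Padding all degrees to `2 h` and splitting the edge ends by edge and by node orients the edges
  with in-degree and out-degree `h` everywhere (`ev_orient`); this is an `h`-regular bipartite
  multigraph.
* A regular bipartite multigraph whose degree is a power of two is coloured by repeated splitting.
  For degree `D`, a `p`-regular subgraph with `p` the greatest power of two that is at most `D` is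
  found by Alon's method: give the edges multiplicity `⌊p s / D⌋` for a power of two `s ≥ D n`, fill
  up the degrees to `p s` with dummy edges, and halve all multiplicities, splitting the edges of odd
  multiplicity and rounding up on the side with fewer dummies; after `log s` rounds the dummies are
  gone (`ev_extract`). Since `p > D / 2`, colouring it pays for the search, and the remaining degree
  is less than half (`ev_colourRegular`).
* Every class of the bipartite colouring has in-degree and out-degree at most one, so a greedy pass
  with three colours for each class makes the colouring proper (`ev_threeColour`).

The programs communicate through fixed registers and arrays, and what a program may write is
computed from its text, so that everything else is known to be unchanged (`Ev.frame`). Integer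
registers: `0` holds `W` and in the end the number of slots, `1` holds `R` and in the end the number
of rows, `2` holds `n`, `3` the number of pieces, `4` holds `h`, `5` the number of edges of the
padded multigraph, `6` to `9` the state of the recursion on the degree, and those from `30` on are
working registers. Integer arrays: `0`, `1`, `2` are the columns tail, head, slot of the output,
`10`, `11`, `12` are the keys and the activity flags for `split`, `17` is its result, `20` and `21`
are the two ends of the oriented edges and `26` is the bipartite colouring; the others are tables of
the subroutines. Real array `0` is the input, `1` the time column of the output, and the real
register `0` holds `g` and in the end the common length of the slots. -/

namespace MmWave

/-! ### Total correctness with a step count for the random access machine -/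

namespace Mem

def setNat (m : Mem) (x v : ℕ) : Mem := { m with nat := Function.update m.nat x v }

def setArr (m : Mem) (a i v : ℕ) : Mem :=
  { m with natArr := Function.update m.natArr a (Function.update (m.natArr a) i v) }

def setReal (m : Mem) (x : ℕ) (v : ℝ) : Mem := { m with real := Function.update m.real x v }

def setRealArr (m : Mem) (a i : ℕ) (v : ℝ) : Mem :=
  { m with realArr := Function.update m.realArr a (Function.update (m.realArr a) i v) }

variable (m : Mem)

@[simp] theorem nat_setNat (x v y : ℕ) : (m.setNat x v).nat y = if y = x then v else m.nat y := by
  simp [setNat, Function.update_apply]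
@[simp] theorem natArr_setNat (x v : ℕ) : (m.setNat x v).natArr = m.natArr := rfl
@[simp] theorem real_setNat (x v : ℕ) : (m.setNat x v).real = m.real := rfl
@[simp] theorem realArr_setNat (x v : ℕ) : (m.setNat x v).realArr = m.realArr := rfl

@[simp] theorem nat_setArr (a i v : ℕ) : (m.setArr a i v).nat = m.nat := rfl
@[simp] theorem natArr_setArr (a i v b j : ℕ) :
    (m.setArr a i v).natArr b j = if b = a ∧ j = i then v else m.natArr b j := by
  by_cases h : b = a
  · subst h; simp [setArr, Function.update_apply]
  · simp [setArr, h]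
@[simp] theorem real_setArr (a i v : ℕ) : (m.setArr a i v).real = m.real := rfl
@[simp] theorem realArr_setArr (a i v : ℕ) : (m.setArr a i v).realArr = m.realArr := rfl

@[simp] theorem nat_setReal (x : ℕ) (v : ℝ) : (m.setReal x v).nat = m.nat := rfl
@[simp] theorem natArr_setReal (x : ℕ) (v : ℝ) : (m.setReal x v).natArr = m.natArr := rfl
@[simp] theorem real_setReal (x : ℕ) (v : ℝ) (y : ℕ) :
    (m.setReal x v).real y = if y = x then v else m.real y := by
  simp [setReal, Function.update_apply]
@[simp] theorem realArr_setReal (x : ℕ) (v : ℝ) : (m.setReal x v).realArr = m.realArr := rfl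

@[simp] theorem nat_setRealArr (a i : ℕ) (v : ℝ) : (m.setRealArr a i v).nat = m.nat := rfl
@[simp] theorem natArr_setRealArr (a i : ℕ) (v : ℝ) : (m.setRealArr a i v).natArr = m.natArr := rfl
@[simp] theorem real_setRealArr (a i : ℕ) (v : ℝ) : (m.setRealArr a i v).real = m.real := rfl
@[simp] theorem realArr_setRealArr (a i : ℕ) (v : ℝ) (b j : ℕ) :
    (m.setRealArr a i v).realArr b j = if b = a ∧ j = i then v else m.realArr b j := by
  by_cases h : b = a
  · subst h; simp [setRealArr, Function.update_apply]
  · simp [setRealArr, h]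

end Mem

instance : Add NExp := ⟨NExp.add⟩
instance : Sub NExp := ⟨NExp.sub⟩
instance (n : ℕ) : OfNat NExp n := ⟨NExp.const n⟩

/-- The value of an integer register. -/
abbrev nr : ℕ → NExp := NExp.reg
/-- The value of an entry of an integer array. -/
abbrev na : ℕ → NExp → NExp := NExp.get

@[simp] theorem NExp.eval_add' (m : Mem) (e f : NExp) : (e + f).eval m = e.eval m + f.eval m := rfl
@[simp] theorem NExp.eval_sub' (m : Mem) (e f : NExp) : (e - f).eval m = e.eval m - f.eval m := rfl
-- `no_index` is needed for `simp` to match literals such as `0` and `1`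
@[simp] theorem NExp.eval_ofNat (m : Mem) (n : ℕ) :
    (no_index (OfNat.ofNat n) : NExp).eval m = n := rfl
@[simp] theorem NExp.eval_reg (m : Mem) (x : ℕ) : (NExp.reg x).eval m = m.nat x := rfl
@[simp] theorem NExp.eval_get (m : Mem) (a : ℕ) (i : NExp) :
    (NExp.get a i).eval m = m.natArr a (i.eval m) := rfl

/-- The guard `e < f`. -/
def BExp.ltN (e f : NExp) : BExp := .not (.leN f e)
/-- The guard `e = f`. -/
def BExp.eqN (e f : NExp) : BExp := .and (.leN e f) (.leN f e)

@[simp] theorem BExp.holds_leN (m : Mem) (e f : NExp) :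
    (BExp.leN e f).holds m ↔ e.eval m ≤ f.eval m := Iff.rfl
@[simp] theorem BExp.holds_leR (m : Mem) (e f : RExp) :
    (BExp.leR e f).holds m ↔ e.eval m ≤ f.eval m := Iff.rfl
@[simp] theorem BExp.holds_not (m : Mem) (b : BExp) : (BExp.not b).holds m ↔ ¬ b.holds m := Iff.rfl
@[simp] theorem BExp.holds_and (m : Mem) (b c : BExp) :
    (BExp.and b c).holds m ↔ b.holds m ∧ c.holds m := Iff.rfl
@[simp] theorem BExp.holds_ltN (m : Mem) (e f : NExp) :
    (BExp.ltN e f).holds m ↔ e.eval m < f.eval m := by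
  simp [BExp.ltN]
@[simp] theorem BExp.holds_eqN (m : Mem) (e f : NExp) :
    (BExp.eqN e f).holds m ↔ e.eval m = f.eval m := by
  simp [BExp.eqN, le_antisymm_iff]

infixr:60 " ;; " => Prog.seq

/-- `Ev p m Q`: started in `m`, the program `p` halts after some number `n` of steps in some memory
`m'` with `Q n m'`. -/
def Ev (p : Prog) (m : Mem) (Q : ℕ → Mem → Prop) : Prop := ∃ n m', Runs p m n m' ∧ Q n m'

theorem Ev.mono {p : Prog} {m : Mem} {Q Q' : ℕ → Mem → Prop} (h : Ev p m Q)
    (hQ : ∀ n m', Q n m' → Q' n m') : Ev p m Q' := by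
  obtain ⟨n, m', hr, hq⟩ := h
  exact ⟨n, m', hr, hQ _ _ hq⟩

section rules
variable (m : Mem) (Q : ℕ → Mem → Prop)

theorem ev_skip : Ev .skip m Q ↔ Q 1 m := by
  constructor
  · rintro ⟨n, m', h, hq⟩; cases h; exact hq
  · exact fun h => ⟨_, _, .skip m, h⟩
theorem ev_setN (x : ℕ) (e : NExp) : Ev (.setN x e) m Q ↔ Q 1 (m.setNat x (e.eval m)) := by
  constructor
  · rintro ⟨n, m', h, hq⟩; cases h; exact hq
  · exact fun h => ⟨_, _, .setN m x e, h⟩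
theorem ev_putN (a : ℕ) (i e : NExp) :
    Ev (.putN a i e) m Q ↔ Q 1 (m.setArr a (i.eval m) (e.eval m)) := by
  constructor
  · rintro ⟨n, m', h, hq⟩; cases h; exact hq
  · exact fun h => ⟨_, _, .putN m a i e, h⟩
theorem ev_setR (x : ℕ) (e : RExp) : Ev (.setR x e) m Q ↔ Q 1 (m.setReal x (e.eval m)) := by
  constructor
  · rintro ⟨n, m', h, hq⟩; cases h; exact hq
  · exact fun h => ⟨_, _, .setR m x e, h⟩
theorem ev_putR (a : ℕ) (i : NExp) (e : RExp) :
    Ev (.putR a i e) m Q ↔ Q 1 (m.setRealArr a (i.eval m) (e.eval m)) := by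
  constructor
  · rintro ⟨n, m', h, hq⟩; cases h; exact hq
  · exact fun h => ⟨_, _, .putR m a i e, h⟩
theorem ev_seq (p q : Prog) :
    Ev (p ;; q) m Q ↔ Ev p m fun j m₁ => Ev q m₁ fun k m₂ => Q (j + k) m₂ := by
  constructor
  · rintro ⟨n, m', h, hq⟩
    cases h with
    | seq h1 h2 => exact ⟨_, _, h1, _, _, h2, hq⟩
  · rintro ⟨j, m₁, h1, k, m₂, h2, hq⟩
    exact ⟨_, _, .seq h1 h2, hq⟩
theorem ev_ite (b : BExp) (p q : Prog) :
    Ev (.ite b p q) m Q ↔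
      (b.holds m → Ev p m fun j => Q (j + 1)) ∧ (¬ b.holds m → Ev q m fun j => Q (j + 1)) := by
  constructor
  · rintro ⟨n, m', h, hq⟩
    cases h with
    | iteTrue hb h => exact ⟨fun _ => ⟨_, _, h, hq⟩, fun h => absurd hb h⟩
    | iteFalse hb h => exact ⟨fun h => absurd h hb, fun _ => ⟨_, _, h, hq⟩⟩
  · rintro ⟨h1, h2⟩
    by_cases hb : b.holds m
    · obtain ⟨j, m', hr, hq⟩ := h1 hb
      exact ⟨_, _, .iteTrue hb hr, hq⟩
    · obtain ⟨j, m', hr, hq⟩ := h2 hb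
      exact ⟨_, _, .iteFalse hb hr, hq⟩

end rules

/-! ### What a program may write -/

/-- A computable test whether some command in the program writes the given integer register, so that
a frame condition for a concrete program holds by `rfl`. -/
def Prog.wN : Prog → ℕ → Bool
  | .setN x _, y => x == y
  | .seq p q, y => p.wN y || q.wN y
  | .ite _ p q, y => p.wN y || q.wN y
  | .loop _ p, y => p.wN y
  | _, _ => false

/-- Whether some command in the program writes the given integer array. -/
def Prog.wA : Prog → ℕ → Bool
  | .putN x _ _, y => x == y
  | .seq p q, y => p.wA y || q.wA y
  | .ite _ p q, y => p.wA y || q.wA y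
  | .loop _ p, y => p.wA y
  | _, _ => false

/-- Whether some command in the program writes the given real register. -/
def Prog.wR : Prog → ℕ → Bool
  | .setR x _, y => x == y
  | .seq p q, y => p.wR y || q.wR y
  | .ite _ p q, y => p.wR y || q.wR y
  | .loop _ p, y => p.wR y
  | _, _ => false

/-- Whether some command in the program writes the given real array. -/
def Prog.wRA : Prog → ℕ → Bool
  | .putR x _ _, y => x == y
  | .seq p q, y => p.wRA y || q.wRA y
  | .ite _ p q, y => p.wRA y || q.wRA y
  | .loop _ p, y => p.wRA y
  | _, _ => false

/-- The memories agree on everything that `p` does not write. -/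
structure Frame (p : Prog) (m m' : Mem) : Prop where
  nat : ∀ x, p.wN x = false → m'.nat x = m.nat x
  arr : ∀ x, p.wA x = false → m'.natArr x = m.natArr x
  real : ∀ x, p.wR x = false → m'.real x = m.real x
  realArr : ∀ x, p.wRA x = false → m'.realArr x = m.realArr x

theorem Frame.refl (p : Prog) (m : Mem) : Frame p m m :=
  ⟨fun _ _ => rfl, fun _ _ => rfl, fun _ _ => rfl, fun _ _ => rfl⟩

theorem Frame.trans {p : Prog} {m m' m'' : Mem} (h : Frame p m m') (h' : Frame p m' m'') :
    Frame p m m'' :=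
  ⟨fun x hx => (h'.nat x hx).trans (h.nat x hx), fun x hx => (h'.arr x hx).trans (h.arr x hx),
    fun x hx => (h'.real x hx).trans (h.real x hx),
    fun x hx => (h'.realArr x hx).trans (h.realArr x hx)⟩

theorem Frame.weaken {p q : Prog} {m m' : Mem} (h : Frame p m m')
    (h1 : ∀ x, q.wN x = false → p.wN x = false) (h2 : ∀ x, q.wA x = false → p.wA x = false)
    (h3 : ∀ x, q.wR x = false → p.wR x = false) (h4 : ∀ x, q.wRA x = false → p.wRA x = false) :
    Frame q m m' :=
  ⟨fun x hx => h.nat x (h1 x hx), fun x hx => h.arr x (h2 x hx),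
    fun x hx => h.real x (h3 x hx), fun x hx => h.realArr x (h4 x hx)⟩

/-- A run changes nothing but what the program writes. -/
theorem Runs.frame {p : Prog} {m : Mem} {n : ℕ} {m' : Mem} (h : Runs p m n m') : Frame p m m' := by
  induction h with
  | skip m => exact Frame.refl _ _
  | setN m x e =>
    refine ⟨fun y hy => ?_, fun _ _ => rfl, fun _ _ => rfl, fun _ _ => rfl⟩
    have : y ≠ x := by rintro rfl; simp [Prog.wN] at hy
    simp [this]
  | putN m a i e =>
    refine ⟨fun _ _ => rfl, fun y hy => ?_, fun _ _ => rfl, fun _ _ => rfl⟩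
    have : y ≠ a := by rintro rfl; simp [Prog.wA] at hy
    simp [this]
  | setR m x e =>
    refine ⟨fun _ _ => rfl, fun _ _ => rfl, fun y hy => ?_, fun _ _ => rfl⟩
    have : y ≠ x := by rintro rfl; simp [Prog.wR] at hy
    simp [this]
  | putR m a i e =>
    refine ⟨fun _ _ => rfl, fun _ _ => rfl, fun _ _ => rfl, fun y hy => ?_⟩
    have : y ≠ a := by rintro rfl; simp [Prog.wRA] at hy
    simp [this]
  | seq _ _ ih1 ih2 =>
    refine Frame.trans (ih1.weaken ?_ ?_ ?_ ?_) (ih2.weaken ?_ ?_ ?_ ?_) <;>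
      simp +contextual [Prog.wN, Prog.wA, Prog.wR, Prog.wRA]
  | iteTrue _ _ ih =>
    refine ih.weaken ?_ ?_ ?_ ?_ <;> simp +contextual [Prog.wN, Prog.wA, Prog.wR, Prog.wRA]
  | iteFalse _ _ ih =>
    refine ih.weaken ?_ ?_ ?_ ?_ <;> simp +contextual [Prog.wN, Prog.wA, Prog.wR, Prog.wRA]
  | loopStop _ => exact Frame.refl _ _
  | loopStep _ _ _ ih1 ih2 =>
    exact Frame.trans (ih1.weaken (fun _ h => h) (fun _ h => h) (fun _ h => h) (fun _ h => h)) ih2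

theorem Ev.frame {p : Prog} {m : Mem} {Q : ℕ → Mem → Prop} (h : Ev p m Q) :
    Ev p m fun n m' => Frame p m m' ∧ Q n m' := by
  obtain ⟨n, m', hr, hq⟩ := h
  exact ⟨n, m', hr, hr.frame, hq⟩

/-- The rule for loops: an invariant `I`, which also sees the number of steps made so far, and a
variant `μ`. -/
theorem ev_loop {b : BExp} {p : Prog} {m : Mem} {Q : ℕ → Mem → Prop} (I : ℕ → Mem → Prop)
    (μ : Mem → ℕ) (h0 : I 0 m)
    (hs : ∀ k m₁, Frame p m m₁ → I k m₁ → b.holds m₁ →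
      Ev p m₁ fun n m₂ => I (k + n + 1) m₂ ∧ μ m₂ < μ m₁)
    (hQ : ∀ k m', Frame p m m' → I k m' → ¬ b.holds m' → Q (k + 1) m') :
    Ev (.loop b p) m Q := by
  have key : ∀ c k m₁, Frame p m m₁ → I k m₁ → μ m₁ < c →
      ∃ n m', Runs (.loop b p) m₁ n m' ∧ Q (k + n) m' := by
    intro c
    induction c with
    | zero => intro k m₁ _ _ h; omega
    | succ c ih =>
      intro k m₁ hF hI hc
      by_cases hb : b.holds m₁
      · obtain ⟨n, m₂, hr, hI2, hlt⟩ := hs k m₁ hF hI hb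
        obtain ⟨n', m', hr', hq⟩ := ih (k + n + 1) m₂ (hF.trans hr.frame) hI2 (by omega)
        exact ⟨_, _, .loopStep hb hr hr', by convert hq using 1; omega⟩
      · exact ⟨_, _, .loopStop hb, hQ _ _ hF hI hb⟩
  obtain ⟨n, m', hr, hq⟩ := key (μ m + 1) 0 m (Frame.refl _ _) h0 (by omega)
  exact ⟨n, m', hr, by simpa using hq⟩

/-- `for i < b do p`. -/
def forLoop (i : ℕ) (b : NExp) (p : Prog) : Prog :=
  .setN i 0 ;; .loop (.ltN (nr i) b) (p ;; .setN i (nr i + 1))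

/-- The rule for counting loops.  The invariant `I j k` holds after `j` rounds, in which the bodies
made `k` steps. -/
theorem ev_forLoop' {i : ℕ} {b : NExp} {p : Prog} {m : Mem} {Q : ℕ → Mem → Prop}
    (N : ℕ) (I : ℕ → ℕ → Mem → Prop) (hi : p.wN i = false)
    (hb : ∀ m', Frame (forLoop i b p) m m' → b.eval m' = N)
    (h0 : I 0 0 m) (hI : ∀ j k m v, I j k m → I j k (m.setNat i v))
    (hs : ∀ j k m₁, j < N → m₁.nat i = j → Frame (forLoop i b p) m m₁ → I j k m₁ →
      Ev p m₁ fun n m₂ => I (j + 1) (k + n) m₂)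
    (hQ : ∀ k m', Frame (forLoop i b p) m m' → m'.nat i = N → I N k m' → Q (k + 2 * N + 2) m') :
    Ev (forLoop i b p) m Q := by
  have hw : (forLoop i b p).wN i = true := by simp [forLoop, Prog.wN]
  have fr : ∀ m₁ v, Frame (forLoop i b p) m m₁ → Frame (forLoop i b p) m (m₁.setNat i v) := by
    intro m₁ v h
    refine ⟨fun x hx => ?_, h.arr, h.real, h.realArr⟩
    have : x ≠ i := by rintro rfl; simp [hw] at hx
    simp [this, h.nat x hx]
  have fr2 : ∀ m₁ m₂, Frame (forLoop i b p) m m₁ → Frame p m₁ m₂ → Frame (forLoop i b p) m m₂ := by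
    intro m₁ m₂ h h'
    refine h.trans (h'.weaken ?_ ?_ ?_ ?_) <;>
      simp +contextual [forLoop, Prog.wN, Prog.wA, Prog.wR, Prog.wRA]
  unfold forLoop
  rw [ev_seq, ev_setN]
  refine ev_loop (fun k m₁ => Frame (forLoop i b p) m m₁ ∧ ∃ j k', j ≤ N ∧ m₁.nat i = j ∧
    k = k' + 2 * j ∧ I j k' m₁) (fun m₁ => N - m₁.nat i)
    ⟨fr _ _ (Frame.refl _ _), 0, 0, by simp, by simp, by simp, hI _ _ _ _ h0⟩ ?_ ?_
  · rintro k m₁ - ⟨hF, j, k', hj, hij, rfl, hinv⟩ hb'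
    simp only [BExp.holds_ltN, NExp.eval_reg, hb m₁ hF] at hb'
    rw [ev_seq]
    refine (hs j k' m₁ (by omega) hij hF hinv).frame.mono ?_
    rintro n m₂ ⟨hf, h2⟩
    have e : m₂.nat i = j := (hf.nat i hi).trans hij
    rw [ev_setN]
    have : (nr i + 1).eval m₂ = j + 1 := by simp [e]
    rw [this]
    refine ⟨⟨fr _ _ (fr2 _ _ hF hf), j + 1, k' + n, by omega, by simp, by omega, hI _ _ _ _ h2⟩, ?_⟩
    simp; omega
  · rintro k m' - ⟨hF, j, k', hj, hij, rfl, hinv⟩ hb'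
    simp only [BExp.holds_ltN, NExp.eval_reg, hb m' hF] at hb'
    obtain rfl : j = N := by omega
    have := hQ k' m' hF hij hinv
    convert this using 1
    omega

/-- The rule for counting loops whose body has bounded cost. -/
theorem ev_forLoop {i : ℕ} {b : NExp} {p : Prog} {m : Mem} {Q : ℕ → Mem → Prop}
    (N c : ℕ) (I : ℕ → Mem → Prop) (hi : p.wN i = false)
    (hb : ∀ m', Frame (forLoop i b p) m m' → b.eval m' = N)
    (h0 : I 0 m) (hI : ∀ j m v, I j m → I j (m.setNat i v))
    (hs : ∀ j m₁, j < N → m₁.nat i = j → Frame (forLoop i b p) m m₁ → I j m₁ →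
      Ev p m₁ fun n m₂ => n ≤ c ∧ I (j + 1) m₂)
    (hQ : ∀ k m', k ≤ (c + 2) * N + 2 → Frame (forLoop i b p) m m' → m'.nat i = N → I N m' →
      Q k m') :
    Ev (forLoop i b p) m Q := by
  refine ev_forLoop' N (fun j k m => k ≤ c * j ∧ I j m) hi hb ⟨by simp, h0⟩
    (fun j k m v h => ⟨h.1, hI _ _ _ h.2⟩) ?_ ?_
  · rintro j k m₁ hj hij hF ⟨hk, h⟩
    refine (hs j m₁ hj hij hF h).mono ?_
    rintro n m₂ ⟨hn, h2⟩
    exact ⟨by rw [Nat.mul_succ]; omega, h2⟩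
  · rintro k m' hF hi' ⟨hk, h⟩
    exact hQ _ _ (by rw [Nat.add_mul]; omega) hF hi' h

/-! ### Splitting items evenly with respect to two keys -/

/-- The active items below `M` with key `k`. -/
def keyClass (M : ℕ) (act : ℕ → Prop) [DecidablePred act] (K : ℕ → ℕ) (k : ℕ) : Finset ℕ :=
  (Finset.range M).filter fun j => act j ∧ K j = k

/-- `f` pairs off the active items below `M`; both items of a pair have the same key. -/
structure IsPairing (M : ℕ) (act : ℕ → Prop) (K f : ℕ → ℕ) : Prop where
  lt : ∀ j < M, act j → f j < M
  active : ∀ j < M, act j → act (f j)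
  ne : ∀ j < M, act j → f j ≠ j
  invol : ∀ j < M, act j → f (f j) = j
  key : ∀ j < M, act j → K (f j) = K j

/-- The state of the pairing loop after `i` rounds: `tab k` is zero or one more than the item with
key `k` that still waits for a partner. -/
structure PairInv (i : ℕ) (act : ℕ → Prop) [DecidablePred act] (K tab mate : ℕ → ℕ) : Prop where
  wait : ∀ k, tab k ≠ 0 → tab k - 1 < i ∧ act (tab k - 1) ∧ K (tab k - 1) = k
  done : ∀ j < i, act j → tab (K j) = j + 1 ∨ (tab (K j) ≠ j + 1 ∧ mate j < i ∧ act (mate j) ∧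
    mate j ≠ j ∧ mate (mate j) = j ∧ K (mate j) = K j ∧ tab (K j) ≠ mate j + 1)
  parity : ∀ k, Even (keyClass i act K k).card ↔ tab k = 0

section pairing
variable {i : ℕ} {act : ℕ → Prop} [DecidablePred act] {K tab mate tab' mate' : ℕ → ℕ}

theorem keyClass_succ (k : ℕ) : (keyClass (i + 1) act K k).card =
    (keyClass i act K k).card + if act i ∧ K i = k then 1 else 0 := by
  unfold keyClass
  rw [Finset.range_add_one, Finset.filter_insert]
  split_ifs <;> simp

theorem PairInv.zero (h : ∀ k, tab k = 0) : PairInv 0 act K tab mate :=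
  ⟨fun k hk => absurd (h k) hk, fun j hj => absurd hj (Nat.not_lt_zero _),
    fun k => by simp [keyClass, h]⟩

theorem PairInv.step_inactive (h : PairInv i act K tab mate) (hi : ¬ act i) :
    PairInv (i + 1) act K tab mate where
  wait k hk := by have := h.wait k hk; grind
  done j hj ha := by
    have : j ≠ i := by rintro rfl; exact hi ha
    have := h.done j (by omega) ha
    grind
  parity k := by rw [keyClass_succ]; simp [hi, h.parity]

theorem PairInv.step_wait (h : PairInv i act K tab mate) (hi : act i) (h0 : tab (K i) = 0)
    (ht : ∀ k, tab' k = if k = K i then i + 1 else tab k) (hm : ∀ k, mate' k = mate k) :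
    PairInv (i + 1) act K tab' mate' where
  wait k hk := by
    have := h.wait k
    rw [ht] at *
    grind
  done j hj ha := by
    rcases Nat.lt_succ_iff_lt_or_eq.1 hj with hj | rfl
    · have := h.done j hj ha
      obtain rfl : mate' = mate := funext hm
      rw [ht]
      grind
    · left; simp [ht]
  parity k := by
    rw [keyClass_succ, ht]
    have := h.parity k
    by_cases hk : K i = k
    · subst hk
      simp [hi, h0, h.parity, Nat.even_add_one]
    · have hk' : ¬ k = K i := fun h => hk h.symm
      simp [hk, hk', this]

theorem PairInv.step_match (h : PairInv i act K tab mate) (hi : act i) (h0 : tab (K i) ≠ 0)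
    (ht : ∀ k, tab' k = if k = K i then 0 else tab k)
    (hm : ∀ k, mate' k = if k = tab (K i) - 1 then i else if k = i then tab (K i) - 1 else mate k) :
    PairInv (i + 1) act K tab' mate' where
  wait k hk := by
    have := h.wait k
    rw [ht] at *
    grind
  done j hj ha := by
    obtain ⟨hw1, hw2, hw3⟩ := h.wait _ h0
    generalize hp : tab (K i) - 1 = p at *
    have hpe : tab (K i) = p + 1 := by omega
    by_cases hji : j = i
    · subst hji
      right
      have e1 : mate' j = p := by rw [hm]; grind
      have e2 : mate' p = j := by rw [hm]; grind
      have e3 : tab' (K j) = 0 := by simp [ht]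
      rw [e1, e2, e3]; grind
    by_cases hjp : j = p
    · subst hjp
      right
      have e1 : mate' j = i := by rw [hm]; grind
      have e2 : mate' i = j := by rw [hm]; grind
      have e3 : tab' (K j) = 0 := by simp [ht, hw3]
      rw [e1, e2, e3]; grind
    have e1 : mate' j = mate j := by rw [hm]; grind
    have h3 := h.done j (by omega) ha
    have hwj := h.wait (K j)
    rcases h3 with h3 | ⟨h3, h4, h5, h6, h7, h8, h9⟩
    · left
      have : K j ≠ K i := by intro h; rw [h, hpe] at h3; omega
      rw [ht]; grind
    · right
      have hmp : mate j ≠ p := by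
        intro h
        rw [h] at h8 h9
        rw [← h8, hw3] at h9
        omega
      have e2 : mate' (mate j) = mate (mate j) := by rw [hm]; grind
      rw [e1, e2, ht]; grind
  parity k := by
    rw [keyClass_succ, ht]
    have := h.parity k
    by_cases hk : K i = k
    · subst hk
      have h2 : ¬ Even (keyClass i act K (K i)).card := fun h => h0 (this.1 h)
      simp [hi, Nat.even_add_one, h2]
    · have hk' : ¬ k = K i := fun h => hk h.symm
      simp [hk, hk', this]

/-- If all classes are even, then nobody waits for a partner in the end. -/
theorem PairInv.isPairing (h : PairInv i act K tab mate)
    (he : ∀ k, Even (keyClass i act K k).card) :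
    (∀ k, tab k = 0) ∧ IsPairing i act K mate := by
  have h0 : ∀ k, tab k = 0 := fun k => (h.parity k).1 (he k)
  have := fun j hj ha => h.done j hj ha
  simp only [h0] at this
  exact ⟨h0, fun j hj ha => by grind, fun j hj ha => by grind, fun j hj ha => by grind,
    fun j hj ha => by grind, fun j hj ha => by grind⟩

end pairing

/-- Pair off the active items with equal keys. -/
def pairUp (K mate : ℕ) : Prog :=
  forLoop 31 (nr 30) <| .ite (.eqN (na 12 (nr 31)) 1)
    (.setN 32 (na K (nr 31)) ;; .setN 33 (na 13 (nr 32)) ;; .ite (.eqN (nr 33) 0)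
      (.putN 13 (nr 32) (nr 31 + 1))
      (.putN mate (nr 31) (nr 33 - 1) ;; .putN mate (nr 33 - 1) (nr 31) ;; .putN 13 (nr 32) 0))
    .skip

theorem ev_pairUp {K mate M : ℕ} {m : Mem} (hK : K ≠ 13 ∧ K ≠ mate) (hm : mate ≠ 12 ∧ mate ≠ 13)
    (hM : m.nat 30 = M) (h0 : ∀ k, m.natArr 13 k = 0)
    (he : ∀ k, Even (keyClass M (m.natArr 12 · = 1) (m.natArr K) k).card) :
    Ev (pairUp K mate) m fun n m' => n ≤ 9 * M + 2 ∧ (∀ k, m'.natArr 13 k = 0) ∧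
      IsPairing M (m.natArr 12 · = 1) (m.natArr K) (m'.natArr mate) := by
  obtain ⟨hK1, hK2⟩ := hK
  obtain ⟨hm1, hm2⟩ := hm
  refine ev_forLoop M 7 (fun i m₁ => PairInv i (m.natArr 12 · = 1) (m.natArr K) (m₁.natArr 13)
    (m₁.natArr mate)) (by rfl) (fun m' hF => ?_) (PairInv.zero h0) (fun _ _ _ h => h) ?_ ?_
  · simp [hF.nat 30 (by rfl), hM]
  · intro i m₁ hi hr hF hI
    have fa : m₁.natArr 12 = m.natArr 12 := hF.arr 12 (by simp [forLoop, Prog.wA, hm1])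
    have fk : m₁.natArr K = m.natArr K := hF.arr K (by simp [forLoop, Prog.wA]; omega)
    simp only [ev_ite, ev_seq, ev_setN, ev_putN, ev_skip]
    simp [hr, fa, fk]
    refine ⟨fun ha => ⟨fun hz => hI.step_wait ha hz (fun k => ?_) fun k => ?_,
      fun hz => hI.step_match ha hz
      (fun k => ?_) fun k => ?_⟩, fun ha => hI.step_inactive ha⟩
    · simp
    · simp [hm2]
    · simp [hm2.symm]
    · simp [hm2]
  · intro k m' hk hF _ hI
    have := hI.isPairing he
    exact ⟨hk, this⟩

/-- The coloured items (those `j` with `bit j ≠ 2`) have bit `0` or `1`, and their partners have the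
other bit. -/
def Alternates (M : ℕ) (act : ℕ → Prop) (f g bit : ℕ → ℕ) : Prop :=
  ∀ j < M, act j → bit j ≠ 2 → bit j < 2 ∧ bit (f j) = 1 - bit j ∧ bit (g j) = 1 - bit j

/-- The state of a walk that started at `s` and is about to colour `x`: either `x = s`, or the last
coloured item `y` is the partner of `x`, and `s` and `y` are the only coloured items whose second
partner is not yet known to be coloured. -/
def Walking (M : ℕ) (act : ℕ → Prop) (f g bit : ℕ → ℕ) (s x : ℕ) : Prop :=
  (bit s = 2 ∧ x = s ∧ Alternates M act f g bit) ∨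
  ∃ y < M, act y ∧ bit y = 1 ∧ g y = x ∧ bit s = 0 ∧ ∀ j < M, act j → bit j ≠ 2 →
    bit j < 2 ∧ bit (f j) = 1 - bit j ∧
      (j = s ∨ j = y ∨ (bit (g j) = 1 - bit j ∧ g j ≠ s ∧ g j ≠ y))

section walk
variable {M : ℕ} {act : ℕ → Prop} {K K' f g bit bit' : ℕ → ℕ} {s x : ℕ}

/-- Colouring `x` and its first partner, and moving on to the second partner of the latter. -/
theorem Walking.step (hf : IsPairing M act K f) (hg : IsPairing M act K' g)
    (h : Walking M act f g bit s x) (hx : x < M) (ha : act x) (h2 : bit x = 2)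
    (hb : ∀ j, bit' j = if j = f x then 1 else if j = x then 0 else bit j) :
    Walking M act f g bit' s (g (f x)) := by
  have hfx := hf.ne x hx ha
  have hf2 : bit (f x) = 2 := by
    by_contra hc
    have h3 : bit (f x) < 2 ∧ bit (f (f x)) = 1 - bit (f x) := by
      rcases h with ⟨_, _, h⟩ | ⟨y, _, _, _, _, _, h⟩ <;>
        have := h (f x) (hf.lt x hx ha) (hf.active x hx ha) hc <;> exact ⟨this.1, this.2.1⟩
    rw [hf.invol x hx ha] at h3
    omega
  have e1 : bit' (f x) = 1 := by rw [hb]; simp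
  have e2 : bit' x = 0 := by rw [hb]; simp [hfx.symm]
  have e3 : ∀ j, bit j ≠ 2 → bit' j = bit j := by
    intro j hj; rw [hb]; grind
  refine Or.inr ⟨f x, hf.lt x hx ha, hf.active x hx ha, e1, rfl, ?_, ?_⟩
  · rcases h with ⟨h3, rfl, h⟩ | ⟨y, _, _, _, _, h3, h⟩
    · exact e2
    · rw [e3 s (by omega), h3]
  · intro j hj haj hj2
    by_cases j1 : j = f x
    · subst j1; rw [e1, hf.invol x hx ha, e2]; simp
    by_cases j2 : j = x
    · subst j2; rw [e2, e1]
      rcases h with ⟨h3, rfl, h⟩ | ⟨y, hy, hya, hy1, hyg, hs0, h⟩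
      · simp
      · have : g j = y := by rw [← hyg, hg.invol y hy hya]
        rw [this, e3 y (by omega), hy1]
        refine ⟨by simp, by simp, Or.inr (Or.inr ⟨by simp, ?_, ?_⟩)⟩
        · rintro rfl; omega
        · rintro rfl; omega
    have hjb : bit' j = bit j := by rw [hb]; simp [j1, j2]
    rw [hjb] at hj2 ⊢
    rcases h with ⟨h3, rfl, h⟩ | ⟨y, hy, hya, hy1, hyg, hs0, h⟩
    · obtain ⟨a, b, c⟩ := h j hj haj hj2
      rw [e3 (f j) (by omega), e3 (g j) (by omega), b, c]
      refine ⟨a, rfl, Or.inr (Or.inr ⟨rfl, ?_, ?_⟩)⟩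
      · intro h; rw [h] at c; omega
      · intro h; rw [h] at c; omega
    · obtain ⟨a, b, c⟩ := h j hj haj hj2
      rw [e3 (f j) (by omega), b]
      refine ⟨a, rfl, ?_⟩
      rcases c with c | c | ⟨c, c1, c2⟩
      · exact Or.inl c
      · subst c
        right; right
        rw [hyg, e2, hy1]
        refine ⟨by simp, ?_, hfx.symm⟩
        rintro rfl; omega
      · right; right
        rw [e3 (g j) (by omega)]
        refine ⟨c, c1, ?_⟩
        intro h; rw [h] at c; omega

/-- A walk can return only to its start: the second partner of every other coloured item differs
from the last coloured item `y`. -/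
theorem Walking.finish (hg : IsPairing M act K' g)
    (h : Walking M act f g bit s x) (hx : x < M) (ha : act x) (h2 : bit x ≠ 2) :
    Alternates M act f g bit ∧ bit s ≠ 2 := by
  rcases h with ⟨h3, rfl, h⟩ | ⟨y, hy, hya, hy1, hyg, hs0, h⟩
  · exact absurd h3 h2
  have gx : g x = y := by rw [← hyg, hg.invol y hy hya]
  have hxs : x = s := by
    rcases (h x hx ha h2).2.2 with c | c | ⟨c, c1, c2⟩
    · exact c
    · exact absurd (c ▸ hyg) (hg.ne y hy hya)
    · exact absurd gx c2
  subst hxs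
  refine ⟨fun j hj haj hj2 => ?_, by omega⟩
  obtain ⟨a, b, c⟩ := h j hj haj hj2
  refine ⟨a, b, ?_⟩
  rcases c with rfl | rfl | ⟨c, -, -⟩
  · rw [gx, hs0, hy1]
  · rw [hyg, hs0, hy1]
  · exact c

end walk

/-- The number of items that have no bit yet. -/
def uncoloured (M : ℕ) (bit : ℕ → ℕ) : ℕ := ((Finset.range M).filter fun j => bit j = 2).card

/-- Give all items on the cycle through the item in register `31` alternating bits. -/
def walk : Prog :=
  .setN 32 (nr 31) ;; .loop (.eqN (na 17 (nr 32)) 2)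
    (.putN 17 (nr 32) 0 ;; .setN 33 (na 15 (nr 32)) ;; .putN 17 (nr 33) 1 ;;
      .setN 32 (na 16 (nr 33)))

/-- The steps of a walk are paid for by the items that it colours. -/
theorem ev_walk {M s : ℕ} {act : ℕ → Prop} {K K' : ℕ → ℕ} {m : Mem} (hs : m.nat 31 = s)
    (hsM : s < M) (has : act s) (h2 : m.natArr 17 s = 2)
    (hf : IsPairing M act K (m.natArr 15)) (hg : IsPairing M act K' (m.natArr 16))
    (h : Alternates M act (m.natArr 15) (m.natArr 16) (m.natArr 17)) :
    Ev walk m fun n m' =>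
      n + 5 * uncoloured M (m'.natArr 17) ≤ 5 * uncoloured M (m.natArr 17) + 2 ∧
      Alternates M act (m.natArr 15) (m.natArr 16) (m'.natArr 17) ∧ m'.natArr 17 s ≠ 2 ∧
      ∀ j, m.natArr 17 j ≠ 2 → m'.natArr 17 j ≠ 2 := by
  unfold walk
  rw [ev_seq, ev_setN]
  simp only [NExp.eval_reg, hs]
  refine ev_loop (fun k m₁ => k + 5 * uncoloured M (m₁.natArr 17) ≤ 5 * uncoloured M (m.natArr 17) ∧
      m₁.nat 32 < M ∧ act (m₁.nat 32) ∧
      Walking M act (m.natArr 15) (m.natArr 16) (m₁.natArr 17) s (m₁.nat 32) ∧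
      ∀ j, m.natArr 17 j ≠ 2 → m₁.natArr 17 j ≠ 2)
    (fun m₁ => uncoloured M (m₁.natArr 17)) ?_ ?_ ?_
  · simp [hsM, has]
    exact Or.inl ⟨h2, rfl, h⟩
  · rintro k m₁ hF ⟨hk, hxM, hax, hw, hmono⟩ hb
    have f15 : m₁.natArr 15 = m.natArr 15 := hF.arr 15 (by rfl)
    have f16 : m₁.natArr 16 = m.natArr 16 := hF.arr 16 (by rfl)
    generalize hx : m₁.nat 32 = x at *
    simp [hx] at hb
    simp only [ev_seq, ev_setN, ev_putN]
    simp [hx, f15, f16]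
    set m₂ :=
      ((((m₁.setArr 17 x 0).setNat 33 (m.natArr 15 x)).setArr 17 (m.natArr 15 x) 1).setNat 32
      (m.natArr 16 (m.natArr 15 x)))
    have hb2 : ∀ j, m₂.natArr 17 j = if j = m.natArr 15 x then 1 else if j = x then 0 else
        m₁.natArr 17 j := by intro j; simp [m₂]
    have hlt : uncoloured M (m₂.natArr 17) < uncoloured M (m₁.natArr 17) := by
      refine Finset.card_lt_card (Finset.ssubset_iff_of_subset ?_ |>.2 ⟨x, ?_, ?_⟩)
      · intro j; simp only [Finset.mem_filter, hb2]; grind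
      · simp [hxM, hb]
      · simp only [Finset.mem_filter, hb2]; grind
    have hfx := hf.lt x hxM hax
    have hfa := hf.active x hxM hax
    refine ⟨⟨by simp only [m₂, Mem.natArr_setNat] at hlt; omega, hg.lt _ hfx hfa,
      hg.active _ hfx hfa, hw.step hf hg hxM hax hb hb2, ?_⟩, hlt⟩
    intro j hj
    have := hmono j hj
    grind
  · rintro k m' hF ⟨hk, hxM, hax, hw, hmono⟩ hb
    simp at hb
    have := hw.finish hg hxM hax hb
    exact ⟨by omega, this.1, this.2, hmono⟩

/-- Give every active item below register `30` a bit such that in every class of active items with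
equal first key, and in every class with equal second key, both bits are equally frequent. -/
def split : Prog :=
  pairUp 10 15 ;; pairUp 11 16 ;; forLoop 31 (nr 30) (.putN 17 (nr 31) 2) ;;
  forLoop 31 (nr 30)
    (.ite (.and (.eqN (na 12 (nr 31)) 1) (.eqN (na 17 (nr 31)) 2)) walk .skip)

/-- The bits are distributed evenly among the active items with equal key. -/
def Balanced (M : ℕ) (act : ℕ → Prop) (K bit : ℕ → ℕ) : Prop :=
  ∃ f, IsPairing M act K f ∧ ∀ j < M, act j → bit (f j) = 1 - bit j

/-- Halving the classes of two keys at once takes linear time: the union of the two pairings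
consists of even cycles, and alternate items of each cycle receive different bits. -/
theorem ev_split {M : ℕ} {m : Mem} (hM : m.nat 30 = M) (h0 : ∀ k, m.natArr 13 k = 0)
    (he1 : ∀ k, Even (keyClass M (m.natArr 12 · = 1) (m.natArr 10) k).card)
    (he2 : ∀ k, Even (keyClass M (m.natArr 12 · = 1) (m.natArr 11) k).card) :
    Ev split m fun n m' => n ≤ 32 * M + 8 ∧ (∀ k, m'.natArr 13 k = 0) ∧
      (∀ j < M, m.natArr 12 j = 1 → m'.natArr 17 j < 2) ∧
      Balanced M (m.natArr 12 · = 1) (m.natArr 10) (m'.natArr 17) ∧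
      Balanced M (m.natArr 12 · = 1) (m.natArr 11) (m'.natArr 17) := by
  unfold split
  rw [ev_seq]
  refine (ev_pairUp (by decide) (by decide) hM h0 he1).frame.mono ?_
  rintro n₁ m₁ ⟨F₁, ht₁, z₁, p₁⟩
  rw [ev_seq]
  have a12 : m₁.natArr 12 = m.natArr 12 := F₁.arr 12 (by rfl)
  have a10 : m₁.natArr 10 = m.natArr 10 := F₁.arr 10 (by rfl)
  have a11 : m₁.natArr 11 = m.natArr 11 := F₁.arr 11 (by rfl)
  have hM₁ : m₁.nat 30 = M := (F₁.nat 30 (by rfl)).trans hM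
  refine (ev_pairUp (by decide) (by decide) hM₁ z₁ (by rw [a12, a11]; exact he2)).frame.mono ?_
  rintro n₂ m₂ ⟨F₂, ht₂, z₂, p₂⟩
  rw [a12, a11] at p₂
  have b12 : m₂.natArr 12 = m.natArr 12 := (F₂.arr 12 (by rfl)).trans a12
  have b15 : m₂.natArr 15 = m₁.natArr 15 := F₂.arr 15 (by rfl)
  have hM₂ : m₂.nat 30 = M := (F₂.nat 30 (by rfl)).trans hM₁
  rw [← b15] at p₁
  rw [ev_seq]
  refine ev_forLoop M 1 (fun i m' => ∀ j < i, m'.natArr 17 j = 2) (by rfl)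
    (fun m' hF => by simp [hF.nat 30 (by rfl), hM₂]) (by simp) (fun _ _ _ h => h) ?_ ?_
  · intro i m' hi hr hF hI
    rw [ev_putN]
    simp [hr]
    intro j hj
    have := hI j
    grind
  · intro n₃ m₃ ht₃ F₃ _ hI
    have c12 : m₃.natArr 12 = m.natArr 12 := (F₃.arr 12 (by rfl)).trans b12
    have c13 : m₃.natArr 13 = m₂.natArr 13 := F₃.arr 13 (by rfl)
    have c15 : m₃.natArr 15 = m₂.natArr 15 := F₃.arr 15 (by rfl)
    have c16 : m₃.natArr 16 = m₂.natArr 16 := F₃.arr 16 (by rfl)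
    have hM₃ : m₃.nat 30 = M := (F₃.nat 30 (by rfl)).trans hM₂
    rw [← c15] at p₁
    rw [← c16] at p₂
    have hU : uncoloured M (m₃.natArr 17) ≤ M := by
      simpa [uncoloured] using Finset.card_filter_le (Finset.range M) (fun j => m₃.natArr 17 j = 2)
    refine ev_forLoop' M (fun i k m' => k + 5 * uncoloured M (m'.natArr 17) ≤ 5 * M + 4 * i ∧
      Alternates M (m.natArr 12 · = 1) (m₃.natArr 15) (m₃.natArr 16) (m'.natArr 17) ∧
      ∀ j < i, m.natArr 12 j = 1 → m'.natArr 17 j ≠ 2) (by rfl)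
      (fun m' hF => by simp [hF.nat 30 (by rfl), hM₃]) ?_ (fun _ _ _ _ h => h) ?_ ?_
    · exact ⟨by omega, fun j hj _ h => absurd (hI j hj) h, by simp⟩
    · rintro i k m' hi hr hF ⟨hk, halt, hdone⟩
      have d12 : m'.natArr 12 = m.natArr 12 := (hF.arr 12 (by rfl)).trans c12
      have d15 : m'.natArr 15 = m₃.natArr 15 := hF.arr 15 (by rfl)
      have d16 : m'.natArr 16 = m₃.natArr 16 := hF.arr 16 (by rfl)
      rw [ev_ite]
      simp only [BExp.holds_and, BExp.holds_eqN, NExp.eval_get, NExp.eval_reg, NExp.eval_ofNat,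
        hr, d12]
      refine ⟨?_, ?_⟩
      · rintro ⟨ha, hb⟩
        rw [← d15] at p₁
        rw [← d16] at p₂
        rw [← d15, ← d16] at halt
        refine (ev_walk hr hi ha hb p₁ p₂ halt).mono ?_
        rintro n m'' ⟨hn, halt', hc, hmono⟩
        rw [d15, d16] at halt'
        refine ⟨by omega, halt', fun j hj hja => ?_⟩
        rcases Nat.lt_succ_iff_lt_or_eq.1 hj with hj | rfl
        · exact hmono j (hdone j hj hja)
        · exact hc
      · intro hb
        rw [ev_skip]
        refine ⟨by omega, halt, fun j hj hja => ?_⟩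
        rcases Nat.lt_succ_iff_lt_or_eq.1 hj with hj | rfl
        · exact hdone j hj hja
        · exact fun h => hb ⟨hja, h⟩
    · rintro k m' hF - ⟨hk, halt, hdone⟩
      refine ⟨by omega, ?_, ?_, ⟨_, p₁, ?_⟩, ⟨_, p₂, ?_⟩⟩
      · rw [hF.arr 13 (by rfl), c13]; exact z₂
      · exact fun j hj ha => (halt j hj ha (hdone j hj ha)).1
      · exact fun j hj ha => (halt j hj ha (hdone j hj ha)).2.1
      · exact fun j hj ha => (halt j hj ha (hdone j hj ha)).2.2

theorem Balanced.card_eq {M : ℕ} {act : ℕ → Prop} [DecidablePred act] {K bit : ℕ → ℕ}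
    (h : Balanced M act K bit) (k : ℕ) :
    ((keyClass M act K k).filter (bit · = 0)).card =
      ((keyClass M act K k).filter (bit · = 1)).card := by
  obtain ⟨f, hf, hb⟩ := h
  have hmem : ∀ a b, a ∈ (keyClass M act K k).filter (bit · = b) →
      a < M ∧ act a ∧ K a = k ∧ bit a = b := by
    intro a b; simp only [keyClass, Finset.mem_filter, Finset.mem_range]; tauto
  refine Finset.card_bij' (fun a _ => f a) (fun a _ => f a) ?_ ?_ ?_ ?_
  · intro a ha
    obtain ⟨h1, h2, h3, h4⟩ := hmem _ _ ha
    simp [keyClass, hf.lt a h1 h2, hf.active a h1 h2, hf.key a h1 h2, h3, hb a h1 h2, h4]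
  · intro a ha
    obtain ⟨h1, h2, h3, h4⟩ := hmem _ _ ha
    simp [keyClass, hf.lt a h1 h2, hf.active a h1 h2, hf.key a h1 h2, h3, hb a h1 h2, h4]
  · intro a ha
    obtain ⟨h1, h2, h3, h4⟩ := hmem _ _ ha
    exact hf.invol a h1 h2
  · intro a ha
    obtain ⟨h1, h2, h3, h4⟩ := hmem _ _ ha
    exact hf.invol a h1 h2

/-! ### Halving integral edge weights -/

/-- The total weight of the items below `M` with key `k`. -/
def weightAt (M : ℕ) (K wt : ℕ → ℕ) (k : ℕ) : ℕ :=
  ∑ i ∈ Finset.range M, if K i = k then wt i else 0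

theorem weightAt_eq_card {M : ℕ} {K a wt : ℕ → ℕ} (ha : ∀ i < M, a i = wt i % 2) (k : ℕ) :
    weightAt M K wt k = 2 * weightAt M K (fun i => wt i / 2) k +
      (keyClass M (a · = 1) K k).card := by
  unfold weightAt keyClass
  rw [Finset.card_filter, Finset.mul_sum, ← Finset.sum_add_distrib]
  refine Finset.sum_congr rfl fun i hi => ?_
  have := ha i (Finset.mem_range.1 hi)
  by_cases hk : K i = k
  · by_cases h1 : a i = 1 <;> simp [hk, h1] <;> omega
  · simp [hk]

/-- Since the odd weights split evenly at every key, rounding up those with bit `c` and rounding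
down the others halves the weight at every key exactly, for either value of `c`. -/
theorem weightAt_round {M : ℕ} {K a wt wt' bit : ℕ → ℕ} {c : ℕ} (hc : c < 2)
    (ha : ∀ i < M, a i = wt i % 2) (hb2 : ∀ i < M, a i = 1 → bit i < 2)
    (hb : Balanced M (a · = 1) K bit)
    (hw : ∀ i < M, wt' i = wt i / 2 + if a i = 1 ∧ bit i = c then 1 else 0) (k : ℕ) :
    2 * weightAt M K wt' k = weightAt M K wt k := by
  have h1 : weightAt M K wt' k = weightAt M K (fun i => wt i / 2) k +
      ((keyClass M (a · = 1) K k).filter (bit · = c)).card := by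
    unfold weightAt keyClass
    rw [Finset.filter_filter, Finset.card_filter, ← Finset.sum_add_distrib]
    refine Finset.sum_congr rfl fun i hi => ?_
    rw [hw i (Finset.mem_range.1 hi)]
    by_cases hk : K i = k <;> simp [hk]
  have h2 := hb.card_eq k
  have h3 : ((keyClass M (a · = 1) K k).filter (bit · = 0)).card +
      ((keyClass M (a · = 1) K k).filter (bit · = 1)).card = (keyClass M (a · = 1) K k).card := by
    rw [← Finset.card_union_of_disjoint, ← Finset.filter_or]
    · congr 1
      refine Finset.filter_true_of_mem fun i hi => ?_
      simp only [keyClass, Finset.mem_filter, Finset.mem_range] at hi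
      have := hb2 i hi.1 hi.2.1
      omega
    · rw [Finset.disjoint_filter]; intro i _ h; omega
  rw [h1, weightAt_eq_card ha]
  obtain rfl | rfl : c = 0 ∨ c = 1 := by omega
  · omega
  · omega

/-- Register `30` holds the number of items, `8` the number of them that are real, `2` the number
of the remaining, auxiliary ones.  All weights (array `22`) are halved, rounding up or down such
that the weight at every key is halved exactly and the total weight of the auxiliary items does not
exceed one half of its former value. -/
def halveWeights : Prog :=
  forLoop 40 (nr 30) (.putN 12 (nr 40) (na 24 (na 22 (nr 40)))) ;;
  split ;;
  .setN 36 0 ;; .setN 37 0 ;;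
  forLoop 40 (nr 2) (.ite (.eqN (na 12 (nr 8 + nr 40)) 1)
    (.ite (.eqN (na 17 (nr 8 + nr 40)) 0) (.setN 36 (nr 36 + 1)) (.setN 37 (nr 37 + 1))) .skip) ;;
  .ite (.leN (nr 36) (nr 37)) (.setN 38 0) (.setN 38 1) ;;
  forLoop 40 (nr 30) (.ite (.and (.eqN (na 12 (nr 40)) 1) (.eqN (na 17 (nr 40)) (nr 38)))
    (.putN 22 (nr 40) (na 23 (na 22 (nr 40)) + 1)) (.putN 22 (nr 40) (na 23 (na 22 (nr 40))))) ;;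
  .setN 9 (na 23 (nr 9))

/-- The weights of an extraction: `q` real and `n` auxiliary items, weights at most `s`, weight
`d₁ k * s` and `d₂ k * s` at the keys `k`, and total auxiliary weight less than `s`. -/
structure Weights (q n s : ℕ) (K₁ K₂ wt d₁ d₂ : ℕ → ℕ) : Prop where
  le : ∀ i < q + n, wt i ≤ s
  deg₁ : ∀ k, weightAt (q + n) K₁ wt k = d₁ k * s
  deg₂ : ∀ k, weightAt (q + n) K₂ wt k = d₂ k * s
  aux : ∑ v ∈ Finset.range n, wt (q + v) < s

/-- Of the two roundings, the one that rounds up fewer of the auxiliary weights keeps their total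
below the new bound `s`. -/
theorem ev_halveWeights {q n s : ℕ} {d₁ d₂ : ℕ → ℕ} {m : Mem} (h30 : m.nat 30 = q + n)
    (h8 : m.nat 8 = q) (h2 : m.nat 2 = n) (h9 : m.nat 9 = 2 * s) (h0 : ∀ k, m.natArr 13 k = 0)
    (hhalf : ∀ x ≤ 2 * s, m.natArr 23 x = x / 2) (hpar : ∀ x ≤ 2 * s, m.natArr 24 x = x % 2)
    (hw : Weights q n (2 * s) (m.natArr 10) (m.natArr 11) (m.natArr 22) d₁ d₂) :
    Ev halveWeights m fun k m' => k ≤ 45 * (q + n) + 21 ∧ (∀ k, m'.natArr 13 k = 0) ∧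
      m'.nat 9 = s ∧ Weights q n s (m.natArr 10) (m.natArr 11) (m'.natArr 22) d₁ d₂ := by
  unfold halveWeights
  rw [ev_seq]
  refine ev_forLoop (q + n) 1 (fun i m' => ∀ j < i, m'.natArr 12 j = m.natArr 22 j % 2) (by rfl)
    (fun m' hF => by simp [hF.nat 30 (by rfl), h30]) (by simp) (fun _ _ _ h => h) ?_ ?_
  · intro i m' hi hr hF hI
    rw [ev_putN]
    simp [hr, hF.arr 22 (by rfl), hF.arr 24 (by rfl)]
    intro j hj
    have := hI j
    have := hpar _ (hw.le i hi)
    grind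
  intro k₁ m₁ hk₁ F₁ _ a₁
  have hM₁ : m₁.nat 30 = q + n := (F₁.nat 30 (by rfl)).trans h30
  have A10 : m₁.natArr 10 = m.natArr 10 := F₁.arr 10 (by rfl)
  have A11 : m₁.natArr 11 = m.natArr 11 := F₁.arr 11 (by rfl)
  have A13 : m₁.natArr 13 = m.natArr 13 := F₁.arr 13 (by rfl)
  rw [ev_seq]
  refine (ev_split hM₁ (by rw [A13]; exact h0) ?_ ?_).frame.mono ?_
  · intro k
    have := weightAt_eq_card (K := m.natArr 10) a₁ k
    rw [hw.deg₁, mul_left_comm] at this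
    rw [A10, Nat.even_iff]; omega
  · intro k
    have := weightAt_eq_card (K := m.natArr 11) a₁ k
    rw [hw.deg₂, mul_left_comm] at this
    rw [A11, Nat.even_iff]; omega
  rintro k₂ m₂ ⟨F₂, hk₂, z₂, hb2, B₁, B₂⟩
  rw [A10] at B₁
  rw [A11] at B₂
  have C12 : m₂.natArr 12 = m₁.natArr 12 := F₂.arr 12 (by rfl)
  simp only [ev_seq, ev_setN]
  set m₃ := (m₂.setNat 36 (NExp.eval m₂ 0)).setNat 37 (NExp.eval (m₂.setNat 36 (NExp.eval m₂ 0)) 0)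
    with hm₃
  have hn₃ : m₃.nat 2 = n := by simp [hm₃, F₂.nat 2 (by rfl), F₁.nat 2 (by rfl), h2]
  have hq₃ : m₃.nat 8 = q := by simp [hm₃, F₂.nat 8 (by rfl), F₁.nat 8 (by rfl), h8]
  have hM₃ : m₃.nat 30 = q + n := by simp [hm₃, F₂.nat 30 (by rfl), hM₁]
  refine ev_forLoop n 3 (fun i m' =>
    m'.nat 36 = (∑ v ∈ Finset.range i, if m₁.natArr 12 (q + v) = 1 ∧ m₂.natArr 17 (q + v) = 0
      then 1 else 0) ∧
    m'.nat 37 = (∑ v ∈ Finset.range i, if m₁.natArr 12 (q + v) = 1 ∧ m₂.natArr 17 (q + v) ≠ 0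
      then 1 else 0)) (by rfl)
    (fun m' hF => by simp [hF.nat 2 (by rfl), hn₃]) (by simp [hm₃]) (fun _ _ _ h => h) ?_ ?_
  · rintro i m' hi hr hF ⟨hI1, hI2⟩
    have D12 : m'.natArr 12 = m₁.natArr 12 := (hF.arr 12 (by rfl)).trans C12
    have D17 : m'.natArr 17 = m₂.natArr 17 := hF.arr 17 (by rfl)
    have Dq : m'.nat 8 = q := (hF.nat 8 (by rfl)).trans hq₃
    rw [Finset.sum_range_succ, Finset.sum_range_succ]
    simp only [ev_ite, ev_setN, ev_skip]
    simp +contextual [hr, D12, D17, Dq, hI1, hI2]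
  rintro k₄ m₄ hk₄ F₄ - ⟨c₀, c₁⟩
  have E12 : m₄.natArr 12 = m₁.natArr 12 := (F₄.arr 12 (by rfl)).trans C12
  have E17 : m₄.natArr 17 = m₂.natArr 17 := F₄.arr 17 (by rfl)
  have E22 : m₄.natArr 22 = m.natArr 22 :=
    (F₄.arr 22 (by rfl)).trans ((F₂.arr 22 (by rfl)).trans (F₁.arr 22 (by rfl)))
  have E23 : m₄.natArr 23 = m.natArr 23 :=
    (F₄.arr 23 (by rfl)).trans ((F₂.arr 23 (by rfl)).trans (F₁.arr 23 (by rfl)))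
  have E13 : m₄.natArr 13 = m₂.natArr 13 := F₄.arr 13 (by rfl)
  have E9 : m₄.nat 9 = 2 * s := by
    rw [F₄.nat 9 (by rfl), ← h9]; simp [hm₃, F₂.nat 9 (by rfl), F₁.nat 9 (by rfl)]
  have hM₄ : m₄.nat 30 = q + n := (F₄.nat 30 (by rfl)).trans hM₃
  have hsel : Ev (.ite (.leN (nr 36) (nr 37)) (.setN 38 0) (.setN 38 1)) m₄ fun k m' => k = 2 ∧
      ∃ c < 2, m'.nat 38 = c ∧ ∑ v ∈ Finset.range n,
        2 * (m.natArr 22 (q + v) / 2 + if m₁.natArr 12 (q + v) = 1 ∧ m₂.natArr 17 (q + v) = c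
          then 1 else 0) ≤ ∑ v ∈ Finset.range n, m.natArr 22 (q + v) := by
    have e : ∑ v ∈ Finset.range n, m.natArr 22 (q + v) =
        ∑ v ∈ Finset.range n, 2 * (m.natArr 22 (q + v) / 2) + (m₄.nat 36 + m₄.nat 37) := by
      rw [c₀, c₁, ← Finset.sum_add_distrib, ← Finset.sum_add_distrib]
      refine Finset.sum_congr rfl fun v hv => ?_
      have h1 := a₁ (q + v) (by simpa using hv)
      rw [h1]
      split_ifs <;> omega
    have e1 : ∑ v ∈ Finset.range n,
        (if m₁.natArr 12 (q + v) = 1 ∧ m₂.natArr 17 (q + v) = 1 then 1 else 0) = m₄.nat 37 := by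
      rw [c₁]
      refine Finset.sum_congr rfl fun v hv => ?_
      have h1 := hb2 (q + v) (by simpa using hv)
      by_cases h : m₁.natArr 12 (q + v) = 1
      · have := h1 h
        congr 1; simp [h]; omega
      · simp [h]
    simp only [ev_ite, ev_setN, BExp.holds_leN, NExp.eval_reg, e, mul_add, Finset.sum_add_distrib,
      ← Finset.mul_sum]
    refine ⟨fun h => ⟨trivial, 0, by simp, by simp, ?_⟩,
      fun h => ⟨trivial, 1, by simp, by simp, ?_⟩⟩
    · rw [← c₀]; omega
    · rw [e1]; omega
  refine hsel.frame.mono ?_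
  rintro k₅ m₅ ⟨F₅, rfl, c, hc, hcr, hbad⟩
  have hM₅ : m₅.nat 30 = q + n := (F₅.nat 30 (by rfl)).trans hM₄
  refine ev_forLoop (q + n) 2 (fun i m' =>
    (∀ j, i ≤ j → m'.natArr 22 j = m.natArr 22 j) ∧
    ∀ j < i, m'.natArr 22 j = m.natArr 22 j / 2 +
      if m₁.natArr 12 j = 1 ∧ m₂.natArr 17 j = c then 1 else 0) (by rfl)
    (fun m' hF => by simp [hF.nat 30 (by rfl), hM₅]) ?_ (fun _ _ _ h => h) ?_ ?_
  · simp [F₅.arr 22 (by rfl), E22]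
  · rintro i m' hi hr hF ⟨hI1, hI2⟩
    have G12 : m'.natArr 12 = m₁.natArr 12 :=
      (hF.arr 12 (by rfl)).trans ((F₅.arr 12 (by rfl)).trans E12)
    have G17 : m'.natArr 17 = m₂.natArr 17 :=
      (hF.arr 17 (by rfl)).trans ((F₅.arr 17 (by rfl)).trans E17)
    have G23 : m'.natArr 23 = m.natArr 23 :=
      (hF.arr 23 (by rfl)).trans ((F₅.arr 23 (by rfl)).trans E23)
    have G38 : m'.nat 38 = c := (hF.nat 38 (by rfl)).trans hcr
    have hh := hhalf _ (hw.le i hi)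
    simp only [ev_ite, ev_putN]
    simp [hr, G12, G17, G23, G38, hI1 i le_rfl, hh]
    have t1 : ∀ j, i + 1 ≤ j → m'.natArr 22 j = m.natArr 22 j := fun j hj => hI1 j (by omega)
    refine ⟨fun h1 h2 => ⟨fun j hj => ?_, fun j hj => ?_⟩,
      fun h1 => ⟨fun j hj => ?_, fun j hj => ?_⟩⟩
    · rw [if_neg (by omega)]; exact t1 j hj
    · split_ifs with e1 e2 e2
      · rw [e1]
      · subst e1; exact absurd ⟨h1, h2⟩ e2
      · have := hI2 j (by omega); rw [if_pos e2] at this; exact this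
      · have := hI2 j (by omega); rw [if_neg e2] at this; exact this
    · rw [if_neg (by omega)]; exact t1 j hj
    · split_ifs with e1 e2 e2
      · subst e1; exact absurd e2.2 (h1 e2.1)
      · rw [e1]; simp
      · have := hI2 j (by omega); rw [if_pos e2] at this; exact this
      · have := hI2 j (by omega); rw [if_neg e2] at this; exact this
  rintro k₆ m₆ hk₆ F₆ - ⟨-, hwt⟩
  have H13 : m₆.natArr 13 = m₂.natArr 13 :=
    (F₆.arr 13 (by rfl)).trans ((F₅.arr 13 (by rfl)).trans E13)
  have H23 : m₆.natArr 23 = m.natArr 23 :=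
    (F₆.arr 23 (by rfl)).trans ((F₅.arr 23 (by rfl)).trans E23)
  have H9 : m₆.nat 9 = 2 * s := (F₆.nat 9 (by rfl)).trans ((F₅.nat 9 (by rfl)).trans E9)
  simp only [Mem.natArr_setNat, Mem.nat_setNat, NExp.eval_get, NExp.eval_reg, H9, H23, H13,
    hhalf _ le_rfl, if_true]
  refine ⟨by omega, z₂, by omega, ?_⟩
  refine ⟨fun i hi => ?_, fun k => ?_, fun k => ?_, ?_⟩
  · rw [hwt i hi]
    have h1 := hw.le i hi
    have h2 := a₁ i hi
    split_ifs with h3 <;> omega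
  · have := weightAt_round hc a₁ (by simpa [C12] using hb2) B₁ hwt k
    rw [hw.deg₁, mul_left_comm] at this
    omega
  · have := weightAt_round hc a₁ (by simpa [C12] using hb2) B₂ hwt k
    rw [hw.deg₂, mul_left_comm] at this
    omega
  · have h1 := hw.aux
    have h2 : ∑ v ∈ Finset.range n, 2 * m₆.natArr 22 (q + v) ≤
        ∑ v ∈ Finset.range n, m.natArr 22 (q + v) := by
      refine le_trans (le_of_eq ?_) hbad
      refine Finset.sum_congr rfl fun v hv => ?_
      rw [hwt (q + v) (by simpa using hv)]
    rw [← Finset.mul_sum] at h2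
    omega

/-! ### Regular subgraphs of regular bipartite multigraphs -/

/-- List the edges in the list `18` of length register `8`, followed by one auxiliary edge from `v`
to `v` for every vertex `v`. -/
def loadItems : Prog :=
  forLoop 40 (nr 8)
    (.putN 10 (nr 40) (na 20 (na 18 (nr 40))) ;; .putN 11 (nr 40) (na 21 (na 18 (nr 40)))) ;;
  forLoop 40 (nr 2) (.putN 10 (nr 8 + nr 40) (nr 40) ;; .putN 11 (nr 8 + nr 40) (nr 40)) ;;
  .setN 30 (nr 8 + nr 2)

theorem ev_loadItems {q n : ℕ} {m : Mem} (h8 : m.nat 8 = q) (h2 : m.nat 2 = n) :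
    Ev loadItems m fun k m' => k ≤ 4 * (q + n) + 5 ∧ m'.nat 30 = q + n ∧
      (∀ i < q, m'.natArr 10 i = m.natArr 20 (m.natArr 18 i) ∧
        m'.natArr 11 i = m.natArr 21 (m.natArr 18 i)) ∧
      ∀ v < n, m'.natArr 10 (q + v) = v ∧ m'.natArr 11 (q + v) = v := by
  unfold loadItems
  rw [ev_seq]
  refine ev_forLoop q 2 (fun i m' => ∀ j < i, m'.natArr 10 j = m.natArr 20 (m.natArr 18 j) ∧
        m'.natArr 11 j = m.natArr 21 (m.natArr 18 j)) (by rfl)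
    (fun m' hF => by simp [hF.nat 8 (by rfl), h8]) (by simp) (fun _ _ _ h => h) ?_ ?_
  · intro i m' hi hr hF hI
    simp only [ev_seq, ev_putN]
    simp [hr, hF.arr 18 (by rfl), hF.arr 20 (by rfl), hF.arr 21 (by rfl)]
    intro j hj
    have := hI j
    grind
  intro k₁ m₁ hk₁ F₁ _ a₁
  have hq₁ : m₁.nat 8 = q := (F₁.nat 8 (by rfl)).trans h8
  have hn₁ : m₁.nat 2 = n := (F₁.nat 2 (by rfl)).trans h2
  rw [ev_seq]
  refine ev_forLoop n 2 (fun i m' => (∀ j < q, m'.natArr 10 j = m₁.natArr 10 j ∧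
      m'.natArr 11 j = m₁.natArr 11 j) ∧
      ∀ v < i, m'.natArr 10 (q + v) = v ∧ m'.natArr 11 (q + v) = v) (by rfl)
    (fun m' hF => by simp [hF.nat 2 (by rfl), hn₁]) (by simp) (fun _ _ _ h => h) ?_ ?_
  · rintro i m' hi hr hF ⟨hI1, hI2⟩
    have hq : m'.nat 8 = q := (hF.nat 8 (by rfl)).trans hq₁
    simp only [ev_seq, ev_putN]
    simp [hr, hq]
    refine ⟨fun j hj => ?_, fun v hv => ?_⟩
    · rw [if_neg (by omega), if_neg (by omega)]; exact hI1 j hj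
    · have := hI2 v
      grind
  rintro k₂ m₂ hk₂ F₂ - ⟨b₁, b₂⟩
  have hq₂ : m₂.nat 8 = q := (F₂.nat 8 (by rfl)).trans hq₁
  have hn₂ : m₂.nat 2 = n := (F₂.nat 2 (by rfl)).trans hn₁
  rw [ev_setN]
  refine ⟨by omega, by simp [hq₂, hn₂], fun i hi => ?_, b₂⟩
  simpa [← (a₁ i hi).1, ← (a₁ i hi).2] using b₁ i hi

/-- Store the least power `s` of two that is not below the number of edges, and distribute the
weight `p * s` as evenly as possible: `⌊p * s / D⌋` for every one of the edges, and the
remainder for the auxiliary edges. -/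
def initWeights : Prog :=
  .setN 9 1 ;; .setN 34 (nr 7) ;;
  .loop (.ltN (nr 9) (nr 8)) (.setN 9 (nr 9 + nr 9) ;; .setN 34 (nr 34 + nr 34)) ;;
  .setN 35 0 ;;
  .loop (.leN (nr 6) (nr 34)) (.setN 34 (nr 34 - nr 6) ;; .setN 35 (nr 35 + 1)) ;;
  forLoop 40 (nr 8) (.putN 22 (nr 40) (nr 35)) ;;
  forLoop 40 (nr 2) (.putN 22 (nr 8 + nr 40) (nr 34))

theorem ev_initWeights {q n D p : ℕ} {m : Mem} (h8 : m.nat 8 = q) (h2 : m.nat 2 = n)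
    (h6 : m.nat 6 = D) (h7 : m.nat 7 = p) (hq : 1 ≤ q) (hp : 1 ≤ p) (hpD : p ≤ D) :
    Ev initWeights m fun k m' => k ≤ 3 * Nat.clog 2 q + 9 * q + 3 * n + 12 ∧
      ∃ j α β, m'.nat 9 = 2 ^ j ∧ j ≤ Nat.clog 2 q ∧ q ≤ 2 ^ j ∧ 2 ^ j ≤ 2 * q ∧
        p * 2 ^ j = D * α + β ∧ β < D ∧ (∀ i < q, m'.natArr 22 i = α) ∧
        ∀ v < n, m'.natArr 22 (q + v) = β := by
  unfold initWeights
  simp only [ev_seq, ev_setN]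
  set m₀ := (m.setNat 9 (NExp.eval m 1)).setNat 34 (NExp.eval (m.setNat 9 (NExp.eval m 1)) (nr 7))
    with hm₀
  refine ev_loop (fun k m' => ∃ j, k = 3 * j ∧ m'.nat 9 = 2 ^ j ∧ m'.nat 34 = p * 2 ^ j ∧
    j ≤ Nat.clog 2 q ∧ 2 ^ j ≤ 2 * q) (fun m' => q - m'.nat 9) ?_ ?_ ?_
  · refine ⟨0, rfl, by simp [hm₀], by simp [hm₀, h7], by omega, by omega⟩
  · rintro k m' hF ⟨j, rfl, e9, e34, hj, -⟩ hb
    have e8 : m'.nat 8 = q := by rw [hF.nat 8 (by rfl)]; simp [hm₀, h8]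
    simp only [BExp.holds_ltN, NExp.eval_reg, e9, e8] at hb
    simp only [ev_seq, ev_setN]
    have hlt := (Nat.lt_clog_iff_pow_lt (by norm_num)).2 hb
    have h1 : 1 ≤ 2 ^ j := Nat.one_le_two_pow
    simp [e9, e34]
    exact ⟨⟨j + 1, by omega, by rw [pow_succ]; omega, by rw [pow_succ]; ring,
      by omega, by rw [pow_succ]; omega⟩, by omega⟩
  rintro k₁ m₁ F₁ ⟨j, rfl, e9, e34, hj, hj2⟩ hb
  have e8 : m₁.nat 8 = q := by rw [F₁.nat 8 (by rfl)]; simp [hm₀, h8]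
  have e6 : m₁.nat 6 = D := by rw [F₁.nat 6 (by rfl)]; simp [hm₀, h6]
  have e2 : m₁.nat 2 = n := by rw [F₁.nat 2 (by rfl)]; simp [hm₀, h2]
  simp only [BExp.holds_ltN, NExp.eval_reg, e9, e8, not_lt] at hb
  refine ev_loop (fun k m' => k = 3 * m'.nat 35 ∧ p * 2 ^ j = D * m'.nat 35 + m'.nat 34)
    (fun m' => m'.nat 34) ?_ ?_ ?_
  · simp [e34]
  · rintro k m' hF ⟨rfl, hI⟩ hb
    have e6' : m'.nat 6 = D := by rw [hF.nat 6 (by rfl)]; simpa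
    simp only [BExp.holds_leN, NExp.eval_reg, e6'] at hb
    simp only [ev_seq, ev_setN]
    simp [e6']
    refine ⟨⟨by omega, by rw [mul_add]; omega⟩, by omega, by omega⟩
  rintro k₂ m₂ F₂ ⟨rfl, hI⟩ hb₂
  have e6' : m₂.nat 6 = D := by rw [F₂.nat 6 (by rfl)]; simpa
  have e8' : m₂.nat 8 = q := by rw [F₂.nat 8 (by rfl)]; simpa
  have e2' : m₂.nat 2 = n := by rw [F₂.nat 2 (by rfl)]; simpa
  have e9' : m₂.nat 9 = 2 ^ j := by rw [F₂.nat 9 (by rfl)]; simpa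
  simp only [BExp.holds_leN, NExp.eval_reg, e6', not_le] at hb₂
  have hα : m₂.nat 35 ≤ 2 * q := by
    have h1 : D * m₂.nat 35 ≤ D * 2 ^ j := by
      calc _ ≤ p * 2 ^ j := by omega
        _ ≤ _ := Nat.mul_le_mul_right _ hpD
    exact (Nat.le_of_mul_le_mul_left h1 (by omega)).trans hj2
  refine ev_forLoop q 1 (fun i m' => ∀ j < i, m'.natArr 22 j = m₂.nat 35) (by rfl)
    (fun m' hF => by simp [hF.nat 8 (by rfl), e8']) (by simp) (fun _ _ _ h => h) ?_ ?_
  · intro i m' hi hr hF hI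
    rw [ev_putN]
    simp [hr, hF.nat 35 (by rfl)]
    intro j hj
    have := hI j
    grind
  intro k₃ m₃ hk₃ F₃ _ a₃
  have e8₃ : m₃.nat 8 = q := (F₃.nat 8 (by rfl)).trans e8'
  have e34₃ : m₃.nat 34 = m₂.nat 34 := (F₃.nat 34 (by rfl))
  refine ev_forLoop n 1 (fun i m' => (∀ j < q, m'.natArr 22 j = m₂.nat 35) ∧
      ∀ v < i, m'.natArr 22 (q + v) = m₂.nat 34) (by rfl)
    (fun m' hF => by simp [hF.nat 2 (by rfl), F₃.nat 2 (by rfl), e2']) ⟨a₃, by simp⟩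
    (fun _ _ _ h => h) ?_ ?_
  · rintro i m' hi hr hF ⟨hI1, hI2⟩
    rw [ev_putN]
    simp [hr, hF.nat 34 (by rfl), hF.nat 8 (by rfl), e8₃, e34₃]
    refine ⟨fun j hj => ?_, fun v hv => ?_⟩
    · rw [if_neg (by omega)]; exact hI1 j hj
    · have := hI2 v
      grind
  rintro k₄ m₄ hk₄ F₄ - ⟨b₁, b₂⟩
  refine ⟨by omega, j, _, _, ?_, hj, hb, hj2, hI, hb₂, b₁, b₂⟩
  rw [F₄.nat 9 (by rfl), F₃.nat 9 (by rfl), e9']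

/-- Tabulate the halves and the parities of all numbers up to twice register `9`. -/
def halfTable : Prog :=
  forLoop 40 (nr 9 + 1)
    (.putN 23 (nr 40 + nr 40) (nr 40) ;; .putN 23 (nr 40 + nr 40 + 1) (nr 40) ;;
      .putN 24 (nr 40 + nr 40) 0 ;; .putN 24 (nr 40 + nr 40 + 1) 1)

theorem ev_halfTable {s : ℕ} {m : Mem} (h9 : m.nat 9 = s) :
    Ev halfTable m fun k m' => k ≤ 6 * s + 8 ∧
      ∀ x ≤ s, m'.natArr 23 x = x / 2 ∧ m'.natArr 24 x = x % 2 := by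
  unfold halfTable
  refine ev_forLoop (s + 1) 4 (fun i m' => ∀ x < 2 * i, m'.natArr 23 x = x / 2 ∧
      m'.natArr 24 x = x % 2) (by rfl)
    (fun m' hF => by simp [hF.nat 9 (by rfl), h9]) (by simp) (fun _ _ _ h => h) ?_ ?_
  · intro i m' hi hr hF hI
    simp only [ev_seq, ev_putN]
    simp [hr]
    intro x hx
    have := hI x
    by_cases h1 : x = i + i + 1
    · subst h1; simp; omega
    by_cases h2 : x = i + i
    · subst h2; simp; omega
    simp only [h1, h2, if_false]
    exact this (by omega)
  · intro k m' hk _ _ hI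
    exact ⟨by omega, fun x hx => hI x (by omega)⟩

/-- Mark the edges of a `p`-regular subgraph by the weight `1` and the other edges by `0`. -/
def extract : Prog :=
  loadItems ;; initWeights ;; halfTable ;; .loop (.ltN 1 (nr 9)) halveWeights

/-- Among the `q` edges listed by `rid`, there are `D` whose end (given by `S`) is `v`, for each of
the `n` vertices `v`, and there are no others. -/
def RegularList (n D q : ℕ) (rid S : ℕ → ℕ) : Prop :=
  (∀ i < q, S (rid i) < n) ∧ ∀ v < n, ((Finset.range q).filter fun i => S (rid i) = v).card = D

/-- The initial weights give every vertex the weight `p * s`: the `D` edges at it have weight `α`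
each, and its auxiliary edge makes up for the remainder `β`. -/
theorem weightAt_init {q n D α β p s : ℕ} {K wt rid S : ℕ → ℕ} (hR : RegularList n D q rid S)
    (hK : ∀ i < q, K i = S (rid i)) (hK' : ∀ v < n, K (q + v) = v) (hα : ∀ i < q, wt i = α)
    (hβ : ∀ v < n, wt (q + v) = β) (h : p * s = D * α + β) (k : ℕ) :
    weightAt (q + n) K wt k = (if k < n then p else 0) * s := by
  unfold weightAt
  rw [Finset.sum_range_add]
  have h1 : ∑ x ∈ Finset.range q, (if K x = k then wt x else 0) =
      ((Finset.range q).filter fun i => S (rid i) = k).card * α := by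
    rw [Finset.card_filter, Finset.sum_mul]
    refine Finset.sum_congr rfl fun i hi => ?_
    rw [hK i (by simpa using hi), hα i (by simpa using hi)]
    split_ifs <;> simp
  have h2 : ∑ x ∈ Finset.range n, (if K (q + x) = k then wt (q + x) else 0) =
      if k < n then β else 0 := by
    have : ∀ x ∈ Finset.range n, (if K (q + x) = k then wt (q + x) else 0) =
        if x = k then β else 0 := by
      intro x hx
      rw [hK' x (by simpa using hx), hβ x (by simpa using hx)]
    rw [Finset.sum_congr rfl this, Finset.sum_ite_eq']
    simp
  rw [h1, h2]
  by_cases hk : k < n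
  · rw [hR.2 k hk, if_pos hk, if_pos hk, h]
  · rw [if_neg hk, if_neg hk, Finset.card_eq_zero.2]
    · simp
    · refine Finset.filter_eq_empty_iff.2 fun i hi => ?_
      have := hR.1 i (by simpa using hi)
      omega

/-- When the bound `s` on the weights has come down to `1`, the auxiliary edges have weight zero,
and the edges of weight `1` form a `p`-regular subgraph. -/
theorem ev_extract {q n D p : ℕ} {m : Mem} (h8 : m.nat 8 = q) (h2 : m.nat 2 = n)
    (h6 : m.nat 6 = D) (h7 : m.nat 7 = p) (hn : 1 ≤ n) (hp : 1 ≤ p) (hpD : p ≤ D) (hq : q = D * n)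
    (h0 : ∀ k, m.natArr 13 k = 0) (hS : RegularList n D q (m.natArr 18) (m.natArr 20))
    (hT : RegularList n D q (m.natArr 18) (m.natArr 21)) :
    Ev extract m fun k m' => k ≤ 115 * (q * (Nat.clog 2 q + 1)) + 26 ∧ (∀ k, m'.natArr 13 k = 0) ∧
      (∀ i < q, m'.natArr 22 i ≤ 1) ∧
      (∀ v < n, ∑ i ∈ Finset.range q,
        (if m.natArr 20 (m.natArr 18 i) = v then m'.natArr 22 i else 0) = p) ∧
      (∀ v < n, ∑ i ∈ Finset.range q,
        (if m.natArr 21 (m.natArr 18 i) = v then m'.natArr 22 i else 0) = p) := by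
  have hqn : n ≤ q := by rw [hq]; exact Nat.le_mul_of_pos_left _ (by omega)
  have hqD : D ≤ q := by rw [hq]; exact Nat.le_mul_of_pos_right _ (by omega)
  unfold extract
  rw [ev_seq]
  refine (ev_loadItems h8 h2).frame.mono ?_
  rintro k₁ m₁ ⟨F₁, hk₁, g30, gK, gK'⟩
  rw [ev_seq]
  refine (ev_initWeights (m := m₁) (q := q) (n := n) (D := D) (p := p) ?_ ?_ ?_ ?_ (by omega) hp
    hpD).frame.mono ?_
  · rw [F₁.nat 8 (by rfl), h8]
  · rw [F₁.nat 2 (by rfl), h2]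
  · rw [F₁.nat 6 (by rfl), h6]
  · rw [F₁.nat 7 (by rfl), h7]
  rintro k₂ m₂ ⟨F₂, hk₂, r, α, β, e9, hr, hr1, hr2, hdiv, hβ, hwα, hwβ⟩
  rw [ev_seq]
  refine (ev_halfTable e9).frame.mono ?_
  rintro k₃ m₃ ⟨F₃, hk₃, htab⟩
  have e30 : m₃.nat 30 = q + n := by rw [F₃.nat 30 (by rfl), F₂.nat 30 (by rfl), g30]
  have e8 : m₃.nat 8 = q := by rw [F₃.nat 8 (by rfl), F₂.nat 8 (by rfl), F₁.nat 8 (by rfl), h8]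
  have e2 : m₃.nat 2 = n := by rw [F₃.nat 2 (by rfl), F₂.nat 2 (by rfl), F₁.nat 2 (by rfl), h2]
  have e10 : m₃.natArr 10 = m₁.natArr 10 := by rw [F₃.arr 10 (by rfl), F₂.arr 10 (by rfl)]
  have e11 : m₃.natArr 11 = m₁.natArr 11 := by rw [F₃.arr 11 (by rfl), F₂.arr 11 (by rfl)]
  have e13 : m₃.natArr 13 = m.natArr 13 := by
    rw [F₃.arr 13 (by rfl), F₂.arr 13 (by rfl), F₁.arr 13 (by rfl)]
  have e22 : m₃.natArr 22 = m₂.natArr 22 := F₃.arr 22 (by rfl)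
  have hα : α ≤ 2 ^ r := by
    have h1 : D * α ≤ D * 2 ^ r := by
      calc _ ≤ p * 2 ^ r := by omega
        _ ≤ _ := Nat.mul_le_mul_right _ hpD
    exact Nat.le_of_mul_le_mul_left h1 (by omega)
  have W₀ : Weights q n (2 ^ r) (m₁.natArr 10) (m₁.natArr 11) (m₃.natArr 22)
      (fun k => if k < n then p else 0) (fun k => if k < n then p else 0) := by
    rw [e22]
    refine ⟨fun i hi => ?_, fun k => ?_, fun k => ?_, ?_⟩
    · by_cases hiq : i < q
      · rw [hwα i hiq]; exact hα
      · obtain ⟨v, rfl⟩ := Nat.exists_eq_add_of_le (not_lt.1 hiq)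
        rw [hwβ v (by omega)]; omega
    · exact weightAt_init hS (fun i hi => (gK i hi).1) (fun v hv => (gK' v hv).1) hwα hwβ hdiv k
    · exact weightAt_init hT (fun i hi => (gK i hi).2) (fun v hv => (gK' v hv).2) hwα hwβ hdiv k
    · rw [Finset.sum_congr rfl fun v hv => hwβ v (by simpa using hv)]
      have : n * β < n * D := Nat.mul_lt_mul_of_pos_left hβ (by omega)
      rw [mul_comm n D, ← hq] at this
      simp; omega
  refine ev_loop (fun k m' => ∃ j, j ≤ r ∧
      k + (45 * (q + n) + 22) * j ≤ (45 * (q + n) + 22) * r ∧ m'.nat 9 = 2 ^ j ∧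
      (∀ k, m'.natArr 13 k = 0) ∧ Weights q n (2 ^ j) (m₁.natArr 10) (m₁.natArr 11) (m'.natArr 22)
      (fun k => if k < n then p else 0) (fun k => if k < n then p else 0))
    (fun m' => m'.nat 9) ?_ ?_ ?_
  · exact ⟨r, le_rfl, by omega, by rw [F₃.nat 9 (by rfl), e9], by rw [e13]; exact h0, W₀⟩
  · rintro k m' hF ⟨j, hj, hk, j9, hz, hW⟩ hb
    simp [j9] at hb
    obtain ⟨j, rfl⟩ : ∃ i, j = i + 1 := ⟨j - 1, by omega⟩
    have hle : 2 * 2 ^ j ≤ 2 ^ r := by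
      rw [← pow_succ']; exact Nat.pow_le_pow_right (by norm_num) hj
    refine (ev_halveWeights (m := m') (q := q) (n := n) (s := 2 ^ j)
      (d₁ := fun k => if k < n then p else 0) (d₂ := fun k => if k < n then p else 0)
      ?_ ?_ ?_ ?_ hz ?_ ?_ ?_).mono ?_
    · rw [hF.nat 30 (by rfl), e30]
    · rw [hF.nat 8 (by rfl), e8]
    · rw [hF.nat 2 (by rfl), e2]
    · rw [j9, pow_succ']
    · intro x hx; rw [hF.arr 23 (by rfl)]; exact (htab x (hx.trans hle)).1
    · intro x hx; rw [hF.arr 24 (by rfl)]; exact (htab x (hx.trans hle)).2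
    · rw [hF.arr 10 (by rfl), hF.arr 11 (by rfl), e10, e11, ← pow_succ']; exact hW
    · rintro k' m'' ⟨hk', hz', h9', hW'⟩
      rw [hF.arr 10 (by rfl), hF.arr 11 (by rfl), e10, e11] at hW'
      rw [mul_add, mul_one] at hk
      refine ⟨⟨j, by omega, by omega, h9', hz', hW'⟩, ?_⟩
      rw [h9', j9, pow_succ']
      have := Nat.one_le_two_pow (n := j)
      omega
  rintro k₄ m₄ F₄ ⟨j, hj, hk₄, j9, hz, hW⟩ hb
  simp [j9] at hb
  obtain rfl : j = 0 := by
    by_contra h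
    have := Nat.one_lt_two_pow h
    omega
  have haux : ∀ v < n, m₄.natArr 22 (q + v) = 0 := by
    intro v hv
    have h1 := hW.aux
    rw [pow_zero, Nat.lt_one_iff, Finset.sum_eq_zero_iff] at h1
    exact h1 v (by simpa using hv)
  have hdeg : ∀ K : ℕ → ℕ, (∀ k, weightAt (q + n) K (m₄.natArr 22) k =
      (if k < n then p else 0) * 2 ^ 0) → ∀ v < n,
      ∑ i ∈ Finset.range q, (if K i = v then m₄.natArr 22 i else 0) = p := by
    intro K h v hv
    have h1 := h v
    unfold weightAt at h1
    rw [Finset.sum_range_add, Finset.sum_eq_zero (s := Finset.range n), if_pos hv] at h1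
    · simpa using h1
    · intro x hx
      rw [haux x (by simpa using hx)]; simp
  refine ⟨?_, hz, fun i hi => by simpa using hW.le i (by omega), fun v hv => ?_, fun v hv => ?_⟩
  · have h1 : (45 * (q + n) + 22) * r ≤ (112 * q) * Nat.clog 2 q :=
      Nat.mul_le_mul (by omega) hr
    have h2 : q * (Nat.clog 2 q + 1) = q * Nat.clog 2 q + q := by ring
    have h3 : Nat.clog 2 q ≤ q * Nat.clog 2 q := Nat.le_mul_of_pos_left _ (by omega)
    rw [mul_assoc] at h1
    omega
  · rw [← hdeg _ hW.deg₁ v hv]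
    refine Finset.sum_congr rfl fun i hi => ?_
    rw [(gK i (by simpa using hi)).1]
  · rw [← hdeg _ hW.deg₂ v hv]
    refine Finset.sum_congr rfl fun i hi => ?_
    rw [(gK i (by simpa using hi)).2]

/-! ### Edge colouring regular bipartite multigraphs -/

/-- The first `q` entries of the list `f` are the elements of `A`, without repetition. -/
structure Enumerates (f : ℕ → ℕ) (q : ℕ) (A : Finset ℕ) : Prop where
  inj : ∀ i < q, ∀ j < q, f i = f j → i = j
  image : (Finset.range q).image f = A

/-- Every vertex below `n` is the end (given by `S`) of `D` edges in `A`, and all ends are below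
`n`. -/
structure RegularOn (n D : ℕ) (A : Finset ℕ) (S : ℕ → ℕ) : Prop where
  lt : ∀ e ∈ A, S e < n
  card : ∀ v < n, (A.filter (S · = v)).card = D

section enum
variable {f f' : ℕ → ℕ} {q n D a : ℕ} {A : Finset ℕ} {S : ℕ → ℕ}

theorem Enumerates.mem (h : Enumerates f q A) {i : ℕ} (hi : i < q) : f i ∈ A := by
  rw [← h.image]; exact Finset.mem_image_of_mem _ (by simpa using hi)

theorem Enumerates.exists_of_mem (h : Enumerates f q A) {e : ℕ} (he : e ∈ A) :
    ∃ i < q, f i = e := by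
  rw [← h.image] at he
  simpa using he

theorem Enumerates.card (h : Enumerates f q A) : A.card = q := by
  rw [← h.image, Finset.card_image_of_injOn, Finset.card_range]
  intro i hi j hj
  exact h.inj i (by simpa using hi) j (by simpa using hj)

theorem Enumerates.sum (h : Enumerates f q A) (F : ℕ → ℕ) :
    ∑ i ∈ Finset.range q, F (f i) = ∑ e ∈ A, F e := by
  rw [← h.image, Finset.sum_image]
  intro i hi j hj
  exact h.inj i (by simpa using hi) j (by simpa using hj)

theorem Enumerates.empty : Enumerates f 0 ∅ := ⟨by simp, by simp⟩

theorem Enumerates.push (h : Enumerates f q A) (ha : a ∉ A)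
    (hf : ∀ i < q + 1, f' i = if i = q then a else f i) : Enumerates f' (q + 1) (insert a A) := by
  have hne : ∀ i < q, f i ≠ a := fun i hi e => ha (e ▸ h.mem hi)
  refine ⟨fun i hi j hj e => ?_, ?_⟩
  · rw [hf i hi, hf j hj] at e
    have := h.inj i
    grind
  · rw [Finset.range_add_one, Finset.image_insert, hf q (by omega), if_pos rfl, ← h.image]
    congr 1
    refine Finset.image_congr fun i hi => ?_
    have : i < q := by simpa using hi
    rw [hf i (by omega), if_neg (by omega)]

theorem Enumerates.congr (h : Enumerates f q A) (hf : ∀ i < q, f' i = f i) :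
    Enumerates f' q A := by
  refine ⟨fun i hi j hj e => h.inj i hi j hj (by rw [← hf i hi, ← hf j hj, e]), ?_⟩
  rw [← h.image]
  exact Finset.image_congr fun i hi => hf i (by simpa using hi)

theorem Enumerates.regularList (h : Enumerates f q A) (hR : RegularOn n D A S) :
    RegularList n D q f S := by
  refine ⟨fun i hi => hR.lt _ (h.mem hi), fun v hv => ?_⟩
  rw [← hR.card v hv, Finset.card_filter, Finset.card_filter]
  exact h.sum fun e => if S e = v then 1 else 0

theorem RegularOn.card_eq (hR : RegularOn n D A S) : A.card = D * n := by
  rw [Finset.card_eq_sum_card_fiberwise (f := S) (t := Finset.range n)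
    (fun e he => by simpa using hR.lt e he),
    Finset.sum_congr rfl fun v hv => hR.card v (by simpa using hv)]
  simp [mul_comm]

end enum

/-- Move the marked edges of the list `18` to the list `19`. -/
def partition : Prog :=
  .setN 44 0 ;; .setN 45 0 ;;
  forLoop 40 (nr 8) (.ite (.eqN (na 22 (nr 40)) 1)
    (.putN 19 (nr 44) (na 18 (nr 40)) ;; .setN 44 (nr 44 + 1))
    (.putN 18 (nr 45) (na 18 (nr 40)) ;; .setN 45 (nr 45 + 1)))

/-- The unmarked edges stay in the list `18`, which is compacted in place. -/
theorem ev_partition {q : ℕ} {A : Finset ℕ} {m : Mem} (h8 : m.nat 8 = q)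
    (hA : Enumerates (m.natArr 18) q A) :
    Ev partition m fun k m' => k ≤ 5 * q + 4 ∧ ∃ B ⊆ A,
      Enumerates (m'.natArr 19) (m'.nat 44) B ∧ Enumerates (m'.natArr 18) (m'.nat 45) (A \ B) ∧
      ∀ i < q, (m.natArr 18 i ∈ B ↔ m.natArr 22 i = 1) := by
  unfold partition
  simp only [ev_seq, ev_setN]
  set m₀ := (m.setNat 44 (NExp.eval m 0)).setNat 45 (NExp.eval (m.setNat 44 (NExp.eval m 0)) 0)
    with hm₀
  set Y := fun i => ((Finset.range i).filter fun j => m.natArr 22 j = 1).image (m.natArr 18) with hY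
  set Z := fun i => ((Finset.range i).filter fun j => ¬ m.natArr 22 j = 1).image (m.natArr 18)
    with hZ
  have notin : ∀ (P : ℕ → Prop) [DecidablePred P], ∀ i < q,
      m.natArr 18 i ∉ ((Finset.range i).filter P).image (m.natArr 18) := by
    intro P _ i hi h
    obtain ⟨j, hj, e⟩ := Finset.mem_image.1 h
    simp only [Finset.mem_filter, Finset.mem_range] at hj
    have := hA.inj j (by omega) i hi e
    omega
  refine ev_forLoop q 3 (fun i m' => m'.nat 45 ≤ i ∧ (∀ j, i ≤ j → m'.natArr 18 j = m.natArr 18 j) ∧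
    Enumerates (m'.natArr 19) (m'.nat 44) (Y i) ∧ Enumerates (m'.natArr 18) (m'.nat 45) (Z i))
    (by rfl) (fun m' hF => by simp [hF.nat 8 (by rfl), hm₀, h8]) ?_ (fun _ _ _ h => h) ?_ ?_
  · simp [hm₀, hY, hZ, Enumerates.empty]
  · rintro i m' hi hr hF ⟨hle, hsuf, h1, h2⟩
    have e22 : m'.natArr 22 = m.natArr 22 := by rw [hF.arr 22 (by rfl)]; rfl
    simp only [ev_ite, ev_seq, ev_putN, ev_setN, BExp.holds_eqN, NExp.eval_get, NExp.eval_reg,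
      NExp.eval_ofNat, hr, e22, hsuf i le_rfl]
    refine ⟨fun hw => ⟨by simp, ?_⟩, fun hw => ⟨by simp, ?_⟩⟩
    · have hYi : Y (i + 1) = insert (m.natArr 18 i) (Y i) := by
        simp [hY, Finset.range_add_one, Finset.filter_insert, hw]
      have hZi : Z (i + 1) = Z i := by
        simp [hZ, Finset.range_add_one, Finset.filter_insert, hw]
      rw [hYi, hZi]
      simp only [Mem.nat_setNat, Mem.nat_setArr, NExp.eval_add', NExp.eval_reg, NExp.eval_ofNat]
      refine ⟨?_, fun j hj => ?_, ?_, ?_⟩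
      · simp; omega
      · simp [hsuf j (by omega)]
      · refine h1.push (notin _ i hi) fun j hj => ?_
        simp
      · exact h2.congr fun j hj => by simp
    · have hYi : Y (i + 1) = Y i := by
        simp [hY, Finset.range_add_one, Finset.filter_insert, hw]
      have hZi : Z (i + 1) = insert (m.natArr 18 i) (Z i) := by
        simp [hZ, Finset.range_add_one, Finset.filter_insert, hw]
      rw [hYi, hZi]
      simp only [Mem.nat_setNat, Mem.nat_setArr, NExp.eval_add', NExp.eval_reg, NExp.eval_ofNat]
      refine ⟨?_, fun j hj => ?_, ?_, ?_⟩
      · simp; omega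
      · simp [hsuf j (by omega)]; omega
      · exact h1.congr fun j hj => by simp
      · refine h2.push (notin _ i hi) fun j hj => ?_
        simp
  · rintro k m' hk - - ⟨-, -, h1, h2⟩
    have hmem : ∀ i < q, (m.natArr 18 i ∈ Y q ↔ m.natArr 22 i = 1) := by
      intro i hi
      simp only [hY, Finset.mem_image, Finset.mem_filter, Finset.mem_range]
      constructor
      · rintro ⟨j, ⟨hj, hw⟩, e⟩
        rwa [← hA.inj j hj i hi e]
      · exact fun h => ⟨i, ⟨hi, h⟩, rfl⟩
    have hYA : Y q ⊆ A := by
      rw [← hA.image]; exact Finset.image_subset_image (Finset.filter_subset _ _)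
    have hZA : Z q = A \ Y q := by
      ext e
      rw [Finset.mem_sdiff]
      constructor
      · intro h
        simp only [hZ, Finset.mem_image, Finset.mem_filter, Finset.mem_range] at h
        obtain ⟨j, ⟨hj, hw⟩, rfl⟩ := h
        exact ⟨hA.mem hj, fun h => hw ((hmem j hj).1 h)⟩
      · rintro ⟨h, h'⟩
        obtain ⟨j, hj, rfl⟩ := hA.exists_of_mem h
        simp only [hZ, Finset.mem_image, Finset.mem_filter, Finset.mem_range]
        exact ⟨j, ⟨hj, fun hw => h' ((hmem j hj).2 hw)⟩, rfl⟩
    rw [hZA] at h2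
    exact ⟨by omega, Y q, hYA, h1, h2, hmem⟩

/-- Colour a bipartite multigraph (list `19`, its length in register `44`) that is regular of degree
`p`, a power of two, with `p` colours by splitting it evenly again and again.  The two keys of an
edge combine its ends with the colour bits found so far. -/
def powColour : Prog :=
  .setN 30 (nr 44) ;;
  forLoop 40 (nr 44) (.putN 10 (nr 40) (na 20 (na 19 (nr 40))) ;;
    .putN 11 (nr 40) (na 21 (na 19 (nr 40))) ;; .putN 25 (nr 40) 0 ;; .putN 12 (nr 40) 1) ;;
  .setN 46 1 ;;
  .loop (.ltN (nr 46) (nr 7)) (split ;;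
    forLoop 40 (nr 44) (.putN 10 (nr 40) (na 10 (nr 40) + na 10 (nr 40) + na 17 (nr 40)) ;;
      .putN 11 (nr 40) (na 11 (nr 40) + na 11 (nr 40) + na 17 (nr 40)) ;;
      .putN 25 (nr 40) (na 25 (nr 40) + na 25 (nr 40) + na 17 (nr 40))) ;;
    .setN 46 (nr 46 + nr 46))

/-- Every class of items with equal key is empty or has `d` elements. -/
def UniformKeys (N d : ℕ) (act : ℕ → Prop) [DecidablePred act] (K : ℕ → ℕ) : Prop :=
  ∀ k, (keyClass N act K k).card = 0 ∨ (keyClass N act K k).card = d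

theorem UniformKeys.even {N d : ℕ} {act : ℕ → Prop} [DecidablePred act] {K : ℕ → ℕ}
    (h : UniformKeys N (2 * d) act K) (k : ℕ) : Even (keyClass N act K k).card := by
  rcases h k with h | h <;> rw [h] <;> simp

/-- Appending an evenly distributed bit to the key halves all classes. -/
theorem UniformKeys.split {N d : ℕ} {act : ℕ → Prop} [DecidablePred act] {K K' bit : ℕ → ℕ}
    (h : UniformKeys N (2 * d) act K) (hb2 : ∀ i < N, act i → bit i < 2)
    (hb : Balanced N act K bit) (hK : ∀ i < N, K' i = 2 * K i + bit i) :
    UniformKeys N d act K' := by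
  intro k
  have e : keyClass N act K' k = (keyClass N act K (k / 2)).filter (bit · = k % 2) := by
    ext i
    simp only [keyClass, Finset.mem_filter, Finset.mem_range]
    constructor
    · rintro ⟨hi, ha, rfl⟩
      have := hb2 i hi ha
      have := hK i hi
      refine ⟨⟨hi, ha, ?_⟩, ?_⟩ <;> omega
    · rintro ⟨⟨hi, ha, h1⟩, h2⟩
      refine ⟨hi, ha, ?_⟩
      rw [hK i hi, h1, h2]; omega
  have h2 := hb.card_eq (k / 2)
  have h3 : ((keyClass N act K (k / 2)).filter (bit · = 0)).card +
      ((keyClass N act K (k / 2)).filter (bit · = 1)).card = (keyClass N act K (k / 2)).card := by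
    rw [← Finset.card_union_of_disjoint, ← Finset.filter_or]
    · congr 1
      refine Finset.filter_true_of_mem fun i hi => ?_
      simp only [keyClass, Finset.mem_filter, Finset.mem_range] at hi
      have := hb2 i hi.1 hi.2.1
      omega
    · rw [Finset.disjoint_filter]; intro i _ h; omega
  rw [e]
  rcases Nat.mod_two_eq_zero_or_one k with hk | hk <;> rw [hk] <;> rcases h (k / 2) with h | h <;>
    omega

theorem UniformKeys.inj {N : ℕ} {act : ℕ → Prop} [DecidablePred act] {K : ℕ → ℕ}
    (h : UniformKeys N 1 act K) (ha : ∀ i < N, act i) {i j : ℕ} (hi : i < N) (hj : j < N)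
    (e : K i = K j) : i = j := by
  have : (keyClass N act K (K j)).card ≤ 1 := by rcases h (K j) with h | h <;> omega
  exact Finset.card_le_one.1 this i (by simp [keyClass, hi, ha i hi, e]) j
    (by simp [keyClass, hj, ha j hj])

/-- After `b` splits, every class of edges with equal end and equal bits is a single edge, so the
bits form a proper colour. -/
theorem ev_powColour {N n b : ℕ} {m : Mem} (h44 : m.nat 44 = N) (h7 : m.nat 7 = 2 ^ b)
    (h0 : ∀ k, m.natArr 13 k = 0)
    (hS : RegularList n (2 ^ b) N (m.natArr 19) (m.natArr 20))
    (hT : RegularList n (2 ^ b) N (m.natArr 19) (m.natArr 21)) :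
    Ev powColour m fun k m' => k ≤ 6 * N + (37 * N + 12) * b + 5 ∧ (∀ k, m'.natArr 13 k = 0) ∧
      (∀ i < N, m'.natArr 25 i < 2 ^ b) ∧
      ∀ i < N, ∀ j < N, i ≠ j → m'.natArr 25 i = m'.natArr 25 j →
        m.natArr 20 (m.natArr 19 i) ≠ m.natArr 20 (m.natArr 19 j) ∧
        m.natArr 21 (m.natArr 19 i) ≠ m.natArr 21 (m.natArr 19 j) := by
  unfold powColour
  rw [ev_seq, ev_setN, ev_seq]
  set m₀ := m.setNat 30 (NExp.eval m (nr 44)) with hm₀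
  refine ev_forLoop N 4 (fun i m' => ∀ j < i, m'.natArr 10 j = m.natArr 20 (m.natArr 19 j) ∧
      m'.natArr 11 j = m.natArr 21 (m.natArr 19 j) ∧ m'.natArr 25 j = 0 ∧ m'.natArr 12 j = 1)
    (by rfl) (fun m' hF => by simp [hF.nat 44 (by rfl), hm₀, h44]) (by simp) (fun _ _ _ h => h)
    ?_ ?_
  · intro i m' hi hr hF hI
    have e19 : m'.natArr 19 = m.natArr 19 := by rw [hF.arr 19 (by rfl)]; rfl
    have e20 : m'.natArr 20 = m.natArr 20 := by rw [hF.arr 20 (by rfl)]; rfl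
    have e21 : m'.natArr 21 = m.natArr 21 := by rw [hF.arr 21 (by rfl)]; rfl
    simp only [ev_seq, ev_putN]
    simp [hr, e19, e20, e21]
    intro j hj
    have := hI j
    grind
  intro k₁ m₁ hk₁ F₁ _ a₁
  simp only [ev_seq, ev_setN]
  set m₂ := m₁.setNat 46 (NExp.eval m₁ 1) with hm₂
  have e44 : m₂.nat 44 = N := by simp [hm₂, F₁.nat 44 (by rfl), hm₀, h44]
  have e30 : m₂.nat 30 = N := by simp [hm₂, F₁.nat 30 (by rfl), hm₀, h44]
  have e7 : m₂.nat 7 = 2 ^ b := by simp [hm₂, F₁.nat 7 (by rfl), hm₀, h7]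
  have e13 : m₂.natArr 13 = m.natArr 13 := by
    show m₁.natArr 13 = _; rw [F₁.arr 13 (by rfl)]; rfl
  have hact : ∀ i < N, m₂.natArr 12 i = 1 := fun i hi => (a₁ i hi).2.2.2
  have key : ∀ {K S : ℕ → ℕ}, RegularList n (2 ^ b) N (m.natArr 19) S →
      (∀ i < N, K i = S (m.natArr 19 i)) → UniformKeys N (2 ^ b) (m₂.natArr 12 · = 1) K := by
    intro K S hR hK k
    have e : keyClass N (m₂.natArr 12 · = 1) K k =
        (Finset.range N).filter fun i => S (m.natArr 19 i) = k := by
      refine Finset.filter_congr fun i hi => ?_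
      have hi : i < N := by simpa using hi
      simp [hact i hi, hK i hi]
    rw [e]
    by_cases hk : k < n
    · exact Or.inr (hR.2 k hk)
    · left
      refine Finset.card_eq_zero.2 (Finset.filter_eq_empty_iff.2 fun i hi => ?_)
      have := hR.1 i (by simpa using hi)
      omega
  refine ev_loop (fun k m' => ∃ a, a ≤ b ∧ m'.nat 46 = 2 ^ a ∧ k ≤ (37 * N + 12) * a ∧
      (∀ k, m'.natArr 13 k = 0) ∧
      UniformKeys N (2 ^ (b - a)) (m₂.natArr 12 · = 1) (m'.natArr 10) ∧
      UniformKeys N (2 ^ (b - a)) (m₂.natArr 12 · = 1) (m'.natArr 11) ∧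
      ∀ i < N, m'.natArr 10 i = m.natArr 20 (m.natArr 19 i) * 2 ^ a + m'.natArr 25 i ∧
        m'.natArr 11 i = m.natArr 21 (m.natArr 19 i) * 2 ^ a + m'.natArr 25 i ∧
        m'.natArr 25 i < 2 ^ a) (fun m' => 2 ^ b - m'.nat 46) ?_ ?_ ?_
  · refine ⟨0, by simp, by simp [hm₂], by simp, by rw [e13]; exact h0,
      key hS fun i hi => (a₁ i hi).1, key hT fun i hi => (a₁ i hi).2.1, fun i hi => ?_⟩
    obtain ⟨h1, h2, h3, h4⟩ := a₁ i hi
    simp [hm₂, h1, h2, h3]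
  · rintro k m' hF ⟨a, hab, h46, hk, hz, hU₁, hU₂, hrep⟩ hb
    simp only [BExp.holds_ltN, NExp.eval_reg, h46, hF.nat 7 (by rfl), e7] at hb
    have hab' : a < b := (Nat.pow_lt_pow_iff_right (by norm_num)).1 hb
    have hpow : 2 ^ (b - a) = 2 * 2 ^ (b - (a + 1)) := by
      rw [← pow_succ']; congr 1; omega
    rw [hpow] at hU₁ hU₂
    have f12 : m'.natArr 12 = m₂.natArr 12 := hF.arr 12 (by rfl)
    have f44 : m'.nat 44 = N := (hF.nat 44 (by rfl)).trans e44
    rw [ev_seq]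
    refine (ev_split ((hF.nat 30 (by rfl)).trans e30) hz
      (by rw [f12]; exact hU₁.even) (by rw [f12]; exact hU₂.even)).frame.mono ?_
    rintro k₃ m₃ ⟨F₃, hk₃, hz₃, hb2, B₁, B₂⟩
    rw [f12] at hb2 B₁ B₂
    have g10 : m₃.natArr 10 = m'.natArr 10 := F₃.arr 10 (by rfl)
    have g11 : m₃.natArr 11 = m'.natArr 11 := F₃.arr 11 (by rfl)
    have g25 : m₃.natArr 25 = m'.natArr 25 := F₃.arr 25 (by rfl)
    rw [ev_seq]
    refine ev_forLoop N 3 (fun i x => (∀ j, i ≤ j → x.natArr 10 j = m'.natArr 10 j ∧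
        x.natArr 11 j = m'.natArr 11 j ∧ x.natArr 25 j = m'.natArr 25 j) ∧
      ∀ j < i, x.natArr 10 j = 2 * m'.natArr 10 j + m₃.natArr 17 j ∧
        x.natArr 11 j = 2 * m'.natArr 11 j + m₃.natArr 17 j ∧
        x.natArr 25 j = 2 * m'.natArr 25 j + m₃.natArr 17 j) (by rfl)
      (fun x hx => by simp [hx.nat 44 (by rfl), F₃.nat 44 (by rfl), f44])
      ⟨by simp [g10, g11, g25], by simp⟩ (fun _ _ _ h => h) ?_ ?_
    · rintro i x hi hr hx ⟨hI1, hI2⟩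
      obtain ⟨c1, c2, c3⟩ := hI1 i le_rfl
      simp only [ev_seq, ev_putN]
      simp [hr, hx.arr 17 (by rfl), c1, c2, c3]
      refine ⟨fun j hj => ?_, fun j hj => ?_⟩
      · rw [if_neg (by omega), if_neg (by omega), if_neg (by omega)]; exact hI1 j (by omega)
      · have := hI2 j
        grind
    rintro k₄ m₄ hk₄ F₄ - ⟨-, hnew⟩
    have g46 : m₄.nat 46 = 2 ^ a := by rw [F₄.nat 46 (by rfl), F₃.nat 46 (by rfl), h46]
    rw [ev_setN]
    refine ⟨⟨a + 1, hab', by simp [g46, pow_succ, mul_two], by rw [mul_add]; omega, ?_, ?_, ?_, ?_⟩,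
      ?_⟩
    · show ∀ k, m₄.natArr 13 k = 0
      rw [F₄.arr 13 (by rfl)]; exact hz₃
    · exact hU₁.split hb2 B₁ fun i hi => (hnew i hi).1
    · exact hU₂.split hb2 B₂ fun i hi => (hnew i hi).2.1
    · intro i hi
      obtain ⟨d1, d2, d3⟩ := hnew i hi
      obtain ⟨r1, r2, r3⟩ := hrep i hi
      have hbi := hb2 i hi (hact i hi)
      simp only [Mem.natArr_setNat]
      rw [d1, d2, d3, r1, r2, pow_succ]
      exact ⟨by ring, by ring, by omega⟩
    · have := Nat.one_le_two_pow (n := a)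
      simp [g46, h46]
      omega
  · rintro k m' hF ⟨a, hab, h46, hk, hz, hU₁, hU₂, hrep⟩ hb
    simp only [BExp.holds_ltN, NExp.eval_reg, h46, hF.nat 7 (by rfl), e7] at hb
    have hab' : ¬ a < b := fun h => hb (Nat.pow_lt_pow_right (by norm_num) h)
    obtain rfl : a = b := by omega
    simp only [Nat.sub_self, pow_zero] at hU₁ hU₂
    refine ⟨by omega, hz, fun i hi => (hrep i hi).2.2, fun i hi j hj hij hc => ⟨fun e => ?_,
      fun e => ?_⟩⟩
    · exact hij (hU₁.inj hact hi hj (by rw [(hrep i hi).1, (hrep j hj).1, e, hc]))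
    · exact hij (hU₂.inj hact hi hj (by rw [(hrep i hi).2.1, (hrep j hj).2.1, e, hc]))

/-- Store the largest power of two up to the current degree (register `6`). -/
def topPower : Prog :=
  .setN 7 1 ;; .loop (.leN (nr 7 + nr 7) (nr 6)) (.setN 7 (nr 7 + nr 7))

theorem ev_topPower {D : ℕ} {m : Mem} (h6 : m.nat 6 = D) (hD : 1 ≤ D) :
    Ev topPower m fun k m' => k ≤ 2 * D + 2 ∧
      ∃ b, m'.nat 7 = 2 ^ b ∧ 2 ^ b ≤ D ∧ D < 2 * 2 ^ b := by
  unfold topPower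
  rw [ev_seq, ev_setN]
  set m₀ := m.setNat 7 (NExp.eval m 1) with hm₀
  refine ev_loop (fun k m' => ∃ b, m'.nat 7 = 2 ^ b ∧ 2 ^ b ≤ D ∧ k ≤ 2 * 2 ^ b)
    (fun m' => D - m'.nat 7) ?_ ?_ ?_
  · exact ⟨0, by simp [hm₀], by simpa, by simp⟩
  · rintro k m' hF ⟨b, h7, hb, hk⟩ hc
    have e6 : m'.nat 6 = D := by rw [hF.nat 6 (by rfl)]; simp [hm₀, h6]
    simp [h7, e6] at hc
    have := Nat.one_le_two_pow (n := b)
    rw [ev_setN]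
    simp only [NExp.eval_add', NExp.eval_reg, h7, Mem.nat_setNat, if_true]
    exact ⟨⟨b + 1, by rw [pow_succ]; omega, by rw [pow_succ]; omega, by rw [pow_succ]; omega⟩,
      by omega⟩
  · rintro k m' hF ⟨b, h7, hb, hk⟩ hc
    have e6 : m'.nat 6 = D := by rw [hF.nat 6 (by rfl)]; simp [hm₀, h6]
    simp [h7, e6] at hc
    exact ⟨by omega, b, h7, hb, by omega⟩

/-- Extract a regular subgraph whose degree is a power of two and give its edges new colours. -/
def colourPart : Prog :=
  topPower ;; extract ;; partition ;; powColour ;;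
  forLoop 40 (nr 44) (.putN 26 (na 19 (nr 40)) (nr 47 + na 25 (nr 40))) ;;
  .setN 47 (nr 47 + nr 7) ;; .setN 6 (nr 6 - nr 7) ;; .setN 8 (nr 45)

/-- Array `26` colours the edges below `E` outside of `A` properly with colours below `o`. -/
structure PartialColouring (E : ℕ) (S T : ℕ → ℕ) (A : Finset ℕ) (o : ℕ) (cls : ℕ → ℕ) : Prop where
  lt : ∀ e < E, e ∉ A → cls e < o
  proper : ∀ e < E, ∀ e' < E, e ∉ A → e' ∉ A → e ≠ e' → cls e = cls e' → S e ≠ S e' ∧ T e ≠ T e'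

/-- The state between two rounds of the colouring of a regular bipartite multigraph: the edges in
`A` form a regular graph of degree `D` and are still uncoloured. -/
structure ColourState (n E : ℕ) (S T : ℕ → ℕ) (A : Finset ℕ) (D o : ℕ) (m : Mem) : Prop where
  n_eq : m.nat 2 = n
  D_eq : m.nat 6 = D
  q_eq : m.nat 8 = D * n
  o_eq : m.nat 47 = o
  tab : ∀ k, m.natArr 13 k = 0
  S_eq : m.natArr 20 = S
  T_eq : m.natArr 21 = T
  sub : A ⊆ Finset.range E
  list : Enumerates (m.natArr 18) (D * n) A
  regS : RegularOn n D A S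
  regT : RegularOn n D A T
  col : PartialColouring E S T A o (m.natArr 26)

/-- The new colours cost time proportional to the number of edges of degree `D`, up to a logarithm,
and reduce the degree to less than half. -/
theorem ev_colourPart {n E D o : ℕ} {S T : ℕ → ℕ} {A : Finset ℕ} {m : Mem}
    (h : ColourState n E S T A D o m) (hn : 1 ≤ n) (hD : 1 ≤ D) :
    Ev colourPart m fun k m' => k ≤ 260 * (D * n * (Nat.clog 2 (D * n) + 1)) ∧
      ∃ p B, p ≤ D ∧ D < 2 * p ∧ ColourState n E S T B (D - p) (o + p) m' := by
  unfold colourPart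
  have hq1 : 1 ≤ D * n := Nat.mul_pos hD hn
  have hDq : D ≤ D * n := Nat.le_mul_of_pos_right _ hn
  rw [ev_seq]
  refine (ev_topPower h.D_eq hD).frame.mono ?_
  rintro k₁ m₁ ⟨F₁, hk₁, b, h7, hb1, hb2⟩
  rw [ev_seq]
  have e18 : m₁.natArr 18 = m.natArr 18 := F₁.arr 18 (by rfl)
  have e20 : m₁.natArr 20 = S := (F₁.arr 20 (by rfl)).trans h.S_eq
  have e21 : m₁.natArr 21 = T := (F₁.arr 21 (by rfl)).trans h.T_eq
  refine (ev_extract (m := m₁) (q := D * n) (n := n) (D := D) (p := 2 ^ b)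
    ((F₁.nat 8 (by rfl)).trans h.q_eq) ((F₁.nat 2 (by rfl)).trans h.n_eq)
    ((F₁.nat 6 (by rfl)).trans h.D_eq) h7 hn Nat.one_le_two_pow hb1 rfl
    (by rw [F₁.arr 13 (by rfl)]; exact h.tab)
    (by rw [e18, e20]; exact h.list.regularList h.regS)
    (by rw [e18, e21]; exact h.list.regularList h.regT)).frame.mono ?_
  rintro k₂ m₂ ⟨F₂, hk₂, z₂, hw1, hwS, hwT⟩
  rw [e18, e20] at hwS
  rw [e18, e21] at hwT
  rw [ev_seq]
  have f18 : m₂.natArr 18 = m.natArr 18 := (F₂.arr 18 (by rfl)).trans e18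
  have f8 : m₂.nat 8 = D * n := by rw [F₂.nat 8 (by rfl), F₁.nat 8 (by rfl), h.q_eq]
  refine (ev_partition f8 (by rw [f18]; exact h.list)).frame.mono ?_
  rintro k₃ m₃ ⟨F₃, hk₃, B, hBA, hB, hC, hmem⟩
  rw [f18] at hmem
  -- the marked edges form a regular graph of degree `2 ^ b`
  have reg : ∀ U : ℕ → ℕ, RegularOn n D A U → (∀ v < n, ∑ i ∈ Finset.range (D * n),
      (if U (m.natArr 18 i) = v then m₂.natArr 22 i else 0) = 2 ^ b) →
      RegularOn n (2 ^ b) B U ∧ RegularOn n (D - 2 ^ b) (A \ B) U := by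
    intro U hU hw
    have h1 : ∀ v < n, (B.filter (U · = v)).card = 2 ^ b := by
      intro v hv
      rw [← hw v hv]
      have e1 : ∀ i ∈ Finset.range (D * n), (if U (m.natArr 18 i) = v then m₂.natArr 22 i else 0) =
          (fun e => if e ∈ B ∧ U e = v then 1 else 0) (m.natArr 18 i) := by
        intro i hi
        have hi : i < D * n := by simpa using hi
        have h2 := hmem i hi
        have h3 := hw1 i hi
        by_cases hu : U (m.natArr 18 i) = v
        · by_cases hB : m.natArr 18 i ∈ B
          · simp [hu, hB, h2.1 hB]
          · have : ¬ m₂.natArr 22 i = 1 := fun h => hB (h2.2 h)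
            simp [hu, hB]; omega
        · simp [hu]
      rw [Finset.sum_congr rfl e1, h.list.sum fun e => if e ∈ B ∧ U e = v then 1 else 0,
        ← Finset.card_filter]
      congr 1
      ext e
      simp only [Finset.mem_filter]
      exact ⟨fun h => ⟨hBA h.1, h⟩, fun h => h.2⟩
    refine ⟨⟨fun e he => hU.lt e (hBA he), h1⟩, ⟨fun e he => hU.lt e (Finset.mem_sdiff.1 he).1,
      fun v hv => ?_⟩⟩
    have h2 : (A \ B).filter (U · = v) = A.filter (U · = v) \ B.filter (U · = v) := by
      ext e; simp only [Finset.mem_filter, Finset.mem_sdiff]; tauto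
    rw [h2, Finset.card_sdiff_of_subset (Finset.filter_subset_filter _ hBA), hU.card v hv, h1 v hv]
  obtain ⟨regBS, regCS⟩ := reg S h.regS hwS
  obtain ⟨regBT, regCT⟩ := reg T h.regT hwT
  have cB : m₃.nat 44 = 2 ^ b * n := by rw [← hB.card, regBS.card_eq]
  have cC : m₃.nat 45 = (D - 2 ^ b) * n := by rw [← hC.card, regCS.card_eq]
  have g20 : m₃.natArr 20 = S := by rw [F₃.arr 20 (by rfl), F₂.arr 20 (by rfl), e20]
  have g21 : m₃.natArr 21 = T := by rw [F₃.arr 21 (by rfl), F₂.arr 21 (by rfl), e21]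
  rw [cB] at hB
  rw [cC] at hC
  rw [ev_seq]
  refine (ev_powColour (n := n) (b := b) cB (by rw [F₃.nat 7 (by rfl), F₂.nat 7 (by rfl), h7])
    (by rw [F₃.arr 13 (by rfl)]; exact z₂) (by rw [g20]; exact hB.regularList regBS)
    (by rw [g21]; exact hB.regularList regBT)).frame.mono ?_
  rintro k₄ m₄ ⟨F₄, hk₄, z₄, hlt, hprop⟩
  rw [g20, g21] at hprop
  rw [ev_seq]
  have i44 : m₄.nat 44 = 2 ^ b * n := (F₄.nat 44 (by rfl)).trans cB
  have i19 : m₄.natArr 19 = m₃.natArr 19 := F₄.arr 19 (by rfl)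
  have i26 : m₄.natArr 26 = m.natArr 26 := by
    rw [F₄.arr 26 (by rfl), F₃.arr 26 (by rfl), F₂.arr 26 (by rfl), F₁.arr 26 (by rfl)]
  have i47 : m₄.nat 47 = o := by
    rw [F₄.nat 47 (by rfl), F₃.nat 47 (by rfl), F₂.nat 47 (by rfl), F₁.nat 47 (by rfl), h.o_eq]
  refine ev_forLoop (2 ^ b * n) 1 (fun i m' =>
    (∀ e, e ∉ B → m'.natArr 26 e = m.natArr 26 e) ∧
    ∀ j < i, m'.natArr 26 (m₃.natArr 19 j) = o + m₄.natArr 25 j) (by rfl)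
    (fun m' hF => by simp [hF.nat 44 (by rfl), i44]) ⟨by simp [i26], by simp⟩ (fun _ _ _ h => h)
    ?_ ?_
  · rintro i m' hi hr hF ⟨hI1, hI2⟩
    rw [ev_putN]
    simp [hr, hF.arr 19 (by rfl), i19, hF.arr 25 (by rfl), hF.nat 47 (by rfl), i47]
    refine ⟨fun e he => ?_, fun j hj => ?_⟩
    · rw [if_neg (by rintro rfl; exact he (hB.mem hi))]; exact hI1 e he
    · by_cases hji : j = i
      · subst hji; simp
      · rw [if_neg (fun h => hji (hB.inj j (by omega) i hi h))]; exact hI2 j (by omega)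
  rintro k₅ m₅ hk₅ F₅ - ⟨hI1, hI2⟩
  simp only [ev_seq, ev_setN]
  have j7 : m₅.nat 7 = 2 ^ b := by
    rw [F₅.nat 7 (by rfl), F₄.nat 7 (by rfl), F₃.nat 7 (by rfl), F₂.nat 7 (by rfl), h7]
  have j6 : m₅.nat 6 = D := by
    rw [F₅.nat 6 (by rfl), F₄.nat 6 (by rfl), F₃.nat 6 (by rfl), F₂.nat 6 (by rfl),
      F₁.nat 6 (by rfl), h.D_eq]
  have j45 : m₅.nat 45 = (D - 2 ^ b) * n := by
    rw [F₅.nat 45 (by rfl), F₄.nat 45 (by rfl), cC]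
  have j47 : m₅.nat 47 = o := by rw [F₅.nat 47 (by rfl), i47]
  refine ⟨?_, 2 ^ b, A \ B, hb1, hb2, ?_⟩
  · have hbq : b ≤ Nat.clog 2 (D * n) := by
      have h1 : 2 ^ b ≤ 2 ^ Nat.clog 2 (D * n) :=
        (hb1.trans hDq).trans (Nat.le_pow_clog (by norm_num) _)
      exact (Nat.pow_le_pow_iff_right (by norm_num)).1 h1
    have h1 : 2 ^ b * n ≤ D * n := Nat.mul_le_mul_right _ hb1
    have h2 : (37 * (2 ^ b * n) + 12) * b ≤ 49 * (D * n) * Nat.clog 2 (D * n) :=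
      Nat.mul_le_mul (by omega) hbq
    rw [mul_assoc] at h2
    rw [mul_add, mul_one] at hk₂ ⊢
    omega
  · have hcol : ∀ e ∈ B, ∃ i < 2 ^ b * n, m₃.natArr 19 i = e ∧
        m₅.natArr 26 e = o + m₄.natArr 25 i := by
      intro e he
      obtain ⟨i, hi, rfl⟩ := hB.exists_of_mem he
      exact ⟨i, hi, rfl, hI2 i hi⟩
    have hBC : ∀ e, e ∉ A \ B → e ∉ B → e ∉ A := by
      intro e h1 h2 h3; exact h1 (Finset.mem_sdiff.2 ⟨h3, h2⟩)
    refine ⟨?_, ?_, ?_, ?_, ?_, ?_, ?_, Finset.sdiff_subset.trans h.sub, ?_, regCS, regCT, ⟨?_, ?_⟩⟩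
    · simp [F₅.nat 2 (by rfl), F₄.nat 2 (by rfl), F₃.nat 2 (by rfl), F₂.nat 2 (by rfl),
        F₁.nat 2 (by rfl), h.n_eq]
    · simp [j6, j7]
    · simp [j45]
    · simp [j47, j7]
    · show ∀ k, m₅.natArr 13 k = 0
      rw [F₅.arr 13 (by rfl)]; exact z₄
    · show m₅.natArr 20 = S
      rw [F₅.arr 20 (by rfl), F₄.arr 20 (by rfl), g20]
    · show m₅.natArr 21 = T
      rw [F₅.arr 21 (by rfl), F₄.arr 21 (by rfl), g21]
    · show Enumerates (m₅.natArr 18) _ _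
      rw [F₅.arr 18 (by rfl), F₄.arr 18 (by rfl)]; exact hC
    · intro e he heA
      show m₅.natArr 26 e < _
      by_cases heB : e ∈ B
      · obtain ⟨i, hi, -, e2⟩ := hcol e heB
        have := hlt i hi
        omega
      · rw [hI1 e heB]
        have := h.col.lt e he (hBC e heA heB)
        omega
    · intro e he e' he' heA heA' hne
      show m₅.natArr 26 e = m₅.natArr 26 e' → _
      intro hc
      by_cases heB : e ∈ B <;> by_cases heB' : e' ∈ B
      · obtain ⟨i, hi, rfl, e2⟩ := hcol e heB
        obtain ⟨i', hi', rfl, e2'⟩ := hcol e' heB'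
        exact hprop i hi i' hi' (by rintro rfl; exact hne rfl) (by omega)
      · obtain ⟨i, hi, rfl, e2⟩ := hcol e heB
        rw [hI1 e' heB'] at hc
        have := h.col.lt e' he' (hBC e' heA' heB')
        omega
      · obtain ⟨i', hi', rfl, e2'⟩ := hcol e' heB'
        rw [hI1 e heB] at hc
        have := h.col.lt e he (hBC e heA heB)
        omega
      · rw [hI1 e heB, hI1 e' heB'] at hc
        exact h.col.proper e he e' he' (hBC e heA heB) (hBC e' heA' heB') hne hc

/-- Colour the edges below register `5` of a bipartite multigraph that is regular of degree register
`4`, with ends in the arrays `20` and `21`, properly with as many colours (array `26`). -/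
def colourRegular : Prog :=
  forLoop 40 (nr 5) (.putN 18 (nr 40) (nr 40)) ;;
  .setN 6 (nr 4) ;; .setN 8 (nr 5) ;; .setN 47 0 ;; .loop (.ltN 0 (nr 6)) colourPart

/-- The degrees of the rounds decrease geometrically, so the costs of all rounds sum up to a
multiple of the cost of the first one. -/
theorem ev_colourRegular {n h E : ℕ} {m : Mem} (h2 : m.nat 2 = n) (h4 : m.nat 4 = h)
    (h5 : m.nat 5 = E) (hn : 1 ≤ n) (hE : E = h * n) (h0 : ∀ k, m.natArr 13 k = 0)
    (hS : RegularOn n h (Finset.range E) (m.natArr 20))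
    (hT : RegularOn n h (Finset.range E) (m.natArr 21)) :
    Ev colourRegular m fun k m' => k ≤ 540 * (h * n * (Nat.clog 2 (h * n) + 1)) + 10 ∧
      (∀ e < E, m'.natArr 26 e < h) ∧
      ∀ e < E, ∀ e' < E, e ≠ e' → m'.natArr 26 e = m'.natArr 26 e' →
        m.natArr 20 e ≠ m.natArr 20 e' ∧ m.natArr 21 e ≠ m.natArr 21 e' := by
  unfold colourRegular
  rw [ev_seq]
  refine ev_forLoop E 1 (fun i m' => ∀ j < i, m'.natArr 18 j = j) (by rfl)
    (fun m' hF => by simp [hF.nat 5 (by rfl), h5]) (by simp) (fun _ _ _ h => h) ?_ ?_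
  · intro i m' hi hr hF hI
    rw [ev_putN]
    simp [hr]
    intro j hj
    have := hI j
    grind
  intro k₁ m₁ hk₁ F₁ _ a₁
  simp only [ev_seq, ev_setN]
  set m₂ := ((m₁.setNat 6 (NExp.eval m₁ (nr 4))).setNat 8
    (NExp.eval (m₁.setNat 6 (NExp.eval m₁ (nr 4))) (nr 5))).setNat 47 _ with hm₂
  have hst : ColourState n E (m.natArr 20) (m.natArr 21) (Finset.range E) h 0 m₂ := by
    refine ⟨?_, ?_, ?_, ?_, ?_, ?_, ?_, subset_rfl, ⟨?_, ?_⟩, hS, hT, ⟨?_, ?_⟩⟩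
    · simp [hm₂, F₁.nat 2 (by rfl), h2]
    · simp [hm₂, F₁.nat 4 (by rfl), h4]
    · simp [hm₂, F₁.nat 5 (by rfl), h5, hE]
    · simp [hm₂]
    · show ∀ k, m₁.natArr 13 k = 0
      rw [F₁.arr 13 (by rfl)]; exact h0
    · exact F₁.arr 20 (by rfl)
    · exact F₁.arr 21 (by rfl)
    · intro i hi j hj
      show m₁.natArr 18 i = m₁.natArr 18 j → _
      rw [a₁ i (by omega), a₁ j (by omega)]; exact id
    · rw [← hE]
      refine (Finset.image_congr fun i hi => ?_).trans Finset.image_id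
      exact a₁ i (by simpa using hi)
    · intro e he hn; exact absurd (by simpa using he) hn
    · intro e he e' _ hn; exact absurd (by simpa using he) hn
  -- a round that lowers the degree from `D` to `D - p` costs `O(D n log(h n))`, and `D < 2 p`
  set L := n * (Nat.clog 2 (h * n) + 1) with hL
  refine ev_loop (fun k m' => ∃ A D o, D + o = h ∧ k + 522 * (L * D) ≤ 522 * (L * h) ∧
    ColourState n E (m.natArr 20) (m.natArr 21) A D o m') (fun m' => m'.nat 6) ?_ ?_ ?_
  · exact ⟨_, h, 0, rfl, by omega, hst⟩
  · rintro k m' hF ⟨A, D, o, hDo, hk, hs⟩ hb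
    simp [hs.D_eq] at hb
    refine (ev_colourPart hs hn hb).mono ?_
    rintro k' m'' ⟨hk', p, B, hp1, hp2, hs'⟩
    refine ⟨⟨B, D - p, o + p, by omega, ?_, hs'⟩, ?_⟩
    · have h1 : D * n * (Nat.clog 2 (D * n) + 1) ≤ L * D := by
        rw [hL, mul_comm _ D, ← mul_assoc]
        refine Nat.mul_le_mul le_rfl ?_
        have := Nat.clog_mono_right 2 (Nat.mul_le_mul_right n (show D ≤ h by omega))
        omega
      have h2 : L * D ≤ 2 * (L * p) := by
        rw [mul_left_comm]; exact Nat.mul_le_mul le_rfl hp2.le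
      have h3 : L * (D - p) + L * p = L * D := by rw [← mul_add]; congr 1; omega
      have h4 : 1 ≤ L * p := by
        refine Nat.mul_pos ?_ (by omega)
        exact Nat.mul_pos hn (by omega)
      omega
    · rw [hs'.D_eq, hs.D_eq]; omega
  · rintro k m' hF ⟨A, D, o, hDo, hk, hs⟩ hb
    simp [hs.D_eq] at hb
    subst hb
    obtain rfl : o = h := by omega
    have hA : A = ∅ := by
      rw [← Finset.card_eq_zero, hs.regS.card_eq]; simp
    subst hA
    refine ⟨?_, fun e he => hs.col.lt e he (by simp), fun e he e' he' => ?_⟩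
    · have e1 : L * o = o * n * (Nat.clog 2 (o * n) + 1) := by rw [hL]; ring
      have e2 : o * n * (Nat.clog 2 (o * n) + 1) = o * n * Nat.clog 2 (o * n) + o * n := by ring
      omega
    · exact hs.col.proper e he e' he' (by simp) (by simp)

/-! ### Balanced orientations -/

/-- The number of entries `v` among the first `q` entries of `f`. -/
def count (f : ℕ → ℕ) (q v : ℕ) : ℕ := ∑ i ∈ Finset.range q, if f i = v then 1 else 0

theorem count_succ (f : ℕ → ℕ) (q v : ℕ) :
    count f (q + 1) v = count f q v + if f q = v then 1 else 0 := Finset.sum_range_succ _ _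

theorem count_congr {f f' : ℕ → ℕ} {q : ℕ} (h : ∀ i < q, f' i = f i) (v : ℕ) :
    count f' q v = count f q v :=
  Finset.sum_congr rfl fun i hi => by rw [h i (by simpa using hi)]

theorem count_push {f f' : ℕ → ℕ} {q a : ℕ} (h : ∀ i < q, f' i = f i) (ha : f' q = a) (v : ℕ) :
    count f' (q + 1) v = count f q v + if a = v then 1 else 0 := by
  rw [count_succ, count_congr h, ha]

theorem sum_count {f : ℕ → ℕ} {q n : ℕ} (h : ∀ i < q, f i < n) :
    ∑ v ∈ Finset.range n, count f q v = q := by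
  unfold count
  rw [Finset.sum_comm, Finset.sum_congr rfl (g := fun _ => 1)]
  · simp
  · intro i hi
    rw [Finset.sum_ite_eq, if_pos]
    simpa using h i (by simpa using hi)

theorem sum_range_two_mul (F : ℕ → ℕ) (E : ℕ) :
    ∑ d ∈ Finset.range (2 * E), F d = ∑ e ∈ Finset.range E, (F (2 * e) + F (2 * e + 1)) := by
  induction E with
  | zero => simp
  | succ E ih =>
    rw [show 2 * (E + 1) = 2 * E + 1 + 1 by ring, Finset.sum_range_succ, Finset.sum_range_succ, ih,
      Finset.sum_range_succ]
    ring

/-- List the ends of all edges (array `11`) and compute the degrees (array `27`). -/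
def degrees : Prog :=
  forLoop 40 (nr 3) (.putN 11 (nr 40 + nr 40) (na 0 (nr 40)) ;;
    .putN 11 (nr 40 + nr 40 + 1) (na 1 (nr 40)) ;;
    .putN 27 (na 0 (nr 40)) (na 27 (na 0 (nr 40)) + 1) ;;
    .putN 27 (na 1 (nr 40)) (na 27 (na 1 (nr 40)) + 1))

theorem ev_degrees {M : ℕ} {m : Mem} (h3 : m.nat 3 = M) (h0 : ∀ k, m.natArr 27 k = 0) :
    Ev degrees m fun k m' => k ≤ 6 * M + 2 ∧
      (∀ k < M, m'.natArr 11 (2 * k) = m.natArr 0 k ∧ m'.natArr 11 (2 * k + 1) = m.natArr 1 k) ∧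
      ∀ v, m'.natArr 27 v = count (m'.natArr 11) (2 * M) v := by
  unfold degrees
  refine ev_forLoop M 4 (fun i m' => (∀ k < i, m'.natArr 11 (2 * k) = m.natArr 0 k ∧
      m'.natArr 11 (2 * k + 1) = m.natArr 1 k) ∧
      ∀ v, m'.natArr 27 v = count (m'.natArr 11) (2 * i) v) (by rfl)
    (fun m' hF => by simp [hF.nat 3 (by rfl), h3]) ⟨by simp, fun v => by simp [h0, count]⟩
    (fun _ _ _ h => h) ?_ ?_
  · rintro i m' hi hr hF ⟨hI1, hI2⟩
    simp only [ev_seq, ev_putN]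
    simp only [Mem.natArr_setArr, Mem.nat_setArr, NExp.eval_add', NExp.eval_get, NExp.eval_reg,
      NExp.eval_ofNat, hr, hF.arr 0 (by rfl), hF.arr 1 (by rfl)]
    simp
    refine ⟨fun k hk => ?_, fun v => ?_⟩
    · by_cases hki : k = i
      · subst hki
        refine ⟨?_, ?_⟩
        · rw [if_neg (by omega), if_pos (by omega)]
        · rw [if_pos (by omega)]
      · have := hI1 k (by omega)
        refine ⟨?_, ?_⟩
        · rw [if_neg (by omega), if_neg (by omega)]; exact this.1
        · rw [if_neg (by omega), if_neg (by omega)]; exact this.2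
    · rw [show 2 * (i + 1) = 2 * i + 1 + 1 by ring, 
        count_push (a := m.natArr 1 i) (fun _ _ => rfl), count_push (f := m'.natArr 11)
        (a := m.natArr 0 i), ← hI2 v]
      · by_cases h1 : v = m.natArr 1 i <;> by_cases h0 : v = m.natArr 0 i
        · simp [← h1, ← h0]
        · have h0' : ¬ m.natArr 0 i = v := fun h => h0 h.symm
          simp [← h1, h0, h0']
        · have h1' : ¬ m.natArr 1 i = v := fun h => h1 h.symm
          simp [h1, ← h0, h1']
        · have h0' : ¬ m.natArr 0 i = v := fun h => h0 h.symm
          have h1' : ¬ m.natArr 1 i = v := fun h => h1 h.symm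
          simp [h1, h0, h0', h1']
      · intro d hd
        simp
        rw [if_neg (by omega), if_neg (by omega)]
      · simp only [Mem.natArr_setArr, true_and, if_pos (two_mul i)]
        split_ifs <;> omega
      · simp; omega
  · rintro k m' hk - - ⟨h1, h2⟩
    exact ⟨by omega, h1, h2⟩

/-- `h` is half the maximum of `deg v` over `v < n`, rounded up. -/
def IsHalfMax (n : ℕ) (deg : ℕ → ℕ) (h : ℕ) : Prop :=
  (∀ v < n, deg v ≤ 2 * h) ∧ (h = 0 ∨ ∃ v < n, 2 * (h - 1) < deg v)

/-- Store half the maximum degree, rounded up. -/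
def halfMax : Prog :=
  .setN 4 0 ;; forLoop 40 (nr 2) (.loop (.ltN (nr 4 + nr 4) (na 27 (nr 40))) (.setN 4 (nr 4 + 1)))

theorem ev_halfMax {n : ℕ} {m : Mem} (h2 : m.nat 2 = n) :
    Ev halfMax m fun k m' => k ≤ 3 * n + 2 * m'.nat 4 + 3 ∧
      IsHalfMax n (m.natArr 27) (m'.nat 4) := by
  unfold halfMax
  rw [ev_seq, ev_setN]
  refine ev_forLoop' n (fun i k m' => k ≤ i + 2 * m'.nat 4 ∧
      (∀ v < i, m.natArr 27 v ≤ 2 * m'.nat 4) ∧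
      (m'.nat 4 = 0 ∨ ∃ v < n, 2 * (m'.nat 4 - 1) < m.natArr 27 v)) (by rfl)
    (fun m' hF => by simp [hF.nat 2 (by rfl), h2]) (by simp) (fun _ _ _ _ h => h) ?_ ?_
  · rintro i k m' hi hr hF ⟨hk, hI1, hI2⟩
    have e27 : m'.natArr 27 = m.natArr 27 := by rw [hF.arr 27 (by rfl)]; rfl
    refine ev_loop (fun k' x => k + k' ≤ i + 2 * x.nat 4 ∧ (∀ v < i, m.natArr 27 v ≤ 2 * x.nat 4) ∧
      (x.nat 4 = 0 ∨ ∃ v < n, 2 * (x.nat 4 - 1) < m.natArr 27 v))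
      (fun x => m.natArr 27 i - x.nat 4) ⟨by omega, hI1, hI2⟩ ?_ ?_
    · rintro k' x hx ⟨hk', hJ1, hJ2⟩ hb
      simp [hx.nat 40 (by rfl), hr, hx.arr 27 (by rfl), e27] at hb
      rw [ev_setN]
      simp
      refine ⟨⟨by omega, fun v hv => ?_, ⟨i, hi, by omega⟩⟩, by omega⟩
      have := hJ1 v hv
      omega
    · rintro k' x hx ⟨hk', hJ1, hJ2⟩ hb
      simp [hx.nat 40 (by rfl), hr, hx.arr 27 (by rfl), e27] at hb
      refine ⟨by omega, fun v hv => ?_, hJ2⟩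
      rcases Nat.lt_succ_iff_lt_or_eq.1 hv with hv | rfl
      · exact hJ1 v hv
      · omega
  · rintro k m' - - ⟨hk, h1, h2⟩
    exact ⟨by omega, h1, h2⟩

/-- Append further ends until every vertex occurs as often as twice register `4` demands. -/
def padEnds : Prog :=
  .setN 48 (nr 3 + nr 3) ;;
  forLoop 40 (nr 2) (.loop (.ltN (na 27 (nr 40)) (nr 4 + nr 4))
    (.putN 11 (nr 48) (nr 40) ;; .putN 27 (nr 40) (na 27 (nr 40) + 1) ;; .setN 48 (nr 48 + 1)))

/-- Padding ends with a list of `2 * h * n` ends in which every vertex occurs `2 * h` times, so that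
all ends can be combined to edges. -/
theorem ev_padEnds {n M h : ℕ} {m : Mem} (h2 : m.nat 2 = n) (h3 : m.nat 3 = M) (h4 : m.nat 4 = h)
    (hlt : ∀ d < 2 * M, m.natArr 11 d < n)
    (hdeg : ∀ v, m.natArr 27 v = count (m.natArr 11) (2 * M) v)
    (hle : ∀ v < n, m.natArr 27 v ≤ 2 * h) :
    Ev padEnds m fun k m' => k ≤ 8 * (h * n) + 3 * n + 3 ∧ m'.nat 48 = 2 * (h * n) ∧ M ≤ h * n ∧
      (∀ d < 2 * M, m'.natArr 11 d = m.natArr 11 d) ∧ (∀ d < 2 * (h * n), m'.natArr 11 d < n) ∧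
      ∀ v < n, count (m'.natArr 11) (2 * (h * n)) v = 2 * h := by
  unfold padEnds
  rw [ev_seq, ev_setN]
  set I : ℕ → ℕ → Mem → Prop := fun i k m' => 2 * M ≤ m'.nat 48 ∧
    (∀ d < 2 * M, m'.natArr 11 d = m.natArr 11 d) ∧ (∀ d < m'.nat 48, m'.natArr 11 d < n) ∧
    (∀ v, m'.natArr 27 v = count (m'.natArr 11) (m'.nat 48) v) ∧
    (∀ v < n, m'.natArr 27 v ≤ 2 * h) ∧ (∀ v < i, m'.natArr 27 v = 2 * h) ∧
    k + 8 * M ≤ i + 4 * m'.nat 48 with hI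
  refine ev_forLoop' n I (by rfl) (fun m' hF => by simp [hF.nat 2 (by rfl), h2]) ?_
    (fun _ _ _ _ h => h) ?_ ?_
  · have e : m.nat 3 + m.nat 3 = 2 * M := by omega
    simp [hI, e]
    refine ⟨hlt, hdeg, hle, by omega⟩
  · rintro i k m' hi hr hF hinv
    have e4 : m'.nat 4 = h := by rw [hF.nat 4 (by rfl)]; simpa using h4
    refine ev_loop (fun k' x => I i (k + k') x) (fun x => 2 * h - x.natArr 27 i) hinv ?_ ?_
    · rintro k' x hx ⟨q1, q2, q3, q4, q5, q6, q7⟩ hb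
      have r40 : x.nat 40 = i := (hx.nat 40 (by rfl)).trans hr
      simp [r40, hx.nat 4 (by rfl), e4] at hb
      simp only [ev_seq, ev_setN, ev_putN]
      simp [hI, r40]
      refine ⟨⟨by omega, fun d hd => ?_, fun d hd => ?_, fun v => ?_, fun v hv => ?_,
          fun v hv => ?_,
        by omega⟩, by omega⟩
      · rw [if_neg (by omega)]; exact q2 d hd
      · split_ifs with hdq
        · exact hi
        · exact q3 d (by omega)
      · rw [count_push (f := x.natArr 11) (a := i), ← q4 v]
        · by_cases hv : v = i
          · simp [hv]
          · have hv' : ¬ i = v := fun h => hv h.symm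
            simp [hv, hv']
        · intro d hd
          simp
          intro h; omega
        · simp
      · have := q5 v hv
        split_ifs <;> omega
      · rw [if_neg (by omega)]; exact q6 v hv
    · rintro k' x hx ⟨q1, q2, q3, q4, q5, q6, q7⟩ hb
      have r40 : x.nat 40 = i := (hx.nat 40 (by rfl)).trans hr
      simp [r40, hx.nat 4 (by rfl), e4] at hb
      refine ⟨q1, q2, q3, q4, q5, fun v hv => ?_, by omega⟩
      rcases Nat.lt_succ_iff_lt_or_eq.1 hv with hv | rfl
      · exact q6 v hv
      · have := q5 v hi
        omega
  · rintro k m' - - ⟨q1, q2, q3, q4, q5, q6, q7⟩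
    have e48 : m'.nat 48 = 2 * (h * n) := by
      rw [← sum_count q3, Finset.sum_congr rfl fun v hv =>
          (q4 v).symm.trans (q6 v (by simpa using hv))]
      simp; ring
    rw [e48] at q1 q3 q4 q7
    exact ⟨by omega, e48, by omega, q2, q3, fun v hv => by rw [← q4, q6 v hv]⟩

/-- Combine the listed ends, two at a time, to edges. -/
def pairEnds : Prog :=
  .setN 30 (nr 48) ;; .setN 5 0 ;;
  .loop (.ltN (nr 5 + nr 5) (nr 48)) (.putN 10 (nr 5 + nr 5) (nr 5) ;;
    .putN 10 (nr 5 + nr 5 + 1) (nr 5) ;; .putN 12 (nr 5 + nr 5) 1 ;;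
    .putN 12 (nr 5 + nr 5 + 1) 1 ;; .setN 5 (nr 5 + 1))

theorem ev_pairEnds {E : ℕ} {m : Mem} (h48 : m.nat 48 = 2 * E) :
    Ev pairEnds m fun k m' => k ≤ 6 * E + 3 ∧ m'.nat 30 = 2 * E ∧ m'.nat 5 = E ∧
      ∀ d < 2 * E, m'.natArr 10 d = d / 2 ∧ m'.natArr 12 d = 1 := by
  unfold pairEnds
  simp only [ev_seq, ev_setN]
  refine ev_loop (fun k m' => m'.nat 5 ≤ E ∧ k = 6 * m'.nat 5 ∧
    ∀ d < 2 * m'.nat 5, m'.natArr 10 d = d / 2 ∧ m'.natArr 12 d = 1) (fun m' => E - m'.nat 5)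
    (by simp) ?_ ?_
  · rintro k m' hF ⟨h1, h2, h3⟩ hb
    have e48 : m'.nat 48 = 2 * E := by rw [hF.nat 48 (by rfl)]; simpa using h48
    simp [e48] at hb
    simp only [ev_seq, ev_setN, ev_putN]
    simp
    refine ⟨⟨by omega, by omega, fun d hd => ?_⟩, by omega⟩
    have := h3 d
    by_cases d1 : d = m'.nat 5 + m'.nat 5 + 1
    · simp [d1]; omega
    by_cases d2 : d = m'.nat 5 + m'.nat 5
    · simp [d2]; omega
    simpa [d1, d2] using this (by omega)
  · rintro k m' hF ⟨h1, h2, h3⟩ hb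
    have e48 : m'.nat 48 = 2 * E := by rw [hF.nat 48 (by rfl)]; simpa using h48
    simp [e48] at hb
    have e5 : m'.nat 5 = E := by omega
    rw [e5] at h3
    refine ⟨by omega, ?_, e5, h3⟩
    rw [hF.nat 30 (by rfl)]
    simp [h48]

/-- Direct every edge from its end with bit `0` to its end with bit `1`. -/
def directEdges : Prog :=
  forLoop 40 (nr 5) (.ite (.eqN (na 17 (nr 40 + nr 40)) 0)
    (.putN 20 (nr 40) (na 11 (nr 40 + nr 40)) ;; .putN 21 (nr 40) (na 11 (nr 40 + nr 40 + 1)))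
    (.putN 20 (nr 40) (na 11 (nr 40 + nr 40 + 1)) ;; .putN 21 (nr 40) (na 11 (nr 40 + nr 40))))

theorem ev_directEdges {E : ℕ} {m : Mem} (h5 : m.nat 5 = E) :
    Ev directEdges m fun k m' => k ≤ 5 * E + 2 ∧ ∀ e < E,
      (m.natArr 17 (2 * e) = 0 ∧ m'.natArr 20 e = m.natArr 11 (2 * e) ∧
        m'.natArr 21 e = m.natArr 11 (2 * e + 1)) ∨
      (m.natArr 17 (2 * e) ≠ 0 ∧ m'.natArr 20 e = m.natArr 11 (2 * e + 1) ∧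
        m'.natArr 21 e = m.natArr 11 (2 * e)) := by
  unfold directEdges
  refine ev_forLoop E 3 (fun i m' => ∀ e < i,
      (m.natArr 17 (2 * e) = 0 ∧ m'.natArr 20 e = m.natArr 11 (2 * e) ∧
        m'.natArr 21 e = m.natArr 11 (2 * e + 1)) ∨
      (m.natArr 17 (2 * e) ≠ 0 ∧ m'.natArr 20 e = m.natArr 11 (2 * e + 1) ∧
        m'.natArr 21 e = m.natArr 11 (2 * e))) (by rfl)
    (fun m' hF => by simp [hF.nat 5 (by rfl), h5]) (by simp) (fun _ _ _ h => h) ?_ ?_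
  · intro i m' hi hr hF hI
    have e17 : m'.natArr 17 = m.natArr 17 := hF.arr 17 (by rfl)
    have e11 : m'.natArr 11 = m.natArr 11 := hF.arr 11 (by rfl)
    simp only [ev_ite, ev_seq, ev_putN]
    simp [hr, e17, e11, ← two_mul]
    refine ⟨fun h0 e he => ?_, fun h0 e he => ?_⟩
    · by_cases hei : e = i
      · subst hei; left; simp [h0]
      · simp only [hei, if_false]; exact hI e (by omega)
    · by_cases hei : e = i
      · subst hei; right; simp [h0]
      · simp only [hei, if_false]; exact hI e (by omega)
  · intro k m' hk _ _ h
    exact ⟨by omega, h⟩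

/-- If the two ends of every edge have different bits, and at every vertex both bits are equally
frequent among the `2 * h` ends, then directing all edges from bit `0` to bit `1` balances the
degrees. -/
theorem regularOn_of_balanced {n h E : ℕ} {vert bit S T : ℕ → ℕ}
    (hlt : ∀ d < 2 * E, vert d < n) (hcount : ∀ v < n, count vert (2 * E) v = 2 * h)
    (hbit : ∀ d < 2 * E, bit d < 2) (hflip : ∀ e < E, bit (2 * e + 1) = 1 - bit (2 * e))
    (hbal : ∀ v, (((Finset.range (2 * E)).filter (vert · = v)).filter (bit · = 0)).card =
      (((Finset.range (2 * E)).filter (vert · = v)).filter (bit · = 1)).card)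
    (hST : ∀ e < E, (bit (2 * e) = 0 ∧ S e = vert (2 * e) ∧ T e = vert (2 * e + 1)) ∨
      (bit (2 * e) ≠ 0 ∧ S e = vert (2 * e + 1) ∧ T e = vert (2 * e))) :
    RegularOn n h (Finset.range E) S ∧ RegularOn n h (Finset.range E) T := by
  have hsum : ∀ v, (((Finset.range (2 * E)).filter (vert · = v)).filter (bit · = 0)).card +
      (((Finset.range (2 * E)).filter (vert · = v)).filter (bit · = 1)).card =
      count vert (2 * E) v := by
    intro v
    rw [Finset.filter_filter, Finset.filter_filter, Finset.card_filter, Finset.card_filter,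
      ← Finset.sum_add_distrib]
    refine Finset.sum_congr rfl fun d hd => ?_
    have := hbit d (by simpa using hd)
    by_cases hv : vert d = v <;> simp [hv]
    obtain h | h : bit d = 0 ∨ bit d = 1 := by omega
    all_goals simp [h]
  have key : ∀ c < 2, ∀ U : ℕ → ℕ, (∀ e < E, U e = if bit (2 * e) = c then vert (2 * e) else
      vert (2 * e + 1)) → RegularOn n h (Finset.range E) U := by
    intro c hc U hU
    refine ⟨fun e he => ?_, fun v hv => ?_⟩
    · have he : e < E := by simpa using he
      rw [hU e he]
      split_ifs
      · exact hlt _ (by omega)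
      · exact hlt _ (by omega)
    · have h1 : ((Finset.range E).filter (U · = v)).card =
          (((Finset.range (2 * E)).filter (vert · = v)).filter (bit · = c)).card := by
        rw [Finset.filter_filter, Finset.card_filter, Finset.card_filter, sum_range_two_mul]
        refine Finset.sum_congr rfl fun e he => ?_
        have he : e < E := by simpa using he
        rw [hU e he, hflip e he]
        have := hbit (2 * e) (by omega)
        by_cases hb : bit (2 * e) = c
        · have : ¬ 1 - bit (2 * e) = c := by omega
          simp [hb]; omega
        · have h3 : 1 - bit (2 * e) = c := by omega
          simp [hb, h3]
      rw [h1]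
      have h2 := hbal v
      have h3 := hsum v
      rw [hcount v hv] at h3
      obtain rfl | rfl : c = 0 ∨ c = 1 := by omega
      all_goals omega
  refine ⟨key 0 (by norm_num) S fun e he => ?_, key 1 (by norm_num) T fun e he => ?_⟩
  · rcases hST e he with ⟨h1, h2, h3⟩ | ⟨h1, h2, h3⟩
    · rw [if_pos h1, h2]
    · rw [if_neg h1, h2]
  · rcases hST e he with ⟨h1, h2, h3⟩ | ⟨h1, h2, h3⟩
    · rw [if_neg (by omega), h3]
    · have := hbit (2 * e) (by omega)
      rw [if_pos (by omega), h3]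

/-- Add edges to the multigraph (arrays `0` and `1`) until all degrees are twice the half `h` of the
maximum degree, and direct all edges such that `h` edges leave and `h` edges enter each vertex. -/
def orient : Prog :=
  degrees ;; halfMax ;; padEnds ;; pairEnds ;; split ;; directEdges

theorem ev_orient {n M : ℕ} {m : Mem} (h2 : m.nat 2 = n) (h3 : m.nat 3 = M)
    (h13 : ∀ k, m.natArr 13 k = 0) (h27 : ∀ k, m.natArr 27 k = 0)
    (hlt : ∀ k < M, m.natArr 0 k < n ∧ m.natArr 1 k < n) :
    Ev orient m fun k m' => (∀ k, m'.natArr 13 k = 0) ∧ ∃ h,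
      k ≤ 91 * (h * n) + 6 * n + 2 * h + 21 ∧ m'.nat 4 = h ∧ m'.nat 5 = h * n ∧ M ≤ h * n ∧
      IsHalfMax n (fun v => count (m.natArr 0) M v + count (m.natArr 1) M v) h ∧
      RegularOn n h (Finset.range (h * n)) (m'.natArr 20) ∧
      RegularOn n h (Finset.range (h * n)) (m'.natArr 21) ∧
      ∀ k < M, (m'.natArr 20 k = m.natArr 0 k ∧ m'.natArr 21 k = m.natArr 1 k) ∨
        (m'.natArr 20 k = m.natArr 1 k ∧ m'.natArr 21 k = m.natArr 0 k) := by
  unfold orient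
  rw [ev_seq]
  refine (ev_degrees h3 h27).frame.mono ?_
  rintro k₁ m₁ ⟨F₁, hk₁, hends, hdeg⟩
  rw [ev_seq]
  refine (ev_halfMax ((F₁.nat 2 (by rfl)).trans h2)).frame.mono ?_
  rintro k₂ m₂ ⟨F₂, hk₂, hmax⟩
  generalize hh : m₂.nat 4 = h at *
  have a11 : m₂.natArr 11 = m₁.natArr 11 := F₂.arr 11 (by rfl)
  have a27 : m₂.natArr 27 = m₁.natArr 27 := F₂.arr 27 (by rfl)
  have hltv : ∀ d < 2 * M, m₁.natArr 11 d < n := by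
    intro d hd
    obtain ⟨h1, h2⟩ := hends (d / 2) (by omega)
    obtain ⟨h3, h4⟩ := hlt (d / 2) (by omega)
    obtain h | h : d = 2 * (d / 2) ∨ d = 2 * (d / 2) + 1 := by omega
    all_goals rw [h]; omega
  rw [ev_seq]
  refine (ev_padEnds (m := m₂) (n := n) (M := M) (by rw [F₂.nat 2 (by rfl), F₁.nat 2 (by rfl), h2])
    (by rw [F₂.nat 3 (by rfl), F₁.nat 3 (by rfl), h3]) hh (by rw [a11]; exact hltv)
    (by rw [a11, a27]; exact hdeg) (by rw [a27]; exact hmax.1)).frame.mono ?_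
  rintro k₃ m₃ ⟨F₃, hk₃, h48, hME, hold, hlt₃, hcount⟩
  rw [a11] at hold
  rw [ev_seq]
  refine (ev_pairEnds h48).frame.mono ?_
  rintro k₄ m₄ ⟨F₄, hk₄, h30, h5, hK⟩
  have b11 : m₄.natArr 11 = m₃.natArr 11 := F₄.arr 11 (by rfl)
  have b13 : m₄.natArr 13 = m.natArr 13 := by
    rw [F₄.arr 13 (by rfl), F₃.arr 13 (by rfl), F₂.arr 13 (by rfl), F₁.arr 13 (by rfl)]
  set E := h * n with hE
  have hcls : ∀ K v, keyClass (2 * E) (m₄.natArr 12 · = 1) K v =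
      (Finset.range (2 * E)).filter (K · = v) := by
    intro K v
    refine Finset.filter_congr fun d hd => ?_
    simp [(hK d (by simpa using hd)).2]
  rw [ev_seq]
  refine (ev_split h30 (by rw [b13]; exact h13) ?_ ?_).frame.mono ?_
  · intro v
    rw [hcls, Finset.card_filter, sum_range_two_mul]
    refine Finset.even_sum _ fun e he => ?_
    have he : e < E := by simpa using he
    rw [(hK (2 * e) (by omega)).1, (hK (2 * e + 1) (by omega)).1]
    rw [show (2 * e + 1) / 2 = 2 * e / 2 by omega]
    exact ⟨_, rfl⟩
  · intro v
    rw [hcls, b11, Finset.card_filter]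
    show Even (count (m₃.natArr 11) (2 * E) v)
    by_cases hv : v < n
    · rw [hcount v hv]; simp
    · have : count (m₃.natArr 11) (2 * E) v = 0 := by
        refine Finset.sum_eq_zero fun d hd => if_neg ?_
        have := hlt₃ d (by simpa using hd)
        omega
      rw [this]; simp
  rintro k₅ m₅ ⟨F₅, hk₅, z₅, hb2, ⟨f, hf, hfb⟩, B₂⟩
  have hflip : ∀ e < E, m₅.natArr 17 (2 * e + 1) = 1 - m₅.natArr 17 (2 * e) := by
    intro e he
    have ha := (hK (2 * e) (by omega)).2
    have h1 := hf.key (2 * e) (by omega) ha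
    have h2 := hf.lt (2 * e) (by omega) ha
    have h3 := hf.ne (2 * e) (by omega) ha
    rw [(hK (2 * e) (by omega)).1, (hK _ h2).1] at h1
    have h4 : f (2 * e) = 2 * e + 1 := by omega
    rw [← hfb (2 * e) (by omega) ha, h4]
  have hbal := B₂.card_eq
  simp only [hcls, b11] at hbal
  refine (ev_directEdges ((F₅.nat 5 (by rfl)).trans h5)).frame.mono ?_
  rintro k₆ m₆ ⟨F₆, hk₆, hST⟩
  rw [F₅.arr 11 (by rfl), b11] at hST
  obtain ⟨rS, rT⟩ := regularOn_of_balanced hlt₃ hcount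
    (fun d hd => hb2 d hd (hK d hd).2) hflip hbal hST
  refine ⟨by rw [F₆.arr 13 (by rfl)]; exact z₅, h, by omega, ?_, ?_, hME, ?_, rS, rT, ?_⟩
  · rw [F₆.nat 4 (by rfl), F₅.nat 4 (by rfl), F₄.nat 4 (by rfl), F₃.nat 4 (by rfl), hh]
  · rw [F₆.nat 5 (by rfl), F₅.nat 5 (by rfl), h5]
  · have e : ∀ v, count (m.natArr 0) M v + count (m.natArr 1) M v = m₁.natArr 27 v := by
      intro v
      rw [hdeg, count, count, count, sum_range_two_mul, ← Finset.sum_add_distrib]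
      refine Finset.sum_congr rfl fun k hk => ?_
      rw [(hends k (by simpa using hk)).1, (hends k (by simpa using hk)).2]
    simp only [e]
    exact hmax
  · intro k hk
    have h1 := hST k (by omega)
    rw [hold (2 * k) (by omega), hold (2 * k + 1) (by omega), (hends k hk).1, (hends k hk).2] at h1
    rcases h1 with ⟨-, h1, h2⟩ | ⟨-, h1, h2⟩
    · exact Or.inl ⟨h1, h2⟩
    · exact Or.inr ⟨h1, h2⟩

/-! ### Cutting link times into pieces -/

/-- The length of piece `j` of a link time `x`. -/
noncomputable def pieceLen (g x : ℝ) (j : ℕ) : ℝ :=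
  if j + 1 < ⌈x / g⌉₊ then g else x - (⌈x / g⌉₊ - 1) * g

/-- Row `k` of the output table describes piece `j`, of length `pieceLen g x j`, of a link from node
`a` to node `b`. -/
def RowAt (g : ℝ) (m : Mem) (a b : ℕ) (x : ℝ) (j k : ℕ) : Prop :=
  m.natArr 0 k = a ∧ m.natArr 1 k = b ∧ m.realArr 1 k = pieceLen g x j

/-- Append the pieces of the link from node register `41` to base station register `42` with link
time real register `1`. -/
def emitLink : Prog :=
  .loop (.not (.leR (.reg 1) (.cast 0)))
    (.putN 0 (nr 3) (nr 41) ;; .putN 1 (nr 3) (nr 1 + nr 42) ;;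
      .ite (.leR (.reg 1) (.reg 0)) (.putR 1 (nr 3) (.reg 1) ;; .setR 1 (.cast 0))
        (.putR 1 (nr 3) (.reg 0) ;; .setR 1 (.sub (.reg 1) (.reg 0))) ;;
      .setN 3 (nr 3 + 1))

/-- Subtracting `g` until at most `g` is left yields `⌈x / g⌉` pieces; no rounding is needed. -/
theorem ev_emitLink {a v q R : ℕ} {g x : ℝ} {m : Mem} (ha : m.nat 41 = a) (hv : m.nat 42 = v)
    (h1 : m.nat 1 = R) (h3 : m.nat 3 = q) (hg : m.real 0 = g) (hg0 : 0 < g) (hx : m.real 1 = x)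
    (hx0 : 0 ≤ x) :
    Ev emitLink m fun k m' => k = 7 * ⌈x / g⌉₊ + 1 ∧ m'.nat 3 = q + ⌈x / g⌉₊ ∧
      (∀ i < q, m'.natArr 0 i = m.natArr 0 i ∧ m'.natArr 1 i = m.natArr 1 i ∧
        m'.realArr 1 i = m.realArr 1 i) ∧
      ∀ j < ⌈x / g⌉₊, RowAt g m' a (R + v) x j (q + j) := by
  unfold emitLink
  have hlt : ∀ j : ℕ, j < ⌈x / g⌉₊ ↔ 0 < x - j * g := by
    intro j
    rw [Nat.lt_ceil, lt_div_iff₀ hg0, sub_pos]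
  refine ev_loop (fun k m' => ∃ j ≤ ⌈x / g⌉₊, k = 7 * j ∧ m'.nat 3 = q + j ∧
      m'.real 1 = (if j < ⌈x / g⌉₊ then x - j * g else 0) ∧
      (∀ i < q, m'.natArr 0 i = m.natArr 0 i ∧ m'.natArr 1 i = m.natArr 1 i ∧
        m'.realArr 1 i = m.realArr 1 i) ∧
      ∀ i < j, RowAt g m' a (R + v) x i (q + i)) (fun m' => q + ⌈x / g⌉₊ - m'.nat 3) ?_ ?_ ?_
  · refine ⟨0, by omega, by omega, by omega, ?_, by simp, by simp⟩
    split_ifs with h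
    · simp [hx]
    · have := not_lt.1 fun h' => h ((hlt 0).2 h')
      rw [hx]; push_cast at this; linarith
  · rintro k m' hF ⟨j, hj, rfl, h3', hr, hold, hrow⟩ hb
    simp only [BExp.holds_not, BExp.holds_leR, RExp.eval, hr, NExp.eval_ofNat, not_le] at hb
    have hj' : j < ⌈x / g⌉₊ := by
      by_contra h
      rw [if_neg h] at hb
      simp at hb
    rw [if_pos hj'] at hr
    have hgm : m'.real 0 = g := (hF.real 0 (by rfl)).trans hg
    have e41 : m'.nat 41 = a := (hF.nat 41 (by rfl)).trans ha
    have e42 : m'.nat 42 = v := (hF.nat 42 (by rfl)).trans hv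
    have e1 : m'.nat 1 = R := (hF.nat 1 (by rfl)).trans h1
    have hcond : x - j * g ≤ g ↔ ¬ j + 1 < ⌈x / g⌉₊ := by
      rw [hlt, not_lt]; push_cast
      constructor <;> intro h <;> linarith
    have step : ∀ y : ℝ, y = pieceLen g x j → ∀ z : ℝ,
        (z = if j + 1 < ⌈x / g⌉₊ then x - (j + 1 : ℕ) * g else 0) →
        ∀ m'' : Mem, m''.nat 3 = q + (j + 1) → m''.real 1 = z →
        (∀ i, m''.natArr 0 i = if i = q + j then a else m'.natArr 0 i) →
        (∀ i, m''.natArr 1 i = if i = q + j then R + v else m'.natArr 1 i) →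
        (∀ i, m''.realArr 1 i = if i = q + j then y else m'.realArr 1 i) →
        (∃ j' ≤ ⌈x / g⌉₊, 7 * j + 6 + 1 = 7 * j' ∧ m''.nat 3 = q + j' ∧
          m''.real 1 = (if j' < ⌈x / g⌉₊ then x - j' * g else 0) ∧
          (∀ i < q, m''.natArr 0 i = m.natArr 0 i ∧ m''.natArr 1 i = m.natArr 1 i ∧
            m''.realArr 1 i = m.realArr 1 i) ∧
          ∀ i < j', RowAt g m'' a (R + v) x i (q + i)) ∧
        q + ⌈x / g⌉₊ - m''.nat 3 < q + ⌈x / g⌉₊ - m'.nat 3 := by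
      intro y hy z hz m'' hm3 hm1 ha0 ha1 hra
      refine ⟨⟨j + 1, hj', by ring, hm3, by rw [hm1, hz], fun i hi => ?_, fun i hi => ?_⟩, ?_⟩
      · rw [ha0, ha1, hra, if_neg (by omega), if_neg (by omega), if_neg (by omega)]
        exact hold i hi
      · unfold RowAt
        rw [ha0, ha1, hra]
        by_cases hij : i = j
        · subst hij; simp [hy]
        · rw [if_neg (by omega), if_neg (by omega), if_neg (by omega)]
          exact hrow i (by omega)
      · rw [hm3, h3']; omega
    simp only [ev_seq, ev_putN, ev_ite, ev_putR, ev_setR, ev_setN]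
    refine ⟨fun hc => step (x - j * g) ?_ 0 ?_ _ ?_ ?_ ?_ ?_ ?_,
      fun hc => step g ?_ (x - j * g - g) ?_ _ ?_ ?_ ?_ ?_ ?_⟩
    all_goals
      simp only [BExp.holds_leR, RExp.eval, Mem.real_setArr, hr, hgm, hcond, not_not] at hc
    · rw [pieceLen, if_neg hc]
      have : ⌈x / g⌉₊ = j + 1 := by omega
      rw [this]; push_cast; ring
    · rw [if_neg hc]
    · simp [h3', add_assoc]
    · simp [RExp.eval]
    · simp [h3', e41]
    · simp [h3', e42, e1]
    · simp [h3', RExp.eval, hr]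
    · rw [pieceLen, if_pos hc]
    · rw [if_pos hc]; push_cast; ring
    · simp [h3', add_assoc]
    · simp [RExp.eval, hr, hgm]
    · simp [h3', e41]
    · simp [h3', e42, e1]
    · simp [h3', RExp.eval, hgm]
  · rintro k m' hF ⟨j, hj, rfl, h3', hr, hold, hrow⟩ hb
    simp only [BExp.holds_not, BExp.holds_leR, RExp.eval, hr, NExp.eval_ofNat, not_le] at hb
    have hj' : j = ⌈x / g⌉₊ := by
      by_contra h
      have h' : j < ⌈x / g⌉₊ := by omega
      rw [if_pos h'] at hb
      exact hb (by simpa using (hlt j).1 h')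
    subst hj'
    exact ⟨rfl, h3', hold, hrow⟩

/-- Store the number of nodes and list the pieces of all links of the expanded network. -/
def emitAll : Prog :=
  .setN 2 (nr 1 + nr 0) ;; .setN 49 (nr 0) ;; .setN 3 0 ;;
  forLoop 41 (nr 2) (
    forLoop 42 (nr 0) (
      .ite (.ltN (nr 41) (nr 1)) (.setR 1 (.div (.get 0 (nr 42)) (.cast (nr 1))))
        (.setR 1 (.get 0 (nr 49 + nr 42))) ;;
      emitLink) ;;
    .ite (.leN (nr 1) (nr 41)) (.setN 49 (nr 49 + nr 0)) .skip)

/-- The number of pieces of the first `l` links, where link `a * W + v` leads from node `a` to base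
station `v`. -/
noncomputable def pieceCount (W : ℕ) (g : ℝ) (X : ℕ → ℕ → ℝ) (l : ℕ) : ℕ :=
  ∑ i ∈ Finset.range l, ⌈X (i / W) (i % W) / g⌉₊

theorem pieceCount_succ (W : ℕ) (g : ℝ) (X : ℕ → ℕ → ℝ) (l : ℕ) :
    pieceCount W g X (l + 1) = pieceCount W g X l + ⌈X (l / W) (l % W) / g⌉₊ :=
  Finset.sum_range_succ _ _

theorem pieceCount_mono (W : ℕ) (g : ℝ) (X : ℕ → ℕ → ℝ) : Monotone (pieceCount W g X) :=
  monotone_nat_of_le_succ fun l => by rw [pieceCount_succ]; omega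

/-- The output table lists the pieces of the first `l` links. -/
def RowsUpTo (W R : ℕ) (g : ℝ) (X : ℕ → ℕ → ℝ) (l : ℕ) (m : Mem) : Prop :=
  m.nat 3 = pieceCount W g X l ∧ ∀ i < l, ∀ j < ⌈X (i / W) (i % W) / g⌉₊,
    RowAt g m (i / W) (R + i % W) (X (i / W) (i % W)) j (pieceCount W g X i + j)

theorem ev_emitAll {W R : ℕ} {g : ℝ} {X : ℕ → ℕ → ℝ} {m : Mem} (h0 : m.nat 0 = W)
    (h1 : m.nat 1 = R) (hg : m.real 0 = g) (hg0 : 0 < g) (hX0 : ∀ a v, 0 ≤ X a v)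
    (hgate : ∀ a < R, ∀ v < W, X a v = m.realArr 0 v / R)
    (hstat : ∀ u < W, ∀ v < W, X (R + u) v = m.realArr 0 ((u + 1) * W + v)) :
    Ev emitAll m fun k m' => k ≤ 7 * pieceCount W g X ((R + W) * W) + 5 * ((R + W) * W) +
        6 * (R + W) + 5 ∧ m'.nat 2 = R + W ∧ RowsUpTo W R g X ((R + W) * W) m' := by
  unfold emitAll
  simp only [ev_seq, ev_setN]
  set m₀ := ((m.setNat 2 (NExp.eval m (nr 1 + nr 0))).setNat 49 _).setNat 3 _ with hm₀
  refine ev_forLoop' (R + W) (fun a k m' => k ≤ 7 * pieceCount W g X (a * W) + 5 * (a * W) + 4 * a ∧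
      m'.nat 49 = (a - R + 1) * W ∧ RowsUpTo W R g X (a * W) m') (by rfl)
    (fun m' hF => by simp [hF.nat 2 (by rfl), hm₀, h0, h1]) ?_ (fun _ _ _ _ h => h) ?_ ?_
  · refine ⟨by simp, by simp [hm₀, h0], by simp [hm₀, pieceCount], by simp⟩
  · rintro a k m₁ ha hr hF ⟨hk, h49, hrows⟩
    have e0 : m₁.nat 0 = W := by rw [hF.nat 0 (by rfl)]; simpa [hm₀] using h0
    have e1 : m₁.nat 1 = R := by rw [hF.nat 1 (by rfl)]; simpa [hm₀] using h1
    have eg : m₁.real 0 = g := by rw [hF.real 0 (by rfl)]; simpa [hm₀] using hg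
    have ein : m₁.realArr 0 = m.realArr 0 := hF.realArr 0 (by rfl)
    rw [ev_seq]
    refine ev_forLoop' W (fun v k' m' => k + k' ≤ 7 * pieceCount W g X (a * W + v) + 5 * (a * W) +
        4 * a + 3 * v ∧ RowsUpTo W R g X (a * W + v) m') (by rfl)
      (fun m' hF => by simp [hF.nat 0 (by rfl), e0]) ?_ (fun _ _ _ _ h => h) ?_ ?_
    · exact ⟨by simpa using hk, hrows⟩
    · rintro v k' m₂ hv hr₂ hF₂ ⟨hk', hrows'⟩
      have hdiv : (a * W + v) / W = a := by
        rw [mul_comm, Nat.mul_add_div (by omega), Nat.div_eq_of_lt hv]; simp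
      have hmod : (a * W + v) % W = v := by
        rw [mul_comm, Nat.mul_add_mod, Nat.mod_eq_of_lt hv]
      have hload : Ev (.ite (.ltN (nr 41) (nr 1)) (.setR 1 (.div (.get 0 (nr 42)) (.cast (nr 1))))
          (.setR 1 (.get 0 (nr 49 + nr 42)))) m₂ fun k m' => k = 2 ∧ m'.real 1 = X a v := by
        have i41 : m₂.nat 41 = a := (hF₂.nat 41 (by rfl)).trans hr
        have i1 : m₂.nat 1 = R := (hF₂.nat 1 (by rfl)).trans e1
        have i49 : m₂.nat 49 = (a - R + 1) * W := (hF₂.nat 49 (by rfl)).trans h49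
        have iin : m₂.realArr 0 = m.realArr 0 := (hF₂.realArr 0 (by rfl)).trans ein
        simp only [ev_ite, ev_setR]
        simp [RExp.eval, i41, i1, i49, iin, hr₂]
        refine ⟨fun h => (hgate a h v hv).symm, fun h => ?_⟩
        rw [← hstat (a - R) (by omega) v hv]
        congr 1; omega
      rw [ev_seq]
      refine hload.frame.mono ?_
      rintro k₃ m₃ ⟨hF₃, rfl, hx⟩
      refine (ev_emitLink (m := m₃) (a := a) (v := v) (q := pieceCount W g X (a * W + v)) (R := R)
        (g := g) ?_ ?_ ?_ ?_ ?_ hg0 hx (hX0 _ _)).mono ?_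
      · rw [hF₃.nat 41 (by rfl), hF₂.nat 41 (by rfl), hr]
      · rw [hF₃.nat 42 (by rfl), hr₂]
      · rw [hF₃.nat 1 (by rfl), hF₂.nat 1 (by rfl), e1]
      · rw [hF₃.nat 3 (by rfl)]; exact hrows'.1
      · rw [hF₃.real 0 (by rfl), hF₂.real 0 (by rfl), eg]
      · rintro k₄ m₄ ⟨rfl, hq, hold, hnew⟩
        have hs := pieceCount_succ W g X (a * W + v)
        rw [hdiv, hmod] at hs
        rw [← add_assoc (a * W) v 1]
        refine ⟨by omega, by omega, fun i hi j hj => ?_⟩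
        by_cases hil : i = a * W + v
        · subst hil
          rw [hdiv, hmod] at hj ⊢
          exact hnew j hj
        · have h3 := pieceCount_succ W g X i
          have h4 := pieceCount_mono W g X (show i + 1 ≤ a * W + v by omega)
          obtain ⟨o1, o2, o3⟩ := hold (pieceCount W g X i + j) (by omega)
          have := hrows'.2 i (by omega) j hj
          unfold RowAt at this ⊢
          rw [o1, o2, o3, hF₃.arr 0 (by rfl), hF₃.arr 1 (by rfl), hF₃.realArr 1 (by rfl)]
          exact this
    · rintro k' m₂ hF₂ - ⟨hk', hrows'⟩
      have i41 : m₂.nat 41 = a := (hF₂.nat 41 (by rfl)).trans hr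
      have i1 : m₂.nat 1 = R := (hF₂.nat 1 (by rfl)).trans e1
      have i0 : m₂.nat 0 = W := (hF₂.nat 0 (by rfl)).trans e0
      have i49 : m₂.nat 49 = (a - R + 1) * W := (hF₂.nat 49 (by rfl)).trans h49
      have hs : (a + 1) * W = a * W + W := by ring
      simp only [ev_ite, ev_setN, ev_skip, hs]
      refine ⟨fun h => ⟨by omega, ?_, hrows'⟩, fun h => ⟨by omega, ?_, hrows'⟩⟩
      · simp [i41, i1] at h
        simp [i49, i0]
        rw [show a + 1 - R = a - R + 1 by omega]; ring
      · simp [i41, i1] at h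
        rw [i49, show a + 1 - R = a - R by omega]
  · rintro k m' hF - ⟨hk, -, hrows⟩
    refine ⟨by omega, ?_, hrows⟩
    rw [hF.nat 2 (by rfl)]
    simp [hm₀, h0, h1]

/-! ### Three colours for each class, and the output -/

/-- Give the edges (in their order) the least of three colours that is not used by an edge of the
same class that ends where the edge starts or starts where it ends.  Array `28` tabulates the
multiples of the number of nodes; the arrays `29` and `30` hold, for every class and node, one more
than the colour of the edge of the class that leaves and enters the node. -/
def threeColour : Prog :=
  .putN 28 0 0 ;;
  forLoop 40 (nr 4) (.putN 28 (nr 40 + 1) (na 28 (nr 40) + nr 2)) ;;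
  forLoop 40 (nr 3) (
    .setN 50 (na 28 (na 26 (nr 40))) ;;
    .setN 51 (na 29 (nr 50 + na 21 (nr 40))) ;;
    .setN 52 (na 30 (nr 50 + na 20 (nr 40))) ;;
    .ite (.and (.not (.eqN (nr 51) 1)) (.not (.eqN (nr 52) 1))) (.setN 53 0)
      (.ite (.and (.not (.eqN (nr 51) 2)) (.not (.eqN (nr 52) 2))) (.setN 53 1) (.setN 53 2)) ;;
    .putN 29 (nr 50 + na 20 (nr 40)) (nr 53 + 1) ;;
    .putN 30 (nr 50 + na 21 (nr 40)) (nr 53 + 1) ;;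
    .putN 2 (nr 40) (na 26 (nr 40) + na 26 (nr 40) + na 26 (nr 40) + nr 53))

theorem mul_add_inj {n a b u v : ℕ} (hu : u < n) (hv : v < n) (h : n * a + u = n * b + v) :
    a = b ∧ u = v := by
  have h1 : (n * a + u) / n = (n * b + v) / n := by rw [h]
  rw [Nat.mul_add_div (by omega), Nat.mul_add_div (by omega), Nat.div_eq_of_lt hu,
    Nat.div_eq_of_lt hv] at h1
  have h2 : a = b := by omega
  subst h2
  exact ⟨rfl, by omega⟩

/-- In the class of an edge, at most one edge enters its start and at most one leaves its end, so
one of three colours is free. -/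
theorem ev_threeColour {n h M : ℕ} {m : Mem} (h2 : m.nat 2 = n) (h3 : m.nat 3 = M)
    (h4 : m.nat 4 = h) (hcls : ∀ k < M, m.natArr 26 k < h)
    (hS : ∀ k < M, m.natArr 20 k < n) (hT : ∀ k < M, m.natArr 21 k < n)
    (hproper : ∀ k < M, ∀ k' < M, k ≠ k' → m.natArr 26 k = m.natArr 26 k' →
      m.natArr 20 k ≠ m.natArr 20 k' ∧ m.natArr 21 k ≠ m.natArr 21 k') :
    Ev threeColour m fun k m' => k ≤ 3 * h + 11 * M + 5 ∧
      (∀ k < M, ∃ c < 3, m'.natArr 2 k = 3 * m.natArr 26 k + c) ∧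
      ∀ k < M, ∀ k' < M, k ≠ k' → m.natArr 26 k = m.natArr 26 k' →
        m.natArr 20 k = m.natArr 21 k' → m'.natArr 2 k ≠ m'.natArr 2 k' := by
  unfold threeColour
  rw [ev_seq, ev_putN, ev_seq]
  set m₀ := m.setArr 28 (NExp.eval m 0) (NExp.eval m 0) with hm₀
  refine ev_forLoop h 1 (fun i m' => ∀ j ≤ i, m'.natArr 28 j = n * j) (by rfl)
    (fun m' hF => by simp [hF.nat 4 (by rfl), hm₀, h4]) (by simp [hm₀]) (fun _ _ _ h => h) ?_ ?_
  · intro i m' hi hr hF hI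
    have e2 : m'.nat 2 = n := by rw [hF.nat 2 (by rfl)]; simpa [hm₀] using h2
    rw [ev_putN]
    simp [hr, hI i le_rfl, e2]
    intro j hj
    split_ifs with hji
    · rw [hji]; ring
    · exact hI j (by omega)
  intro k₁ m₁ hk₁ F₁ _ hmul
  have e3 : m₁.nat 3 = M := by rw [F₁.nat 3 (by rfl)]; simpa [hm₀] using h3
  have hclsn : ∀ j < M, ∀ i < M, ∀ u < n, ∀ v < n,
      n * m.natArr 26 j + u = n * m.natArr 26 i + v → m.natArr 26 j = m.natArr 26 i ∧ u = v :=
    fun j _ i _ u hu v hv h => mul_add_inj hu hv h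
  refine ev_forLoop M 9 (fun i m' => (∀ j < i, ∃ c < 3, m'.natArr 2 j = 3 * m.natArr 26 j + c ∧
      m'.natArr 29 (n * m.natArr 26 j + m.natArr 20 j) = c + 1 ∧
      m'.natArr 30 (n * m.natArr 26 j + m.natArr 21 j) = c + 1) ∧
      ∀ k < i, ∀ k' < i, k ≠ k' → m.natArr 26 k = m.natArr 26 k' →
        m.natArr 20 k = m.natArr 21 k' → m'.natArr 2 k ≠ m'.natArr 2 k') (by rfl)
    (fun m' hF => by simp [hF.nat 3 (by rfl), e3]) (by simp) (fun _ _ _ h => h) ?_ ?_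
  · rintro i m' hi hr hF ⟨hI1, hI2⟩
    have e26 : m'.natArr 26 = m.natArr 26 := by
      rw [hF.arr 26 (by rfl), F₁.arr 26 (by rfl)]; funext; simp [hm₀]
    have e20 : m'.natArr 20 = m.natArr 20 := by
      rw [hF.arr 20 (by rfl), F₁.arr 20 (by rfl)]; funext; simp [hm₀]
    have e21 : m'.natArr 21 = m.natArr 21 := by
      rw [hF.arr 21 (by rfl), F₁.arr 21 (by rfl)]; funext; simp [hm₀]
    have e28 : m'.natArr 28 (m.natArr 26 i) = n * m.natArr 26 i := by
      rw [hF.arr 28 (by rfl)]; exact hmul _ (hcls i hi).le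
    set a := m'.natArr 29 (n * m.natArr 26 i + m.natArr 21 i) with ha
    set b := m'.natArr 30 (n * m.natArr 26 i + m.natArr 20 i) with hb
    have step : ∀ c < 3, c + 1 ≠ a → c + 1 ≠ b → ∀ m'' : Mem,
        (∀ k, m''.natArr 2 k = if k = i then m.natArr 26 i + m.natArr 26 i + m.natArr 26 i + c else
          m'.natArr 2 k) →
        (∀ k, m''.natArr 29 k = if k = n * m.natArr 26 i + m.natArr 20 i then c + 1 else
          m'.natArr 29 k) →
        (∀ k, m''.natArr 30 k = if k = n * m.natArr 26 i + m.natArr 21 i then c + 1 else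
          m'.natArr 30 k) →
        (∀ j < i + 1, ∃ c < 3, m''.natArr 2 j = 3 * m.natArr 26 j + c ∧
          m''.natArr 29 (n * m.natArr 26 j + m.natArr 20 j) = c + 1 ∧
          m''.natArr 30 (n * m.natArr 26 j + m.natArr 21 j) = c + 1) ∧
        ∀ k < i + 1, ∀ k' < i + 1, k ≠ k' → m.natArr 26 k = m.natArr 26 k' →
          m.natArr 20 k = m.natArr 21 k' → m''.natArr 2 k ≠ m''.natArr 2 k' := by
      intro c hc hca hcb m'' h₂ h₂₉ h₃₀
      refine ⟨fun j hj => ?_, fun k hk k' hk' hne hcl hST => ?_⟩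
      · by_cases hji : j = i
        · subst hji
          refine ⟨c, hc, ?_, ?_, ?_⟩
          · rw [h₂, if_pos rfl]; ring
          · rw [h₂₉, if_pos rfl]
          · rw [h₃₀, if_pos rfl]
        · obtain ⟨d, hd, d1, d2, d3⟩ := hI1 j (by omega)
          refine ⟨d, hd, ?_, ?_, ?_⟩
          · rw [h₂, if_neg hji, d1]
          · rw [h₂₉, if_neg, d2]
            intro h
            obtain ⟨q1, q2⟩ := hclsn j (by omega) i hi _ (hS j (by omega)) _ (hS i hi) h
            exact (hproper j (by omega) i hi hji q1).1 q2
          · rw [h₃₀, if_neg, d3]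
            intro h
            obtain ⟨q1, q2⟩ := hclsn j (by omega) i hi _ (hT j (by omega)) _ (hT i hi) h
            exact (hproper j (by omega) i hi hji q1).2 q2
      · by_cases hki : k = i <;> by_cases hki' : k' = i
        · omega
        · subst hki
          obtain ⟨d, hd, d1, d2, d3⟩ := hI1 k' (by omega)
          rw [h₂, h₂, if_pos rfl, if_neg hki', d1]
          rw [← hcl, ← hST, ← hb] at d3
          omega
        · subst hki'
          obtain ⟨d, hd, d1, d2, d3⟩ := hI1 k (by omega)
          rw [h₂, h₂, if_pos rfl, if_neg hki, d1]
          rw [hcl, hST, ← ha] at d2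
          omega
        · rw [h₂, h₂, if_neg hki, if_neg hki']
          exact hI2 k (by omega) k' (by omega) hne hcl hST
    simp only [ev_seq, ev_setN, ev_putN, ev_ite]
    refine ⟨fun h0 => ⟨by omega, step 0 (by norm_num) ?_ ?_ _ ?_ ?_ ?_⟩,
      fun h0 => ⟨fun h1 => ⟨by omega, step 1 (by norm_num) ?_ ?_ _ ?_ ?_ ?_⟩,
        fun h1 => ⟨by omega, step 2 (by norm_num) ?_ ?_ _ ?_ ?_ ?_⟩⟩⟩
    all_goals
      simp [hr, e26, e20, e21, e28, ← ha, ← hb] at *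
    all_goals omega
  · rintro k m' hk - - ⟨g1, g2⟩
    refine ⟨by omega, fun k hk => ?_, g2⟩
    obtain ⟨c, hc, d1, -, -⟩ := g1 k hk
    exact ⟨c, hc, d1⟩

/-- Scale the schedule to unit length, if necessary, and store the results in the output
registers. -/
def writeOutput : Prog :=
  .setN 0 (nr 4 + nr 4 + nr 4) ;;
  .setR 2 (.mul (.cast (nr 0)) (.reg 0)) ;;
  .ite (.leR (.reg 2) (.cast 1)) (.setR 3 (.cast 1)) (.setR 3 (.div (.cast 1) (.reg 2))) ;;
  forLoop 40 (nr 3) (.putR 1 (nr 40) (.mul (.reg 3) (.get 1 (nr 40)))) ;;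
  .setR 0 (.mul (.reg 3) (.reg 0)) ;;
  .setN 1 (nr 3)

theorem ev_writeOutput {h M : ℕ} {g : ℝ} {m : Mem} (h3 : m.nat 3 = M) (h4 : m.nat 4 = h)
    (hg : m.real 0 = g) :
    Ev writeOutput m fun k m' => k ≤ 3 * M + 8 ∧ m'.nat 0 = 3 * h ∧ m'.nat 1 = M ∧
      m'.real 0 = scaleFactor g (3 * h) * g ∧
      ∀ k < M, m'.realArr 1 k = scaleFactor g (3 * h) * m.realArr 1 k := by
  have hscale : Ev (.ite (.leR (.reg 2) (.cast 1)) (.setR 3 (.cast 1))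
      (.setR 3 (.div (.cast 1) (.reg 2)))) ((m.setNat 0 (3 * h)).setReal 2 (((3 * h : ℕ) : ℝ) * g))
      fun k m' => k = 2 ∧ m'.real 3 = scaleFactor g (3 * h) := by
    simp only [ev_ite, ev_setR]
    simp only [BExp.holds_leR, RExp.eval, NExp.eval_ofNat, Mem.real_setReal, if_true, not_le,
      scaleFactor]
    refine ⟨fun hc => ⟨trivial, ?_⟩, fun hc => ⟨trivial, ?_⟩⟩
    · rw [if_neg (by simpa using hc)]; simp
    · rw [if_pos (by simpa using hc)]; simp
  unfold writeOutput
  rw [ev_seq, ev_setN, ev_seq, ev_setR, ev_seq]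
  have e1 : (nr 4 + nr 4 + nr 4).eval m = 3 * h := by simp [h4]; ring
  have e2 : (RExp.mul (.cast (nr 0)) (.reg 0)).eval (m.setNat 0 (3 * h)) =
      ((3 * h : ℕ) : ℝ) * g := by
    simp [RExp.eval, hg]
  rw [e1, e2]
  refine hscale.frame.mono ?_
  rintro k₁ m₁ ⟨F₁, rfl, hs⟩
  have i3 : m₁.nat 3 = M := by rw [F₁.nat 3 (by rfl)]; simpa using h3
  have ig : m₁.real 0 = g := by rw [F₁.real 0 (by rfl)]; simpa using hg
  have i0 : m₁.nat 0 = 3 * h := by rw [F₁.nat 0 (by rfl)]; simp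
  have ir : m₁.realArr 1 = m.realArr 1 := by rw [F₁.realArr 1 (by rfl)]; simp
  rw [ev_seq]
  refine ev_forLoop M 1 (fun i m' =>
    (∀ k, i ≤ k → m'.realArr 1 k = m.realArr 1 k) ∧
    ∀ k < i, m'.realArr 1 k = scaleFactor g (3 * h) * m.realArr 1 k) (by rfl)
    (fun m' hF => by simp [hF.nat 3 (by rfl), i3]) ⟨by simp [ir], by simp⟩ (fun _ _ _ h => h) ?_ ?_
  · rintro i m' hi hr hF ⟨hI1, hI2⟩
    have j3 : m'.real 3 = scaleFactor g (3 * h) := (hF.real 3 (by rfl)).trans hs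
    rw [ev_putR]
    simp [RExp.eval, hr, j3, hI1 i le_rfl]
    refine ⟨fun k hk => ?_, fun k hk => ?_⟩
    · rw [if_neg (by omega)]; exact hI1 k (by omega)
    · split_ifs with hki
      · rw [hki]
      · exact hI2 k (by omega)
  · rintro k m' hk hF - ⟨-, hI⟩
    have j3 : m'.real 3 = scaleFactor g (3 * h) := (hF.real 3 (by rfl)).trans hs
    have jg : m'.real 0 = g := (hF.real 0 (by rfl)).trans ig
    simp only [ev_seq, ev_setR, ev_setN]
    refine ⟨by omega, ?_, ?_, ?_, hI⟩
    · simp [hF.nat 0 (by rfl), i0]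
    · simp [hF.nat 3 (by rfl), i3]
    · simp [RExp.eval, j3, jg]

/-- The program of step (ii). -/
def scheduleProg : Prog :=
  emitAll ;; orient ;; colourRegular ;; threeColour ;; writeOutput

/-- The outcome of the program in terms of the numbers of nodes, links and pieces: link `i` leads
from node `i / W` to base station `i % W`; `S` and `T` are the ends of the oriented pieces and `cls`
is the colouring of the bipartite multigraph. -/
theorem ev_scheduleProg {W R : ℕ} {g : ℝ} {X : ℕ → ℕ → ℝ} {m : Mem} (h0 : m.nat 0 = W)
    (h1 : m.nat 1 = R) (hW : 1 ≤ W) (hR : 1 ≤ R) (hg : m.real 0 = g) (hg0 : 0 < g)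
    (hzero : ∀ a k, m.natArr a k = 0) (hX0 : ∀ a v, 0 ≤ X a v)
    (hgate : ∀ a < R, ∀ v < W, X a v = m.realArr 0 v / R)
    (hstat : ∀ u < W, ∀ v < W, X (R + u) v = m.realArr 0 ((u + 1) * W + v)) :
    Ev scheduleProg m fun k m' => ∃ (h M : ℕ) (S T cls : ℕ → ℕ),
      M = pieceCount W g X ((R + W) * W) ∧
      k ≤ 672 * (h * (R + W) * (Nat.clog 2 (h * (R + W)) + 1)) + 17 * ((R + W) * W) + 49 ∧
      (∀ i < (R + W) * W, ∀ j < ⌈X (i / W) (i % W) / g⌉₊,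
        m'.natArr 0 (pieceCount W g X i + j) = i / W ∧
        m'.natArr 1 (pieceCount W g X i + j) = R + i % W ∧
        m'.realArr 1 (pieceCount W g X i + j) =
          scaleFactor g (3 * h) * pieceLen g (X (i / W) (i % W)) j) ∧
      IsHalfMax (R + W) (fun v => count (m'.natArr 0) M v + count (m'.natArr 1) M v) h ∧
      (∀ k < M, (S k = m'.natArr 0 k ∧ T k = m'.natArr 1 k) ∨
        (S k = m'.natArr 1 k ∧ T k = m'.natArr 0 k)) ∧
      (∀ k < M, cls k < h) ∧
      (∀ k < M, ∀ k' < M, k ≠ k' → cls k = cls k' → S k ≠ S k' ∧ T k ≠ T k') ∧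
      (∀ k < M, ∃ c < 3, m'.natArr 2 k = 3 * cls k + c) ∧
      (∀ k < M, ∀ k' < M, k ≠ k' → cls k = cls k' → S k = T k' →
        m'.natArr 2 k ≠ m'.natArr 2 k') ∧
      m'.nat 0 = 3 * h ∧ m'.nat 1 = M ∧ m'.real 0 = scaleFactor g (3 * h) * g := by
  unfold scheduleProg
  rw [ev_seq]
  refine (ev_emitAll h0 h1 hg hg0 hX0 hgate hstat).frame.mono ?_
  rintro k₁ m₁ ⟨F₁, hk₁, hn, hM, hrows⟩
  set M := pieceCount W g X ((R + W) * W) with hMdef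
  -- the number of a piece determines the link it belongs to
  have hfind : ∀ k < M, ∃ i < (R + W) * W, ∃ j < ⌈X (i / W) (i % W) / g⌉₊,
      k = pieceCount W g X i + j := by
    have : ∀ L, ∀ k < pieceCount W g X L, ∃ i < L, ∃ j < ⌈X (i / W) (i % W) / g⌉₊,
        k = pieceCount W g X i + j := by
      intro L
      induction L with
      | zero => intro k hk; simp [pieceCount] at hk
      | succ L ih =>
        intro k hk
        rw [pieceCount_succ] at hk
        by_cases h : k < pieceCount W g X L
        · obtain ⟨i, hi, j, hj, e⟩ := ih k h
          exact ⟨i, by omega, j, hj, e⟩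
        · exact ⟨L, by omega, k - pieceCount W g X L, by omega, by omega⟩
    exact this _
  have hlt : ∀ k < M, m₁.natArr 0 k < R + W ∧ m₁.natArr 1 k < R + W := by
    intro k hk
    obtain ⟨i, hi, j, hj, rfl⟩ := hfind k hk
    obtain ⟨r1, r2, -⟩ := hrows i hi j hj
    rw [r1, r2]
    have := Nat.mod_lt i (show W > 0 by omega)
    exact ⟨Nat.div_lt_of_lt_mul (by rwa [mul_comm]), by omega⟩
  rw [ev_seq]
  refine (ev_orient (m := m₁) hn hM (by rw [F₁.arr 13 (by rfl)]; exact hzero 13)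
    (by rw [F₁.arr 27 (by rfl)]; exact hzero 27) hlt).frame.mono ?_
  rintro k₂ m₂ ⟨F₂, hz, h, hk₂, h4, h5, hME, hmax, rS, rT, hST⟩
  rw [ev_seq]
  refine (ev_colourRegular (m := m₂) (n := R + W) (h := h) (E := h * (R + W))
    (by rw [F₂.nat 2 (by rfl), hn]) h4 h5 (by omega) rfl hz rS rT).frame.mono ?_
  rintro k₃ m₃ ⟨F₃, hk₃, hcls, hprop⟩
  have a20 : m₃.natArr 20 = m₂.natArr 20 := F₃.arr 20 (by rfl)
  have a21 : m₃.natArr 21 = m₂.natArr 21 := F₃.arr 21 (by rfl)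
  rw [ev_seq]
  refine (ev_threeColour (m := m₃) (n := R + W) (h := h) (M := M)
    (by rw [F₃.nat 2 (by rfl), F₂.nat 2 (by rfl), hn])
    (by rw [F₃.nat 3 (by rfl), F₂.nat 3 (by rfl), hM]) (by rw [F₃.nat 4 (by rfl), h4])
    (fun k hk => hcls k (by omega)) ?_ ?_ ?_).frame.mono ?_
  · intro k hk; rw [a20]; exact rS.lt k (by simp; omega)
  · intro k hk; rw [a21]; exact rT.lt k (by simp; omega)
  · intro k hk k' hk'
    rw [a20, a21]
    exact hprop k (by omega) k' (by omega)
  rintro k₄ m₄ ⟨F₄, hk₄, hcol, hthree⟩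
  rw [a20, a21] at hthree
  refine (ev_writeOutput (m := m₄) (h := h) (M := M) (g := g) ?_ ?_ ?_).frame.mono ?_
  · rw [F₄.nat 3 (by rfl), F₃.nat 3 (by rfl), F₂.nat 3 (by rfl), hM]
  · rw [F₄.nat 4 (by rfl), F₃.nat 4 (by rfl), h4]
  · rw [F₄.real 0 (by rfl), F₃.real 0 (by rfl), F₂.real 0 (by rfl), F₁.real 0 (by rfl), hg]
  rintro k₅ m₅ ⟨F₅, hk₅, o0, o1, or0, orr⟩
  have b0 : m₅.natArr 0 = m₁.natArr 0 := by
    rw [F₅.arr 0 (by rfl), F₄.arr 0 (by rfl), F₃.arr 0 (by rfl), F₂.arr 0 (by rfl)]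
  have b1 : m₅.natArr 1 = m₁.natArr 1 := by
    rw [F₅.arr 1 (by rfl), F₄.arr 1 (by rfl), F₃.arr 1 (by rfl), F₂.arr 1 (by rfl)]
  have b2 : m₅.natArr 2 = m₄.natArr 2 := F₅.arr 2 (by rfl)
  have br : m₄.realArr 1 = m₁.realArr 1 := by
    rw [F₄.realArr 1 (by rfl), F₃.realArr 1 (by rfl), F₂.realArr 1 (by rfl)]
  refine ⟨h, M, m₂.natArr 20, m₂.natArr 21, m₃.natArr 26, rfl, ?_, ?_, ?_, ?_, ?_, ?_, ?_, ?_,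
    o0, o1,
    or0⟩
  · set n := R + W
    have c1 : h * n * (Nat.clog 2 (h * n) + 1) = h * n * Nat.clog 2 (h * n) + h * n := by ring
    have c2 : h ≤ h * n := Nat.le_mul_of_pos_right _ (by omega)
    have c3 : n ≤ n * W := Nat.le_mul_of_pos_right _ (by omega)
    omega
  · intro i hi j hj
    obtain ⟨r1, r2, r3⟩ := hrows i hi j hj
    have hlt : pieceCount W g X i + j < M := by
      have := pieceCount_mono W g X (show i + 1 ≤ (R + W) * W by omega)
      rw [pieceCount_succ] at this
      omega
    rw [b0, b1, orr _ hlt, br, r3]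
    exact ⟨r1, r2, rfl⟩
  · rw [b0, b1]; exact hmax
  · rw [b0, b1]; exact hST
  · exact fun k hk => hcls k (by omega)
  · exact fun k hk k' hk' => hprop k (by omega) k' (by omega)
  · rw [b2]; exact hcol
  · rw [b2]; exact hthree

/-! ### The maximum degree of the colouring graph -/

section

variable {W R : ℕ} {g : ℝ} {t : LinkTime W} {N : Network W}

theorem card_piece (P : XLink W R → Prop) [DecidablePred P] :
    Nat.card {d : Piece R g t // P d.1} = ∑ e, if P e then ⌈expand R t e / g⌉₊ else 0 := by
  classical
  rw [Nat.card_eq_fintype_card, Fintype.card_subtype, Finset.card_filter, Fintype.sum_sigma]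
  refine Finset.sum_congr rfl fun e _ => ?_
  by_cases h : P e <;> simp [h]

theorem sum_xlink {M : Type*} [AddCommMonoid M] (f : XLink W R → M) :
    ∑ e, f e = ∑ v, (∑ r : Fin R, f (.inl r, v) + ∑ u : Fin W, f (.inr u, v)) := by
  rw [Fintype.sum_prod_type, Fintype.sum_sum_type, Finset.sum_comm,
    Finset.sum_comm (f := fun u v => f (.inr u, v)), Finset.sum_add_distrib]

theorem degree_inl (r : Fin R) :
    (colouringGraph R g t).degree (.inl r) = ∑ v, ⌈t none v / R / g⌉₊ := by
  have h1 := card_piece (g := g) (t := t) (R := R) fun e => e.1 = .inl r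
  have h2 := card_piece (g := g) (t := t) (R := R) fun e => (.inr e.2 : Node W R) = .inl r
  refine (congrArg₂ (· + ·) h1 h2).trans ?_
  simp [sum_xlink, expand]

theorem degree_inr (v : Fin W) :
    (colouringGraph R g t).degree (.inr v) =
      ∑ w, ⌈t (some v) w / g⌉₊ + (R * ⌈t none v / R / g⌉₊ + ∑ u, ⌈t (some u) v / g⌉₊) := by
  have h1 := card_piece (g := g) (t := t) (R := R) fun e => e.1 = .inr v
  have h2 := card_piece (g := g) (t := t) (R := R) fun e => (.inr e.2 : Node W R) = .inr v
  refine (congrArg₂ (· + ·) h1 h2).trans ?_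
  simp [sum_xlink, expand, Finset.sum_add_distrib, Finset.sum_ite_eq']

theorem natCeil_le_indicator {x : ℝ} (hx : 0 ≤ x) (hg : 0 < g) :
    (⌈x / g⌉₊ : ℝ) ≤ x / g + if 0 < x then 1 else 0 := by
  rcases hx.eq_or_lt with rfl | h
  · simp
  · simpa [h] using (Nat.ceil_lt_add_one (div_nonneg hx hg.le)).le

theorem StepOneFeasible.gateway (h : StepOneFeasible N R t) : ∑ v, t none v ≤ R := by
  obtain ⟨τ, hτ, -, -, h4⟩ := h.idle
  have : 0 ≤ ∑ k ∈ Finset.Icc 1 (W / 2), max 0 ((R : ℝ) - W + 2 * k) * τ k :=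
    Finset.sum_nonneg fun k hk => mul_nonneg (le_max_left _ _) (hτ k hk)
  linarith

/-- A link into or out of a base station has one of the other `W - 1` base stations or one of the
`R` gateway nodes as its other end, and no two of them are antiparallel; so rounding up adds at most
`W + R - 1` to the degree. -/
theorem maxDegree_le (hW : 1 ≤ W) (hR : 1 ≤ R) (hg : 0 < g) (h : StepOneFeasible N R t)
    (hc : NoDirectedCycle t) :
    ((colouringGraph R g t).maxDegree : ℝ) ≤ 1 / g + W + R - 1 := by
  have hW' : (1 : ℝ) ≤ W := by exact_mod_cast hW
  have hR' : (1 : ℝ) ≤ R := by exact_mod_cast hR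
  have hR0 : (0 : ℝ) < R := by linarith
  have key : ∀ x, ((colouringGraph R g t).degree x : ℝ) ≤ 1 / g + W + R - 1 := by
    rintro (r | v)
    · rw [degree_inl]
      push_cast
      have h1 : ∀ v, (⌈t none v / R / g⌉₊ : ℝ) ≤ t none v / R / g + 1 := fun v =>
        (natCeil_le_indicator (div_nonneg (h.nonneg _ _) hR0.le) hg).trans
          (by split_ifs <;> linarith)
      calc ∑ v, (⌈t none v / R / g⌉₊ : ℝ) ≤ ∑ v, (t none v / R / g + 1) :=
            Finset.sum_le_sum fun v _ => h1 v
        _ = (∑ v, t none v) / R / g + W := by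
            rw [Finset.sum_add_distrib, Finset.sum_div, Finset.sum_div]; simp
        _ ≤ 1 / g + W := by
            have : (∑ v, t none v) / R ≤ 1 := (div_le_one hR0).2 h.gateway
            have := div_le_div_of_nonneg_right this hg.le
            linarith
        _ ≤ _ := by linarith
    · rw [degree_inr]
      push_cast
      have h1 : ∀ w, (⌈t (some v) w / g⌉₊ : ℝ) + ⌈t (some w) v / g⌉₊ ≤
          (t (some v) w + t (some w) v) / g + if w = v then 0 else 1 := by
        intro w
        have a1 := natCeil_le_indicator (h.nonneg (some v) w) hg
        have a2 := natCeil_le_indicator (h.nonneg (some w) v) hg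
        have : (if 0 < t (some v) w then (1 : ℝ) else 0) + (if 0 < t (some w) v then 1 else 0) ≤
            if w = v then 0 else 1 := by
          by_cases hwv : w = v
          · subst hwv
            simp [h.support _ _ (N.loopless w)]
          · have : ¬ (0 < t (some v) w ∧ 0 < t (some w) v) := fun hh =>
              hc v (.tail (.single hh.1) hh.2)
            rw [if_neg hwv]
            split_ifs with b1 b2
            · exact absurd ⟨b1, b2⟩ this
            all_goals norm_num
        rw [add_div]
        linarith
      have h2 : (R : ℝ) * ⌈t none v / R / g⌉₊ ≤ t none v / g + R := by
        have := (Nat.ceil_lt_add_one (div_nonneg (div_nonneg (h.nonneg none v) hR0.le) hg.le)).le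
        calc (R : ℝ) * ⌈t none v / R / g⌉₊ ≤ R * (t none v / R / g + 1) := by gcongr
          _ = _ := by field_simp
      have h3 := Finset.sum_le_sum fun w (_ : w ∈ Finset.univ) => h1 w
      rw [Finset.sum_add_distrib, Finset.sum_add_distrib, ← Finset.sum_div,
        Finset.sum_add_distrib] at h3
      have h4 : ∑ w : Fin W, (if w = v then (0 : ℝ) else 1) = W - 1 := by
        have : ∀ w : Fin W, (if w = v then (0 : ℝ) else 1) = 1 - if w = v then 1 else 0 := by
          intro w; split_ifs <;> simp
        simp [this, Finset.sum_sub_distrib]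
      have h5 := h.station v
      rw [Fintype.sum_option] at h5
      have h6 := div_le_div_of_nonneg_right h5 hg.le
      rw [add_div, add_div] at h6
      rw [add_div] at h3
      linarith
  unfold Multigraph.maxDegree
  obtain ⟨x, -, hx⟩ := Finset.exists_mem_eq_sup Finset.univ ⟨Sum.inr ⟨0, hW⟩, Finset.mem_univ _⟩
    (colouringGraph R g t).degree
  rw [hx]
  exact key x

theorem halfDegree_le (hW : 1 ≤ W) (hR : 1 ≤ R) (hg : 0 < g) (h : StepOneFeasible N R t)
    (hc : NoDirectedCycle t) :
    2 * ((colouringGraph R g t).halfDegree : ℝ) ≤ 1 / g + W + R := by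
  have h1 : 2 * (colouringGraph R g t).halfDegree ≤ (colouringGraph R g t).maxDegree + 1 := by
    unfold Multigraph.halfDegree; omega
  have h2 : 2 * ((colouringGraph R g t).halfDegree : ℝ) ≤ (colouringGraph R g t).maxDegree + 1 := by
    exact_mod_cast h1
  linarith [maxDegree_le hW hR hg h hc]

end

/-! ### The output table as a schedule of the colouring graph -/

section

variable {W R : ℕ} {g : ℝ} {t : LinkTime W}

theorem Node.code_eq (x : Node W R) : x.code = (finSumFinEquiv x : ℕ) := by
  rcases x with r | u <;> rfl

theorem Node.code_lt (x : Node W R) : x.code < R + W := x.code_eq ▸ (finSumFinEquiv x).isLt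

theorem Node.code_inj {x y : Node W R} : x.code = y.code ↔ x = y := by
  rw [Node.code_eq, Node.code_eq, Fin.val_inj, finSumFinEquiv.injective.eq_iff]

theorem Node.exists_code {v : ℕ} (hv : v < R + W) : ∃ x : Node W R, x.code = v :=
  ⟨finSumFinEquiv.symm ⟨v, hv⟩, by simp [Node.code_eq]⟩

/-- The links of the expanded network, in the order in which the program enumerates them. -/
def linkCode : XLink W R ≃ Fin ((R + W) * W) :=
  (finSumFinEquiv.prodCongr (Equiv.refl _)).trans finProdFinEquiv

theorem linkCode_val (e : XLink W R) : (linkCode e : ℕ) = e.2 + W * e.1.code := by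
  rw [Node.code_eq]; rfl

theorem linkCode_div (e : XLink W R) : (linkCode e : ℕ) / W = e.1.code := by
  rw [linkCode_val, Nat.add_mul_div_left _ _ e.2.pos, Nat.div_eq_of_lt e.2.isLt, zero_add]

theorem linkCode_mod (e : XLink W R) : (linkCode e : ℕ) % W = e.2 := by
  rw [linkCode_val, Nat.add_mul_mod_self_left, Nat.mod_eq_of_lt e.2.isLt]

/-- `expand R t` as a function of the numbers of the two ends of a link. -/
noncomputable def expandTable (R : ℕ) (t : LinkTime W) (a v : ℕ) : ℝ :=
  if h : a < R + W ∧ v < W then expand R t (finSumFinEquiv.symm ⟨a, h.1⟩, ⟨v, h.2⟩) else 0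

theorem expandTable_code (x : Node W R) (v : Fin W) :
    expandTable R t x.code v = expand R t (x, v) := by
  unfold expandTable
  rw [dif_pos ⟨x.code_lt, v.isLt⟩]
  congr 2
  rw [Equiv.symm_apply_eq]
  exact Fin.ext x.code_eq

theorem expandTable_linkCode (e : XLink W R) :
    expandTable R t ((linkCode e : ℕ) / W) ((linkCode e : ℕ) % W) = expand R t e := by
  rw [linkCode_div, linkCode_mod, expandTable_code]

theorem inputMem_gateway (v : Fin W) : (inputMem R g t).realArr 0 v = t none v := by
  have h : (v : ℕ) < (W + 1) * W := by nlinarith [v.isLt, v.pos]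
  simp [inputMem, h, Nat.mod_eq_of_lt v.isLt]

theorem inputMem_station (u v : Fin W) :
    (inputMem R g t).realArr 0 ((u + 1) * W + v) = t (some u) v := by
  have h : (u + 1) * W + v < (W + 1) * W := by nlinarith [v.isLt, u.isLt]
  have h1 : ((u + 1) * W + v : ℕ) / W = u + 1 := by
    rw [mul_comm, Nat.mul_add_div v.pos, Nat.div_eq_of_lt v.isLt, add_zero]
  have h2 : ((u + 1) * W + v : ℕ) % W = v := by
    rw [mul_comm, Nat.mul_add_mod, Nat.mod_eq_of_lt v.isLt]
  simp [inputMem, h, h1, h2, -Nat.div_eq_zero_iff]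

/-- The number of rows of the output table. -/
noncomputable abbrev rowCount (R : ℕ) (g : ℝ) (t : LinkTime W) : ℕ :=
  pieceCount W g (expandTable R t) ((R + W) * W)

/-- The row of the output table that describes an edge of the colouring graph. -/
noncomputable def rowEquiv (R : ℕ) (g : ℝ) (t : LinkTime W) : Piece R g t ≃ Fin (rowCount R g t) :=
  ((Equiv.sigmaCongr linkCode fun e => finCongr (by rw [expandTable_linkCode])).trans
    (finSigmaFinEquiv (n := fun l : Fin ((R + W) * W) =>
      ⌈expandTable R t ((l : ℕ) / W) ((l : ℕ) % W) / g⌉₊))).trans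
    (finCongr (Finset.sum_range fun l =>
      ⌈expandTable R t (l / W) (l % W) / g⌉₊).symm)

theorem rowEquiv_val (d : Piece R g t) :
    (rowEquiv R g t d : ℕ) = pieceCount W g (expandTable R t) (linkCode d.1) + d.2 := by
  rw [pieceCount, Finset.sum_range]
  exact finSigmaFinEquiv_apply (n := fun l : Fin ((R + W) * W) =>
      ⌈expandTable R t ((l : ℕ) / W) ((l : ℕ) % W) / g⌉₊)
    ⟨linkCode d.1, Fin.cast (by rw [expandTable_linkCode]) d.2⟩

theorem count_eq_card {E : Type} [Finite E] {M : ℕ} (φ : E ≃ Fin M) {f : ℕ → ℕ} {v : ℕ}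
    {P : E → Prop} (h : ∀ d, f (φ d) = v ↔ P d) : count f M v = Nat.card {d // P d} := by
  classical
  have := Fintype.ofFinite E
  rw [Nat.card_eq_fintype_card, Fintype.card_subtype, Finset.card_filter, count, Finset.sum_range]
  exact (Fintype.sum_equiv φ _ _ fun d => by simp [h]).symm

theorem halfDegree_eq {E : Type} {G : Multigraph (Node W R) E} {h : ℕ} {deg : ℕ → ℕ}
    (hd : ∀ x : Node W R, deg x.code = G.degree x) (H : IsHalfMax (R + W) deg h) :
    G.halfDegree = h := by
  obtain ⟨H1, H2⟩ := H
  have h1 : G.maxDegree ≤ 2 * h := Finset.sup_le fun x _ => by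
    rw [← hd]; exact H1 _ x.code_lt
  have h2 : h = 0 ∨ 2 * (h - 1) < G.maxDegree := by
    refine H2.imp_right ?_
    rintro ⟨v, hv, hlt⟩
    obtain ⟨x, rfl⟩ := Node.exists_code (W := W) hv
    rw [hd] at hlt
    exact hlt.trans_le (Finset.le_sup (f := G.degree) (Finset.mem_univ x))
  unfold Multigraph.halfDegree
  omega

/-- The memory left by the program holds the schedule of a colouring of Karloff's kind. -/
theorem ev_scheduleProg_inputMem (hW : 1 ≤ W) (hR : 1 ≤ R) (hg : 0 < g) (ht : ∀ u v, 0 ≤ t u v) :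
    ∃ (n : ℕ) (m : Mem) (κ : ℕ) (col : Piece R g t → Fin κ),
      Runs scheduleProg (inputMem R g t) n m ∧
      n ≤ 672 * ((colouringGraph R g t).halfDegree * (R + W) *
        (Nat.clog 2 ((colouringGraph R g t).halfDegree * (R + W)) + 1)) + 17 * ((R + W) * W) + 49 ∧
      (colouringGraph R g t).IsKarloffColouring col ∧ HoldsSchedule R g t col m := by
  have hX0 : ∀ a v, 0 ≤ expandTable R t a v := by
    intro a v
    unfold expandTable
    split_ifs with h
    · rcases finSumFinEquiv.symm (⟨a, h.1⟩ : Fin (R + W)) with r | u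
      · exact div_nonneg (ht _ _) (Nat.cast_nonneg _)
      · exact ht _ _
    · exact le_rfl
  obtain ⟨n, m, hrun, h, M, S, T, cls, rfl, htime, hrows, hhalf, hST, hcls, hproper, hcol, hthird,
      hnat0, hnat1, hreal⟩ :=
    ev_scheduleProg (m := inputMem R g t) (W := W) (R := R) (g := g) (X := expandTable R t) rfl rfl
      hW hR rfl hg (fun _ _ => rfl) hX0
      (fun a ha v hv => by
        rw [inputMem_gateway ⟨v, hv⟩]
        exact expandTable_code (t := t) (.inl ⟨a, ha⟩) ⟨v, hv⟩)
      (fun u hu v hv => by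
        rw [inputMem_station ⟨u, hu⟩ ⟨v, hv⟩]
        exact expandTable_code (t := t) (R := R) (.inr ⟨u, hu⟩) ⟨v, hv⟩)
  set φ := rowEquiv R g t with hφ
  have hlt : ∀ d, (φ d : ℕ) < rowCount R g t := fun d => (φ d).isLt
  -- the rows of the table
  have hrow : ∀ d : Piece R g t, m.natArr 0 (φ d) = d.1.1.code ∧
      m.natArr 1 (φ d) = Node.code (.inr d.1.2 : Node W R) ∧
      m.realArr 1 (φ d) = scaleFactor g (3 * h) * pieceTime R g t d := by
    intro d
    have := hrows (linkCode d.1) (linkCode d.1).isLt d.2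
      (by rw [expandTable_linkCode]; exact d.2.isLt)
    rw [expandTable_linkCode, linkCode_div, linkCode_mod, ← rowEquiv_val] at this
    exact this
  -- the degrees counted by the program are those of the colouring graph
  have hdeg : ∀ x : Node W R, (fun v => count (m.natArr 0) (rowCount R g t) v +
      count (m.natArr 1) (rowCount R g t) v) x.code = (colouringGraph R g t).degree x := by
    intro x
    exact congrArg₂ (· + ·)
      (count_eq_card φ fun d => by rw [(hrow d).1, Node.code_inj]; rfl)
      (count_eq_card φ fun d => by rw [(hrow d).2.1, Node.code_inj]; rfl)
  have hh : (colouringGraph R g t).halfDegree = h := halfDegree_eq hdeg hhalf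
  have hcol' : ∀ d, m.natArr 2 (φ d) < 3 * h := by
    intro d
    obtain ⟨c, hc, e⟩ := hcol _ (hlt d)
    have := hcls _ (hlt d)
    omega
  let flip : Piece R g t → Bool := fun d => S (φ d) ≠ d.1.1.code
  have hends : ∀ d, ((colouringGraph R g t).src flip d).code = S (φ d) ∧
      ((colouringGraph R g t).dst flip d).code = T (φ d) := by
    intro d
    have h0 := hST _ (hlt d)
    rw [(hrow d).1, (hrow d).2.1] at h0
    by_cases hf : S (φ d) = d.1.1.code
    · have : flip d = false := by simp [flip, hf]
      simp only [Multigraph.src, Multigraph.dst, this]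
      rcases h0 with ⟨h1, h2⟩ | ⟨h1, h2⟩
      · exact ⟨h1.symm, h2.symm⟩
      · exact ⟨hf.symm, (h1.symm.trans (hf.trans h2.symm))⟩
    · have : flip d = true := by simp [flip, hf]
      simp only [Multigraph.src, Multigraph.dst, this]
      rcases h0 with ⟨h1, h2⟩ | ⟨h1, h2⟩
      · exact absurd h1 hf
      · exact ⟨h1.symm, h2.symm⟩
  have hne : ∀ {d d'}, d ≠ d' → (φ d : ℕ) ≠ φ d' := fun hd e => hd (φ.injective (Fin.ext e))
  have hclass : ∀ d d', m.natArr 2 (φ d) = m.natArr 2 (φ d') → cls (φ d) = cls (φ d') := by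
    intro d d' e
    obtain ⟨c, hc, e1⟩ := hcol _ (hlt d)
    obtain ⟨c', hc', e2⟩ := hcol _ (hlt d')
    omega
  refine ⟨n, m, 3 * h, fun d => ⟨m.natArr 2 (φ d), hcol' d⟩, hrun, by rw [hh]; exact htime,
    ⟨?_, by rw [hh], flip, fun d => ⟨cls (φ d), by rw [hh]; exact hcls _ (hlt d)⟩, ?_, ?_, ?_⟩,
    hnat0, hreal, ?_⟩
  · intro d d' hd htouch heq
    have heq' : m.natArr 2 (φ d) = m.natArr 2 (φ d') := congrArg Fin.val heq
    have hc := hclass d d' heq'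
    have hp := hproper _ (hlt d) _ (hlt d') (hne hd) hc
    have h1 : S (φ d) ≠ T (φ d') := fun e => hthird _ (hlt d) _ (hlt d') (hne hd) hc e heq'
    have h2 : S (φ d') ≠ T (φ d) := fun e =>
      hthird _ (hlt d') _ (hlt d) (hne hd.symm) hc.symm e heq'.symm
    have a1 := hST _ (hlt d)
    have a2 := hST _ (hlt d')
    have htouch' : m.natArr 0 (φ d) = m.natArr 0 (φ d') ∨ m.natArr 0 (φ d) = m.natArr 1 (φ d') ∨
        m.natArr 1 (φ d) = m.natArr 0 (φ d') ∨ m.natArr 1 (φ d) = m.natArr 1 (φ d') := by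
      rw [(hrow d).1, (hrow d).2.1, (hrow d').1, (hrow d').2.1]
      simp only [Node.code_inj]
      exact htouch
    omega
  · intro d d' hd hc
    have hp := hproper _ (hlt d) _ (hlt d') (hne hd) (congrArg Fin.val hc)
    rw [← (hends d).1, ← (hends d').1, ← (hends d).2, ← (hends d').2, Ne, Ne, Node.code_inj,
      Node.code_inj] at hp
    exact hp
  · intro d d' e
    exact Fin.ext (hclass d d' (congrArg Fin.val e))
  · intro i
    have hsub : Fin.val '' ((fun d => (⟨m.natArr 2 (φ d), hcol' d⟩ : Fin (3 * h))) ''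
        {d | (⟨cls (φ d), by rw [hh]; exact hcls _ (hlt d)⟩ :
          Fin (colouringGraph R g t).halfDegree) = i}) ⊆
          ↑(Finset.Ico (3 * (i : ℕ)) (3 * i + 3)) := by
      rintro _ ⟨_, ⟨d, hd, rfl⟩, rfl⟩
      obtain ⟨c, hc, e⟩ := hcol _ (hlt d)
      have : cls (φ d) = i := congrArg Fin.val hd
      simp only [Finset.coe_Ico, Set.mem_Ico]
      omega
    rw [← Set.ncard_image_of_injective _ Fin.val_injective]
    refine (Set.ncard_le_ncard hsub (Finset.finite_toSet _)).trans ?_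
    rw [Set.ncard_coe_finset, Nat.card_Ico]
    omega
  · refine ⟨(finCongr hnat1).trans φ.symm, fun k => ?_⟩
    have hk : ((k : ℕ)) = φ (((finCongr hnat1).trans φ.symm) k) := by simp
    rw [hk]
    exact ⟨(hrow _).1, (hrow _).2.1, rfl, (hrow _).2.2⟩

end

/-! ### The running time -/

theorem clog_two_le {q : ℕ} {s : ℝ} (hs : 2 ≤ s) (hq : (q : ℝ) ≤ 2 * s ^ 2) :
    (Nat.clog 2 q : ℝ) + 1 ≤ 10 * Real.log s := by
  have hl2 : (1 : ℝ) / 2 ≤ Real.log 2 := by linarith [Real.log_two_gt_d9]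
  have hls : Real.log 2 ≤ Real.log s := Real.log_le_log (by norm_num) hs
  rcases Nat.eq_zero_or_pos q with rfl | hq0
  · simp; linarith
  have hq1 : (1 : ℝ) ≤ q := by exact_mod_cast hq0
  rw [← Real.natCeil_logb_natCast]
  have h1 := (Nat.ceil_lt_add_one (Real.logb_nonneg (b := 2) (by norm_num) hq1)).le
  have h2 : Real.log q ≤ Real.log 2 + 2 * Real.log s := by
    refine (Real.log_le_log (by linarith) hq).trans_eq ?_
    rw [Real.log_mul (by norm_num) (by positivity), Real.log_pow]
    norm_num
  have h3 : Real.logb 2 q ≤ 10 * Real.log s - 2 := by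
    rw [Real.logb, div_le_iff₀ (by linarith)]
    nlinarith
  push_cast at h1 ⊢
  linarith

variable {W R : ℕ} {g : ℝ} {t : LinkTime W} {N : Network W}

theorem steps_le {h n : ℕ} (hR : 1 ≤ R) (hRW : R ≤ W) (hg : 0 < g) (hg1 : g ≤ 1)
    (hh : 2 * (h : ℝ) ≤ 1 / g + W + R)
    (hn : n ≤ 672 * (h * (R + W) * (Nat.clog 2 (h * (R + W)) + 1)) + 17 * ((R + W) * W) + 49) :
    (n : ℝ) ≤ 13600 * (((W : ℝ) ^ 2 + W / g) * Real.log (W + 1 / g)) := by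
  have hW : (1 : ℝ) ≤ W := by exact_mod_cast hR.trans hRW
  have hRW' : (R : ℝ) ≤ W := by exact_mod_cast hRW
  have hg' : 1 ≤ 1 / g := (one_le_div hg).2 hg1
  obtain ⟨s, hs⟩ : ∃ s, s = W + 1 / g := ⟨_, rfl⟩
  have hP : (W : ℝ) ^ 2 + W / g = W * s := by rw [hs]; ring
  rw [hP, ← hs]
  have hs2 : 2 ≤ s := by linarith
  have hhs : (h : ℝ) ≤ s := by linarith
  have hprod : (h : ℝ) * (R + W) ≤ 2 * (W * s) := by
    calc (h : ℝ) * (R + W) ≤ s * (W + W) := by gcongr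
      _ = _ := by ring
  have hlog : Real.log 2 ≤ Real.log s := Real.log_le_log (by norm_num) hs2
  have hlog' : (1 : ℝ) / 2 ≤ Real.log s := by linarith [Real.log_two_gt_d9]
  have hclog := clog_two_le (q := h * (R + W)) hs2 (by
    push_cast
    refine hprod.trans ?_
    have : (W : ℝ) * s ≤ s * s := by gcongr; linarith
    linarith)
  have hn' : (n : ℝ) ≤ 672 * ((h : ℝ) * (R + W) * ((Nat.clog 2 (h * (R + W)) : ℝ) + 1)) +
      17 * (((R : ℝ) + W) * W) + 49 := by exact_mod_cast hn
  have h1 : (h : ℝ) * (R + W) * ((Nat.clog 2 (h * (R + W)) : ℝ) + 1) ≤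
      2 * (W * s) * (10 * Real.log s) := by gcongr
  have h2 : ((R : ℝ) + W) * W ≤ 2 * (W * s) := by
    calc ((R : ℝ) + W) * W ≤ (W + W) * s := by gcongr; linarith
      _ = _ := by ring
  have hPL : W * s ≤ 2 * (W * s * Real.log s) := by
    have : 0 ≤ W * s := by positivity
    nlinarith
  have hPs : (2 : ℝ) ≤ W * s := by
    calc (2 : ℝ) = 1 * 2 := by norm_num
      _ ≤ W * s := by gcongr
  linarith

/-! ### Schedules and the matching polytope -/

section

variable {W R : ℕ} {N : Network W}

/-- A set of pairwise disjoint links of the expanded network. -/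
def IsLinkMatching (N : Network W) (A : Finset (XLink W R)) : Prop :=
  (∀ e ∈ A, N.link e.1.base e.2) ∧ ∀ e ∈ A, ∀ f ∈ A, e ≠ f → ¬ e.Touch f

/-- The incidence vector of a set of links. -/
noncomputable def incidence (A : Finset (XLink W R)) : XLink W R → ℝ :=
  fun e => if e ∈ A then 1 else 0

/-- The convex hull of the incidence vectors of the matchings of the expanded network. -/
def matchingPolytope (N : Network W) (R : ℕ) : Set (XLink W R → ℝ) :=
  convexHull ℝ (incidence '' {A | IsLinkMatching N A})

theorem UnitSchedule.time_mem (S : UnitSchedule N R) : S.time ∈ matchingPolytope N R := by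
  have h : S.time = ∑ i, S.len i • incidence (S.active i) := by
    ext e
    simp [UnitSchedule.time, incidence]
  rw [h]
  exact (convex_convexHull ℝ _).sum_mem (fun i _ => (S.len_pos i).le) S.len_sum fun i _ =>
    subset_convexHull ℝ _ ⟨_, ⟨S.active_link i, S.active_matching i⟩, rfl⟩

/-- The points of the matching polytope are the link times of unit length schedules. -/
theorem exists_schedule_iff {x : XLink W R → ℝ} :
    (∃ S : UnitSchedule N R, S.time = x) ↔ x ∈ matchingPolytope N R := by
  refine ⟨fun ⟨S, hS⟩ => hS ▸ S.time_mem, fun hx => ?_⟩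
  obtain ⟨ι, _, w, z, hw, hw1, hz, rfl⟩ := mem_convexHull_iff_exists_fintype.1 hx
  choose A hA hAz using hz
  classical
  let e := Fintype.equivFin {i // 0 < w i}
  have hpos : ∀ f : ι → ℝ, ∑ k, w (e.symm k) * f (e.symm k) = ∑ i, w i * f i := by
    intro f
    rw [← Equiv.sum_comp e fun k => w (e.symm k) * f (e.symm k)]
    simp only [Equiv.symm_apply_apply]
    rw [← Finset.sum_subtype (Finset.univ.filter fun i => 0 < w i) (by simp) fun i => w i * f i,
      Finset.sum_filter]
    refine Finset.sum_congr rfl fun i _ => ?_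
    split_ifs with h
    · rfl
    · rw [le_antisymm (not_lt.1 h) (hw i), zero_mul]
  refine ⟨⟨_, fun k => w (e.symm k), fun k => (e.symm k).2, ?_, fun k => A (e.symm k),
    fun k => (hA _).1, fun k => (hA _).2⟩, ?_⟩
  · simpa [hw1] using hpos 1
  · ext l
    rw [Finset.sum_apply]
    simp only [UnitSchedule.time, ← hAz]
    simpa [incidence] using hpos fun i => incidence (A i) l

theorem isCompact_matchingPolytope : IsCompact (matchingPolytope N R) :=
  (Set.toFinite _).isCompact_convexHull ℝ

theorem incidence_mem {A : Finset (XLink W R)} (hA : IsLinkMatching N A) :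
    incidence A ∈ matchingPolytope N R := subset_convexHull ℝ _ ⟨A, hA, rfl⟩

theorem zero_mem_matchingPolytope : (0 : XLink W R → ℝ) ∈ matchingPolytope N R := by
  have : IsLinkMatching N (∅ : Finset (XLink W R)) := by simp [IsLinkMatching]
  convert incidence_mem this using 1
  ext e
  simp [incidence]

theorem Convex.sum_mem_of_zero_mem {E ι : Type*} [AddCommGroup E] [Module ℝ E] {s : Set E}
    (hs : Convex ℝ s) (h0 : (0 : E) ∈ s) (t : Finset ι) {w : ι → ℝ} {z : ι → E}
    (hw : ∀ i ∈ t, 0 ≤ w i) (hw1 : ∑ i ∈ t, w i ≤ 1) (hz : ∀ i ∈ t, z i ∈ s) :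
    ∑ i ∈ t, w i • z i ∈ s := by
  have := hs.sum_mem (t := Finset.insertNone t) (w := fun o => o.elim (1 - ∑ i ∈ t, w i) w)
    (z := fun o => o.elim 0 z) ?_ ?_ ?_
  · simpa using this
  · rintro (_ | i) hi
    · simpa using hw1
    · exact hw i (by simpa using hi)
  · simp
  · rintro (_ | i) hi
    · exact h0
    · exact hz i (by simpa using hi)

/-- A vector with entries in `[0, 1]` that is supported on a matching lies in the matching polytope:
it is a mixture of the two vectors obtained by moving one entry to `0` or to `1`. -/
theorem mem_of_support_matching {A : Finset (XLink W R)} (hA : IsLinkMatching N A)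
    {y : XLink W R → ℝ} (h0 : ∀ e, 0 ≤ y e) (h1 : ∀ e, y e ≤ 1) (hy : ∀ e ∉ A, y e = 0) :
    y ∈ matchingPolytope N R := by
  classical
  suffices H : ∀ F : Finset (XLink W R), ∀ y : XLink W R → ℝ, (∀ e, 0 ≤ y e) → (∀ e, y e ≤ 1) →
      (∀ e ∉ A, y e = 0) → (∀ e ∉ F, y e = 0 ∨ y e = 1) → y ∈ matchingPolytope N R from
    H Finset.univ y h0 h1 hy (by simp)
  intro F
  induction F using Finset.induction_on with
  | empty =>
    intro y _ _ hy hF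
    have hsub : IsLinkMatching N (A.filter fun e => y e = 1) :=
      ⟨fun e he => hA.1 e (Finset.mem_filter.1 he).1, fun e he f hf =>
        hA.2 e (Finset.mem_filter.1 he).1 f (Finset.mem_filter.1 hf).1⟩
    convert incidence_mem hsub using 1
    ext e
    by_cases heA : e ∈ A
    · rcases hF e (Finset.notMem_empty e) with h | h <;> simp [incidence, h, heA]
    · simp [incidence, heA, hy e heA]
  | insert e F he ih =>
    intro y h0 h1 hy hF
    by_cases heA : e ∈ A
    · have hmem : ∀ c : ℝ, (c = 0 ∨ c = 1) → Function.update y e c ∈ matchingPolytope N R := by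
        intro c hc
        have hc' : 0 ≤ c ∧ c ≤ 1 := by rcases hc with rfl | rfl <;> norm_num
        refine ih _ (fun f => ?_) (fun f => ?_) (fun f hf => ?_) fun f hf => ?_
        all_goals
          rcases eq_or_ne f e with rfl | hfe
          · first | simpa using hc'.1 | simpa using hc'.2 | simpa using hc | exact absurd heA hf
          · rw [Function.update_of_ne hfe]
            first | exact h0 f | exact h1 f | exact hy f hf | exact hF f (by simp [hfe, hf])
      have hmix : y = y e • Function.update y e 1 + (1 - y e) • Function.update y e 0 := by
        funext f
        rcases eq_or_ne f e with rfl | hfe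
        · simp
        · simp [Function.update_of_ne hfe]
          ring
      rw [hmix]
      exact convex_convexHull ℝ _ (hmem 1 (.inr rfl)) (hmem 0 (.inl rfl)) (h0 e)
        (sub_nonneg.2 (h1 e)) (add_sub_cancel _ _)
    · refine ih y h0 h1 hy fun f hf => ?_
      rcases eq_or_ne f e with rfl | hfe
      · exact .inl (hy f heA)
      · exact hF f (by simp [hfe, hf])

end

/-! ### The link times achieved by step (ii) -/

section

variable {W R : ℕ} {g : ℝ} {t : LinkTime W} {N : Network W}

theorem scaleFactor_pos (g : ℝ) (κ : ℕ) : 0 < scaleFactor g κ := by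
  unfold scaleFactor
  split_ifs with h
  · exact one_div_pos.2 (by linarith)
  · exact one_pos

theorem scaleFactor_mul_le (g : ℝ) (κ : ℕ) : κ * (scaleFactor g κ * g) ≤ 1 := by
  unfold scaleFactor
  split_ifs with h
  · have : (κ : ℝ) * (1 / (κ * g) * g) = (κ * g) / (κ * g) := by ring
    rw [this, div_self (by linarith)]
  · linarith

/-- The loss of step (ii): with `κ ≤ 3 ⌈Δ / 2⌉` and `Δ ≤ 1 / g + W + R - 1` the slots have total
length at most `3 ((W + R) g + 1) / 2` before scaling. -/
theorem lt_scaleFactor (hW : 1 ≤ W) (hR : 1 ≤ R) (hg : 0 < g) (h : StepOneFeasible N R t)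
    (hc : NoDirectedCycle t) {κ : ℕ} (hκ : κ ≤ 3 * (colouringGraph R g t).halfDegree) :
    2 / (3 * (((W : ℝ) + R + 1) * g + 1)) < scaleFactor g κ := by
  have hpos : 0 < ((W : ℝ) + R + 1) * g := by positivity
  unfold scaleFactor
  split_ifs with h1
  · rw [div_lt_div_iff₀ (by positivity) (by linarith)]
    have h2 : (κ : ℝ) ≤ 3 * (colouringGraph R g t).halfDegree := by exact_mod_cast hκ
    have h3 := halfDegree_le hW hR hg h hc
    have h4 : 2 * (κ : ℝ) * g ≤ 3 * (1 / g + W + R) * g := by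
      apply mul_le_mul_of_nonneg_right _ hg.le
      linarith
    have h5 : 3 * (1 / g + W + R) * g = 3 * (1 + (W + R) * g) := by
      field_simp
      ring
    linarith
  · rw [div_lt_one (by positivity)]
    linarith

theorem expand_nonneg (ht : ∀ u v, 0 ≤ t u v) (e : XLink W R) : 0 ≤ expand R t e := by
  rcases e with ⟨r | u, v⟩
  · exact div_nonneg (ht _ _) (Nat.cast_nonneg _)
  · exact ht _ _

theorem pieceTime_mem (ht : ∀ u v, 0 ≤ t u v) (hg : 0 < g) (d : Piece R g t) :
    0 ≤ pieceTime R g t d ∧ pieceTime R g t d ≤ g := by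
  unfold pieceTime
  split_ifs
  · exact ⟨hg.le, le_rfl⟩
  · have h0 := expand_nonneg ht d.1
    have h1 := (lt_div_iff₀ hg).1 (sub_lt_iff_lt_add.2 (Nat.ceil_lt_add_one (div_nonneg h0 hg.le)))
    have h2 := (div_le_iff₀ hg).1 (Nat.le_ceil (expand R t d.1 / g))
    constructor <;> linarith

theorem sum_pieceTime (ht : ∀ u v, 0 ≤ t u v) (hg : 0 < g) (e : XLink W R) :
    ∑ j, pieceTime R g t ⟨e, j⟩ = expand R t e := by
  unfold pieceTime
  rw [Fin.sum_univ_eq_sum_range (fun j => if j + 1 < ⌈expand R t e / g⌉₊ then g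
    else expand R t e - (⌈expand R t e / g⌉₊ - 1) * g)]
  have h2 := (div_le_iff₀ hg).1 (Nat.le_ceil (expand R t e / g))
  generalize ⌈expand R t e / g⌉₊ = c at *
  rcases c with _ | c
  · have := expand_nonneg ht e
    simp at h2 ⊢
    linarith
  · rw [Finset.sum_range_succ, Finset.sum_congr rfl fun j hj =>
      if_pos (Nat.succ_lt_succ (Finset.mem_range.1 hj))]
    simp

theorem finalTime_eq (ht : ∀ u v, 0 ≤ t u v) (hg : 0 < g) {κ : ℕ} (col : Piece R g t → Fin κ)
    (e : XLink W R) : finalTime R g t col e = scaleFactor g κ * expand R t e := by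
  simp only [finalTime, slotTime]
  rw [Finset.sum_comm]
  simp only [Finset.sum_ite_eq, Finset.mem_univ, if_true]
  rw [← Finset.mul_sum, sum_pieceTime ht hg]

theorem collapse_finalTime (ht : ∀ u v, 0 ≤ t u v) (hg : 0 < g) (hR : 1 ≤ R) {κ : ℕ}
    (col : Piece R g t → Fin κ) : collapse (finalTime R g t col) = scaleFactor g κ • t := by
  have hR0 : (R : ℝ) ≠ 0 := by exact_mod_cast (by omega : R ≠ 0)
  ext (_ | u) v
  · simp only [collapse, finalTime_eq ht hg, expand, Pi.smul_apply, smul_eq_mul]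
    rw [Finset.sum_const, Finset.card_univ, Fintype.card_fin, nsmul_eq_mul]
    field_simp
  · simp only [collapse, finalTime_eq ht hg, expand, Pi.smul_apply, smul_eq_mul]

/-- The slots of a proper colouring are matchings, and they fit in unit time after scaling. -/
theorem finalTime_mem (hg : 0 < g) (h : StepOneFeasible N R t) {κ : ℕ} {col : Piece R g t → Fin κ}
    (hcol : (colouringGraph R g t).IsProper col) :
    finalTime R g t col ∈ matchingPolytope N R := by
  classical
  have hs := scaleFactor_pos g κ
  have hsg : 0 < scaleFactor g κ * g := mul_pos hs hg
  have hslot : ∀ i, (scaleFactor g κ * g)⁻¹ • slotTime R g t col i ∈ matchingPolytope N R := by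
    intro i
    have hnn : ∀ e, 0 ≤ slotTime R g t col i e := fun e => Finset.sum_nonneg fun j _ => by
      split_ifs
      · exact mul_nonneg hs.le (pieceTime_mem h.nonneg hg _).1
      · exact le_rfl
    have hle : ∀ e, slotTime R g t col i e ≤ scaleFactor g κ * g := by
      intro e
      -- parallel edges have different colours, so at most one of them lies in the slot
      by_cases hex : ∃ j, col ⟨e, j⟩ = i
      · obtain ⟨j, hj⟩ := hex
        unfold slotTime
        rw [Finset.sum_eq_single j, if_pos hj]
        · exact mul_le_mul_of_nonneg_left (pieceTime_mem h.nonneg hg _).2 hs.le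
        · intro j' _ hne
          refine if_neg fun hj' => hcol ⟨e, j'⟩ ⟨e, j⟩ ?_ (.inl rfl) (hj'.trans hj.symm)
          simpa using hne
        · simp
      · refine (Finset.sum_eq_zero fun j _ => if_neg fun hj => hex ⟨j, hj⟩).trans_le hsg.le
    have hA : IsLinkMatching N (Finset.univ.filter fun e => ∃ j, col ⟨e, j⟩ = i) := by
      constructor
      · intro e he
        obtain ⟨j, -⟩ := (Finset.mem_filter.1 he).2
        have hpos : 0 < expand R t e := by
          have := Nat.ceil_pos.1 (j.pos)
          rwa [lt_div_iff₀ hg, zero_mul] at this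
        by_contra hl
        rcases e with ⟨r | u, v⟩
        · simp [expand, h.support none v hl] at hpos
        · simp [expand, h.support (some u) v hl] at hpos
      · intro e he f hf hef htouch
        obtain ⟨j, hj⟩ := (Finset.mem_filter.1 he).2
        obtain ⟨j', hj'⟩ := (Finset.mem_filter.1 hf).2
        refine hcol ⟨e, j⟩ ⟨f, j'⟩ (fun heq => hef (congrArg Sigma.fst heq)) ?_ (hj.trans hj'.symm)
        rcases htouch with h | h | h | h
        · exact .inl h
        · exact .inr (.inl h)
        · exact .inr (.inr (.inl h))
        · exact .inr (.inr (.inr (congrArg Sum.inr h)))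
    refine mem_of_support_matching hA (fun e => mul_nonneg (inv_nonneg.2 hsg.le) (hnn e))
      (fun e => ?_) fun e he => ?_
    · rw [Pi.smul_apply, smul_eq_mul, inv_mul_le_iff₀ hsg, mul_one]
      exact hle e
    · have : slotTime R g t col i e = 0 := Finset.sum_eq_zero fun j _ => if_neg fun hj =>
        he (Finset.mem_filter.2 ⟨Finset.mem_univ _, j, hj⟩)
      simp [this]
  have hsum : finalTime R g t col =
      ∑ i, (scaleFactor g κ * g) • ((scaleFactor g κ * g)⁻¹ • slotTime R g t col i) := by
    ext e
    simp only [smul_inv_smul₀ hsg.ne', Finset.sum_apply, finalTime]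
  rw [hsum]
  refine Convex.sum_mem_of_zero_mem (convex_convexHull ℝ _) zero_mem_matchingPolytope _
    (fun _ _ => hsg.le) ?_ fun i _ => hslot i
  simpa using scaleFactor_mul_le g κ

end

/-! ### The relaxation and the max-min throughput -/

section

variable {W R : ℕ} {N : Network W}

theorem isLinearMap_collapse : IsLinearMap ℝ (collapse : (XLink W R → ℝ) → LinkTime W) where
  map_add x y := by
    ext (_ | u) v <;> simp [collapse, Finset.sum_add_distrib]
  map_smul c x := by
    ext (_ | u) v <;> simp [collapse, Finset.mul_sum]

theorem convex_stepOneFeasible : Convex ℝ {t | StepOneFeasible N R t} := by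
  rintro s hs t ht a b ha hb hab
  obtain ⟨σ, s1, s2, s3, s4⟩ := hs.idle
  obtain ⟨τ, t1, t2, t3, t4⟩ := ht.idle
  refine ⟨fun u v => ?_, fun u v hl => ?_, fun v => ?_, fun k => a * σ k + b * τ k, fun k hk => ?_,
    ?_, ?_, ?_⟩
  · exact add_nonneg (mul_nonneg ha (hs.nonneg u v)) (mul_nonneg hb (ht.nonneg u v))
  · simp [hs.support u v hl, ht.support u v hl]
  · simp only [Pi.add_apply, Pi.smul_apply, smul_eq_mul, Finset.sum_add_distrib, ← Finset.mul_sum]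
    nlinarith [mul_le_mul_of_nonneg_left (hs.station v) ha,
      mul_le_mul_of_nonneg_left (ht.station v) hb]
  · exact add_nonneg (mul_nonneg ha (s1 k hk)) (mul_nonneg hb (t1 k hk))
  · simp only [Finset.sum_add_distrib, ← Finset.mul_sum]
    nlinarith
  · simp only [Pi.add_apply, Pi.smul_apply, smul_eq_mul, Finset.sum_add_distrib, ← Finset.mul_sum,
      mul_add, mul_left_comm _ a, mul_left_comm _ b, s3, t3]
  · simp only [Pi.add_apply, Pi.smul_apply, smul_eq_mul, Finset.sum_add_distrib, ← Finset.mul_sum,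
      mul_add, mul_left_comm _ a, mul_left_comm _ b]
    have e : (R : ℝ) = a * R + b * R := by rw [← add_mul, hab, one_mul]
    nlinarith [mul_le_mul_of_nonneg_left s4 ha, mul_le_mul_of_nonneg_left t4 hb]

theorem sum_indicator_le_one {ι : Type*} [Fintype ι] {p : ι → Prop} [DecidablePred p]
    (h : ∀ i j, p i → p j → i = j) : ∑ i, (if p i then (1 : ℝ) else 0) ≤ 1 := by
  rw [Finset.sum_boole]
  exact_mod_cast Finset.card_le_one.2 fun i hi j hj =>
    h i j (Finset.mem_filter.1 hi).2 (Finset.mem_filter.1 hj).2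

/-- While a matching is active, every node takes part in at most one link. So at most `R` gateway
links are active, and if `k` links between base stations are active, then at most `W - 2 k` base
stations are left as heads of gateway links. -/
theorem stepOneFeasible_incidence {A : Finset (XLink W R)} (hA : IsLinkMatching N A) :
    StepOneFeasible N R (collapse (incidence A)) := by
  classical
  have hgate : ∑ v, collapse (incidence A) none v ≤ R := by
    simp only [collapse]
    rw [Finset.sum_comm]
    calc ∑ r : Fin R, ∑ v, incidence A (.inl r, v) ≤ ∑ r : Fin R, (1 : ℝ) := by
          refine Finset.sum_le_sum fun r _ => sum_indicator_le_one fun v w hv hw => ?_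
          by_contra hne
          exact hA.2 _ hv _ hw (by simpa using hne) (.inl rfl)
      _ = R := by simp
  have hstation : ∀ v, ∑ u, collapse (incidence A) u v +
      ∑ w, collapse (incidence A) (some v) w ≤ 1 := by
    intro v
    rw [Fintype.sum_option]
    simp only [collapse]
    have := sum_indicator_le_one (ι := Node W R ⊕ Fin W)
      (p := fun i => i.elim (fun a => (a, v)) (fun w => (.inr v, w)) ∈ A) ?_
    · rwa [Fintype.sum_sum_type, Fintype.sum_sum_type] at this
    · rintro (a | w) (a' | w') h h'
      · by_contra hne
        exact hA.2 _ h _ h' (by simpa using hne) (.inr (.inr (.inr rfl)))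
      · by_contra hne
        refine hA.2 _ h _ h' (fun he => ?_) (.inr (.inr (.inl rfl)))
        obtain ⟨rfl, rfl⟩ := Prod.mk.inj he
        exact N.loopless _ (hA.1 _ h)
      · by_contra hne
        refine hA.2 _ h _ h' (fun he => ?_) (.inr (.inl rfl))
        obtain ⟨rfl, rfl⟩ := Prod.mk.inj he
        exact N.loopless _ (hA.1 _ h)
      · by_contra hne
        exact hA.2 _ h _ h' (by simpa using hne) (.inl rfl)
  obtain ⟨k, hk⟩ : ∃ k : ℕ, ∑ u, ∑ v, collapse (incidence A) (some u) v = k := by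
    refine ⟨∑ u : Fin W, ∑ v, if (.inr u, v) ∈ A then 1 else 0, ?_⟩
    push_cast
    rfl
  have hcount : ∑ v, collapse (incidence A) none v + 2 * k ≤ (W : ℝ) := by
    have := Finset.sum_le_sum fun v (_ : v ∈ Finset.univ) => hstation v
    simp only [Fintype.sum_option, Finset.sum_add_distrib] at this
    rw [Finset.sum_comm (f := fun v u => collapse (incidence A) (some u) v), hk] at this
    simp at this
    linarith
  have hnn : ∀ u v, 0 ≤ collapse (incidence A) u v := by
    have : ∀ e, 0 ≤ incidence A e := fun e => by unfold incidence; split_ifs <;> norm_num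
    rintro (_ | u) v
    · exact Finset.sum_nonneg fun r _ => this _
    · exact this _
  refine ⟨hnn, ?_, hstation, fun j => if j = k then 1 else 0, ?_, ?_, ?_, ?_⟩
  · rintro (_ | u) v hl
    · exact Finset.sum_eq_zero fun r _ => if_neg fun h => hl (hA.1 (.inl r, v) h)
    · exact if_neg fun h => hl (hA.1 (.inr u, v) h)
  · intro j _
    dsimp only
    split_ifs <;> norm_num
  · rw [Finset.sum_ite_eq']
    split_ifs <;> norm_num
  all_goals
    have hk2 : 2 * k ≤ W := by
      have : 0 ≤ ∑ v, collapse (incidence A) none v := Finset.sum_nonneg fun v _ => hnn _ v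
      exact_mod_cast (by linarith : (2 : ℝ) * k ≤ W)
    simp only [mul_ite, mul_one, mul_zero, Finset.sum_ite_eq']
  · rw [hk]
    split_ifs with h
    · rfl
    · rw [Finset.mem_Icc] at h
      exact_mod_cast (by omega : 0 = k)
  · split_ifs with h
    · rw [le_sub_comm, max_le_iff]
      constructor <;> linarith
    · linarith

theorem stepOneFeasible_of_mem {x : XLink W R → ℝ} (hx : x ∈ matchingPolytope N R) :
    StepOneFeasible N R (collapse x) := by
  refine convexHull_min ?_ (convex_stepOneFeasible.is_linear_preimage isLinearMap_collapse) hx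
  rintro _ ⟨A, hA, rfl⟩
  exact stepOneFeasible_incidence hA

theorem throughput_smul (ρ : ℝ) (t : LinkTime W) (v : Fin W) :
    N.throughput (ρ • t) v = ρ * N.throughput t v := by
  simp only [Network.throughput, Pi.smul_apply, smul_eq_mul, mul_left_comm _ ρ, ← Finset.mul_sum,
    mul_sub]

theorem minThroughput_smul {ρ : ℝ} (hρ : 0 ≤ ρ) (t : LinkTime W) :
    N.minThroughput (ρ • t) = ρ * N.minThroughput t := by
  simp only [Network.minThroughput, throughput_smul, Real.mul_iInf_of_nonneg hρ]

theorem minThroughput_nonneg {t : LinkTime W} (h : IsFairLinkTime N R t) :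
    0 ≤ N.minThroughput t := by
  have h0 := h.fair _ (stepOneFeasible_of_mem zero_mem_matchingPolytope)
  rw [← zero_smul ℝ (0 : XLink W R → ℝ), isLinearMap_collapse.map_smul, minThroughput_smul le_rfl,
    zero_mul] at h0
  exact h0

theorem continuous_minThroughput (hW : 1 ≤ W) : Continuous N.minThroughput := by
  have : Nonempty (Fin W) := ⟨⟨0, hW⟩⟩
  have h : N.minThroughput = fun t => Finset.univ.inf' Finset.univ_nonempty (N.throughput t) := by
    funext t
    rw [Finset.inf'_univ_eq_ciInf]
    rfl
  rw [h]
  refine Continuous.finset_inf'_apply _ fun v _ => ?_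
  unfold Network.throughput
  fun_prop

theorem continuous_collapse : Continuous (collapse : (XLink W R → ℝ) → LinkTime W) := by
  refine continuous_pi fun u => continuous_pi fun v => ?_
  rcases u with _ | u <;> simp only [collapse] <;> fun_prop

theorem exists_isMaxMinThroughput (hW : 1 ≤ W) : ∃ θ, N.IsMaxMinThroughput R θ := by
  obtain ⟨x, hx, hmax⟩ := (isCompact_matchingPolytope (N := N) (R := R)).exists_isMaxOn
    ⟨0, zero_mem_matchingPolytope⟩
    ((continuous_minThroughput hW).comp continuous_collapse).continuousOn
  obtain ⟨S, rfl⟩ := exists_schedule_iff.2 hx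
  refine ⟨_, ⟨S, rfl⟩, ?_⟩
  rintro _ ⟨S', rfl⟩
  exact hmax S'.time_mem

theorem maxMinThroughput_le {t : LinkTime W} (h : IsFairLinkTime N R t) {θ : ℝ}
    (hθ : N.IsMaxMinThroughput R θ) : θ ≤ N.minThroughput t := by
  obtain ⟨S, rfl⟩ := hθ.1
  exact h.fair _ (stepOneFeasible_of_mem S.time_mem)

end

/-! ### Flows along paths -/

section

variable {W R : ℕ} {N : Network W}

/-- The excess of a flow at a base station: inflow minus outflow. -/
def excess (f : LinkTime W) (v : Fin W) : ℝ := ∑ u, f u v - ∑ w, f (some v) w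

theorem excess_add (f f' : LinkTime W) (v : Fin W) :
    excess (f + f') v = excess f v + excess f' v := by
  simp only [excess, Pi.add_apply, Finset.sum_add_distrib]
  ring

/-- A unit of flow along one link. -/
def unitFlow (a : Option (Fin W)) (w : Fin W) : LinkTime W :=
  fun a' w' => if a' = a ∧ w' = w then 1 else 0

theorem excess_unitFlow (a : Option (Fin W)) (w v : Fin W) :
    excess (unitFlow a w) v = (if some w = some v then 1 else 0) - if a = some v then 1 else 0 := by
  simp only [excess, unitFlow, ite_and, Finset.sum_ite_eq', Finset.mem_univ, if_true,
    Option.some_inj, eq_comm (a := w), eq_comm (a := a)]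
  congr 1
  by_cases h : some v = a <;> simp [h]

theorem exists_pathFlow {r : Option (Fin W) → Fin W → Prop} {a b : Option (Fin W)}
    (h : Relation.ReflTransGen (fun a b => ∃ w, b = some w ∧ r a w) a b) :
    ∃ f : LinkTime W, (∀ u v, 0 ≤ f u v) ∧ (∀ u v, ¬ r u v → f u v = 0) ∧
      ∀ v, excess f v = (if b = some v then 1 else 0) - if a = some v then 1 else 0 := by
  induction h with
  | refl => exact ⟨0, fun _ _ => le_rfl, fun _ _ _ => rfl, fun v => by simp [excess]⟩
  | @tail b c _ hbc ih =>
    obtain ⟨w, rfl, hw⟩ := hbc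
    obtain ⟨f, h0, h1, h2⟩ := ih
    refine ⟨f + unitFlow b w, fun u v => add_nonneg (h0 u v) ?_, fun u v hr => ?_, fun v => ?_⟩
    · unfold unitFlow; split_ifs <;> norm_num
    · have : ¬ (u = b ∧ v = w) := by rintro ⟨rfl, rfl⟩; exact hr hw
      simp [h1 u v hr, unitFlow, this]
    · rw [excess_add, h2, excess_unitFlow]
      ring

/-- If every base station can be reached, then sending a small flow along a path to each base
station, one link at a time, gives all of them positive throughput. -/
theorem maxMinThroughput_pos (hW : 1 ≤ W) (hR : 1 ≤ R) {θ : ℝ} (hθ : N.IsMaxMinThroughput R θ)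
    (hreach : N.Reachable) : 0 < θ := by
  classical
  have : Nonempty (Fin W) := ⟨⟨0, hW⟩⟩
  choose f f0 f1 f2 using fun v => exists_pathFlow (hreach v)
  let F : LinkTime W := ∑ v, f v
  have F0 : ∀ u v, 0 ≤ F u v := fun u v => by
    simp only [F, Finset.sum_apply]
    exact Finset.sum_nonneg fun x _ => f0 x u v
  have F1 : ∀ u v, ¬ N.link u v → F u v = 0 := fun u v hl => by
    simp only [F, Finset.sum_apply]
    exact Finset.sum_eq_zero fun x _ => f1 x u v hl
  have F2 : ∀ v, excess F v = 1 := fun v => by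
    have hF : excess F v = ∑ x, excess (f x) v := by
      simp only [excess, F, Finset.sum_apply, Finset.sum_sub_distrib]
      rw [Finset.sum_comm, Finset.sum_comm (f := fun w x => f x (some v) w)]
    rw [hF]
    simp [f2]
  let y : XLink W R → ℝ := fun e => match e with
    | (.inl r, v) => if r = ⟨0, hR⟩ then F none v / N.cap none v else 0
    | (.inr u, v) => F (some u) v / N.cap (some u) v
  have hdiv : ∀ u v, 0 ≤ F u v / N.cap u v := fun u v => by
    by_cases hl : N.link u v
    · exact div_nonneg (F0 u v) (N.cap_pos u v hl).le
    · simp [F1 u v hl]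
  have y0 : ∀ e, 0 ≤ y e := by
    rintro ⟨r | u, v⟩
    · simp only [y]; split_ifs; exacts [hdiv _ _, le_rfl]
    · exact hdiv _ _
  have y1 : ∀ e, ¬ N.link e.1.base e.2 → y e = 0 := by
    rintro ⟨r | u, v⟩ hl
    · simp [y, F1 none v hl]
    · simp [y, F1 (some u) v hl]
  have hcol : ∀ u v, collapse y u v = F u v / N.cap u v := by
    rintro (_ | u) v
    · simp [collapse, y]
    · rfl
  have hthr : ∀ v, N.throughput (collapse y) v = 1 := by
    intro v
    rw [← F2 v]
    have : ∀ u v, N.cap u v * collapse y u v = F u v := fun u v => by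
      rw [hcol]
      by_cases hl : N.link u v
      · exact mul_div_cancel₀ _ (N.cap_pos u v hl).ne'
      · simp [F1 u v hl]
    simp only [Network.throughput, this, excess]
  have hsum : 0 ≤ ∑ e, y e := Finset.sum_nonneg fun e _ => y0 e
  obtain ⟨ε, hε, hε1⟩ : ∃ ε : ℝ, 0 < ε ∧ ε * ∑ e, y e ≤ 1 := by
    refine ⟨1 / (1 + ∑ e, y e), by positivity, ?_⟩
    rw [one_div_mul_eq_div, div_le_one (by positivity)]
    linarith
  have hmem : ε • y ∈ matchingPolytope N R := by
    have hy : ε • y = ∑ e, (ε * y e) • (if N.link e.1.base e.2 then incidence {e} else 0) := by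
      ext e
      simp only [Finset.sum_apply, Pi.smul_apply, smul_eq_mul]
      rw [Finset.sum_eq_single e]
      · by_cases hl : N.link e.1.base e.2
        · simp [hl, incidence]
        · simp [y1 e hl]
      · intro e' _ hne
        split_ifs
        · simp [incidence, hne.symm]
        · simp
      · simp
    rw [hy]
    refine Convex.sum_mem_of_zero_mem (convex_convexHull ℝ _) zero_mem_matchingPolytope _
      (fun e _ => mul_nonneg hε.le (y0 e)) (by rwa [← Finset.mul_sum]) fun e _ => ?_
    split_ifs with hl
    · exact incidence_mem ⟨by simpa using hl, by simp⟩
    · exact zero_mem_matchingPolytope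
  obtain ⟨S, hS⟩ := exists_schedule_iff.2 hmem
  refine lt_of_lt_of_le ?_ (hθ.2 ⟨S, rfl⟩)
  change 0 < N.minThroughput (collapse S.time)
  rw [hS, isLinearMap_collapse.map_smul, minThroughput_smul hε.le, Network.minThroughput]
  simp [hthr, hε]

end

/-! ### Eliminating directed cycles -/

section

variable {W R : ℕ} {N : Network W}

/-- Shortening the links between base stations keeps link times feasible: the times `τ` can be
scaled by the same factor as the total time of these links. -/
theorem StepOneFeasible.shorten {s t : LinkTime W} (ht : StepOneFeasible N R t)
    (h0 : ∀ u v, 0 ≤ s u v) (hst : ∀ u v, s u v ≤ t u v) : StepOneFeasible N R s := by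
  obtain ⟨τ, t1, t2, t3, t4⟩ := ht.idle
  have hB : ∑ u, ∑ v, s (some u) v ≤ ∑ u, ∑ v, t (some u) v :=
    Finset.sum_le_sum fun u _ => Finset.sum_le_sum fun v _ => hst _ _
  have hB0 : 0 ≤ ∑ u, ∑ v, s (some u) v :=
    Finset.sum_nonneg fun u _ => Finset.sum_nonneg fun v _ => h0 _ _
  obtain ⟨ρ, hρ0, hρ1, hρ⟩ : ∃ ρ : ℝ, 0 ≤ ρ ∧ ρ ≤ 1 ∧
      ρ * ∑ u, ∑ v, t (some u) v = ∑ u, ∑ v, s (some u) v := by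
    rcases (hB0.trans hB).eq_or_lt with h | h
    · exact ⟨0, le_rfl, zero_le_one, by linarith⟩
    · exact ⟨_, div_nonneg hB0 h.le, (div_le_one h).2 hB, div_mul_cancel₀ _ h.ne'⟩
  refine ⟨h0, fun u v hl => le_antisymm ((hst u v).trans_eq (ht.support u v hl)) (h0 u v),
    fun v => le_trans (add_le_add (Finset.sum_le_sum fun u _ => hst u v)
      (Finset.sum_le_sum fun w _ => hst _ w)) (ht.station v),
    fun k => ρ * τ k, fun k hk => mul_nonneg hρ0 (t1 k hk), ?_, ?_, ?_⟩
  · rw [← Finset.mul_sum]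
    exact mul_le_one₀ hρ1 (Finset.sum_nonneg t1) t2
  · simp only [mul_left_comm _ ρ, ← Finset.mul_sum, t3, hρ]
  · simp only [mul_left_comm _ ρ, ← Finset.mul_sum]
    have h1 : ∑ v, s none v ≤ ∑ v, t none v := Finset.sum_le_sum fun v _ => hst _ v
    have h2 : 0 ≤ ∑ k ∈ Finset.Icc 1 (W / 2), max 0 ((R : ℝ) - W + 2 * k) * τ k :=
      Finset.sum_nonneg fun k hk => mul_nonneg (le_max_left _ _) (t1 k hk)
    have h3 := mul_le_of_le_one_left h2 hρ1
    linarith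

/-- A directed cycle of links with positive time carries a circulation that uses no gateway link. -/
theorem exists_cycleFlow {s : LinkTime W} (hs : ¬ NoDirectedCycle s) :
    ∃ f : LinkTime W, (∀ u v, 0 ≤ f u v) ∧ (∀ v, f none v = 0) ∧
      (∀ u v, ¬ 0 < s (some u) v → f (some u) v = 0) ∧ (∀ v, excess f v = 0) ∧
      ∃ u v, 0 < f (some u) v := by
  unfold NoDirectedCycle at hs
  push Not at hs
  obtain ⟨v, hv⟩ := hs
  obtain ⟨w, hvw, hwv⟩ := Relation.TransGen.head'_iff.1 hv
  obtain ⟨f, f0, f1, f2⟩ := exists_pathFlow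
    (r := fun a w => ∃ u, a = some u ∧ 0 < s (some u) w) (a := some w) (b := some v)
    (hwv.lift some fun a b hab => ⟨b, rfl, a, rfl, hab⟩)
  have hu : ∀ a b, 0 ≤ unitFlow (some v) w a b := fun a b => by
    unfold unitFlow; split_ifs <;> norm_num
  refine ⟨f + unitFlow (some v) w, fun a b => add_nonneg (f0 a b) (hu a b), fun b => ?_,
    fun a b hab => ?_, fun x => ?_, v, w, ?_⟩
  · have h1 := f1 none b (by simp)
    simp [h1, unitFlow]
  · have h1 := f1 (some a) b (by simpa using hab)
    have h2 : ¬ (a = v ∧ b = w) := by rintro ⟨rfl, rfl⟩; exact hab hvw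
    simp [h1, unitFlow, h2]
  · rw [excess_add, f2, excess_unitFlow]
    ring
  · have h1 := f0 (some v) w
    have h2 : unitFlow (some v) w (some v) w = 1 := by simp [unitFlow]
    simp only [Pi.add_apply, h2]
    linarith

/-- Among the link times `s ≤ t` with the same gateway links and the same throughput, those with the
least total time have no directed cycle, since a circulation could be subtracted from it. -/
theorem exists_noDirectedCycle {t : LinkTime W} (ht : IsFairLinkTime N R t) :
    ∃ s : LinkTime W, (∀ u v, s u v ≤ t u v) ∧ IsFairLinkTime N R s ∧ NoDirectedCycle s := by
  let K : Set (LinkTime W) := Set.Icc 0 t ∩ {s | s none = t none ∧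
    ∀ v, N.throughput s v = N.throughput t v}
  have hK : IsCompact K := by
    refine isCompact_Icc.inter_right ((isClosed_eq (by fun_prop) (by fun_prop)).inter ?_)
    have : {s | ∀ v, N.throughput s v = N.throughput t v} =
        ⋂ v, {s | N.throughput s v = N.throughput t v} := by ext; simp
    change IsClosed {s | ∀ v, N.throughput s v = N.throughput t v}
    rw [this]
    refine isClosed_iInter fun v => isClosed_eq ?_ continuous_const
    unfold Network.throughput
    fun_prop
  have htK : t ∈ K := ⟨⟨fun u v => ht.feasible.nonneg u v, le_rfl⟩, rfl, fun _ => rfl⟩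
  obtain ⟨s, ⟨⟨hs0, hst⟩, hnone, hthr⟩, hmin⟩ := hK.exists_isMinOn ⟨t, htK⟩
    (f := fun s : LinkTime W => ∑ u, ∑ v, s u v) (by fun_prop)
  have hmT : N.minThroughput s = N.minThroughput t := by simp only [Network.minThroughput, hthr]
  have hfeas := ht.feasible.shorten hs0 hst
  refine ⟨s, hst, ⟨hfeas, fun x hx => hmT ▸ ht.fair x hx, fun x hx hle => ?_⟩, ?_⟩
  · rw [hnone]
    exact ht.total x hx (hmT ▸ hle)
  by_contra hcyc
  obtain ⟨f, f0, fnone, fpos, fex, u₀, v₀, huv⟩ := exists_cycleFlow hcyc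
  have hcap : ∀ u v, f u v ≠ 0 → 0 < s u v ∧ 0 < N.cap u v := by
    rintro (_ | u) v hf
    · exact absurd (fnone v) hf
    · have : 0 < s (some u) v := by
        by_contra h
        exact hf (fpos u v h)
      refine ⟨this, N.cap_pos _ _ ?_⟩
      by_contra h
      rw [hfeas.support _ _ h] at this
      exact this.false
  have hdiv : ∀ u v, 0 ≤ f u v / N.cap u v := fun u v => by
    by_cases h : f u v = 0
    · simp [h]
    · exact div_nonneg (f0 u v) (hcap u v h).2.le
  obtain ⟨ε, hε, hle⟩ : ∃ ε : ℝ, 0 < ε ∧ ∀ u v, ε * (f u v / N.cap u v) ≤ s u v := by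
    have h1 : ∀ᶠ ε in nhdsWithin (0 : ℝ) (Set.Ioi 0), ∀ u v, ε * (f u v / N.cap u v) ≤ s u v := by
      refine Filter.eventually_all.2 fun u => Filter.eventually_all.2 fun v => ?_
      by_cases h : f u v = 0
      · exact Filter.Eventually.of_forall fun ε => by simpa [h] using hs0 u v
      · refine Filter.Eventually.filter_mono nhdsWithin_le_nhds ?_
        have hc : Filter.Tendsto (fun ε : ℝ => ε * (f u v / N.cap u v)) (nhds 0)
            (nhds (0 * (f u v / N.cap u v))) := (Continuous.tendsto (by fun_prop) 0)
        rw [zero_mul] at hc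
        exact (hc.eventually_lt_const (hcap u v h).1).mono fun _ => le_of_lt
    obtain ⟨ε, h2, h3⟩ := (h1.and self_mem_nhdsWithin).exists
    exact ⟨ε, h3, h2⟩
  have hcapmul : ∀ u v, N.cap u v * (f u v / N.cap u v) = f u v := fun u v => by
    by_cases h : f u v = 0
    · simp [h]
    · exact mul_div_cancel₀ _ (hcap u v h).2.ne'
  have hmem : (fun u v => s u v - ε * (f u v / N.cap u v)) ∈ K := by
    refine ⟨⟨fun u v => sub_nonneg.2 (hle u v), fun u v =>
      (sub_le_self _ (mul_nonneg hε.le (hdiv u v))).trans (hst u v)⟩, ?_, fun v => ?_⟩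
    · funext v
      simp [fnone, hnone]
    · rw [← hthr v]
      have h1 := fex v
      simp only [excess] at h1
      simp only [Network.throughput, mul_sub, mul_left_comm _ ε, hcapmul, Finset.sum_sub_distrib,
        ← Finset.mul_sum]
      linear_combination (-ε) * h1
  have h1 := isMinOn_iff.1 hmin _ hmem
  simp only [Finset.sum_sub_distrib, ← Finset.mul_sum] at h1
  have h2 : 0 < ∑ u, ∑ v, f u v / N.cap u v :=
    Finset.sum_pos' (fun u _ => Finset.sum_nonneg fun v _ => hdiv u v) ⟨some u₀, Finset.mem_univ _,
      Finset.sum_pos' (fun v _ => hdiv _ v) ⟨v₀, Finset.mem_univ _,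
        div_pos huv (hcap _ _ huv.ne').2⟩⟩
  nlinarith

end

end MmWave

theorem theorem2 :
    -- step (ii) is carried out by one program within the claimed time
    (∃ (prog : Prog) (C : ℝ),
      ∀ (W R : ℕ) (N : Network W) (g : ℝ) (t : LinkTime W),
        1 ≤ R → R ≤ W → 0 < g → g ≤ 1 → StepOneFeasible N R t → NoDirectedCycle t →
        ∃ (n : ℕ) (m : Mem) (κ : ℕ) (col : Piece R g t → Fin κ),
          Runs prog (inputMem R g t) n m ∧
          (n : ℝ) ≤ C * (((W : ℝ) ^ 2 + W / g) * Real.log (W + 1 / g)) ∧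
          (colouringGraph R g t).IsKarloffColouring col ∧
          HoldsSchedule R g t col m) ∧
    -- its quality, for every colouring with the guaranteed number of colours
    (∀ (W R : ℕ) (N : Network W) (g : ℝ) (t : LinkTime W),
      1 ≤ W → 1 ≤ R → 0 < g → g ≤ 1 → StepOneFeasible N R t → NoDirectedCycle t →
      ∀ (κ : ℕ) (col : Piece R g t → Fin κ),
        (colouringGraph R g t).IsProper col →
        κ ≤ 3 * (colouringGraph R g t).halfDegree →
        -- the result is a unit length schedule
        (∃ S : UnitSchedule N R, S.time = finalTime R g t col) ∧
        -- any performance metric that scales with the schedule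
        (∀ μ : LinkTime W → ℝ, (∀ ρ : ℝ, 0 < ρ → ∀ s, μ (ρ • s) = ρ * μ s) → 0 ≤ μ t →
          2 / (3 * ((W + R + 1) * g + 1)) * μ t ≤ μ (collapse (finalTime R g t col)) ∧
          (0 < μ t →
            2 / (3 * ((W + R + 1) * g + 1)) * μ t < μ (collapse (finalTime R g t col)))) ∧
        -- the max-min throughput
        (IsFairLinkTime N R t →
          ∃ θ : ℝ, N.IsMaxMinThroughput R θ ∧
            2 / (3 * ((W + R + 1) * g + 1)) * θ
              ≤ N.minThroughput (collapse (finalTime R g t col)) ∧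
            (0 < θ → 2 / (3 * ((W + R + 1) * g + 1)) * θ
              < N.minThroughput (collapse (finalTime R g t col))) ∧
            (N.Reachable → 0 < θ))) ∧
    -- directed cycles can be eliminated by shortening optimal link times
    (∀ (W R : ℕ) (N : Network W) (t : LinkTime W), 1 ≤ W → 1 ≤ R → IsFairLinkTime N R t →
      ∃ s : LinkTime W, (∀ u v, s u v ≤ t u v) ∧ IsFairLinkTime N R s ∧ NoDirectedCycle s) := by
  refine ⟨⟨scheduleProg, 13600, ?_⟩, ?_, fun W R N t _ _ ht => exists_noDirectedCycle ht⟩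
  · intro W R N g t hR hRW hg hg1 ht hc
    have hW := hR.trans hRW
    obtain ⟨n, m, κ, col, hrun, hn, hcol, hm⟩ := ev_scheduleProg_inputMem hW hR hg ht.nonneg
    exact ⟨n, m, κ, col, hrun, steps_le hR hRW hg hg1 (halfDegree_le hW hR hg ht hc) hn, hcol, hm⟩
  · intro W R N g t hW hR hg _ ht hc κ col hcol hκ
    have hscale := lt_scaleFactor hW hR hg ht hc hκ
    rw [collapse_finalTime ht.nonneg hg hR]
    refine ⟨exists_schedule_iff.2 (finalTime_mem hg ht hcol), fun μ hμ h0 => ?_, fun hfair => ?_⟩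
    · rw [hμ _ (scaleFactor_pos g κ)]
      exact ⟨mul_le_mul_of_nonneg_right hscale.le h0, fun h => mul_lt_mul_of_pos_right hscale h⟩
    · obtain ⟨θ, hθ⟩ := exists_isMaxMinThroughput (N := N) (R := R) hW
      have hle := maxMinThroughput_le hfair hθ
      have hfac : 0 ≤ 2 / (3 * (((W : ℝ) + R + 1) * g + 1)) := by positivity
      have hθt := mul_le_mul_of_nonneg_left hle hfac
      rw [minThroughput_smul (scaleFactor_pos g κ).le]
      exact ⟨θ, hθ, hθt.trans (mul_le_mul_of_nonneg_right hscale.le (minThroughput_nonneg hfair)),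
        fun h => hθt.trans_lt (mul_lt_mul_of_pos_right hscale (h.trans_le hle)),
        maxMinThroughput_pos hW hR hθ⟩
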